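/- Work on a word RAM with words of $O(\log n)$ bits and unit-cost instructions; algorithms are deterministic. In the OMv problem an algorithm receives $n\ge 1$ and a Boolean matrix $M\in\{0,1\}^{n\times n}$, and then $n$ vectors $v^1,\dots,v^n\in\{0,1\}^n$ one at a time; it has to output the Boolean product $Mv^i$ before it sees $v^{i+1}$. The OMv conjecture says that for no $\varepsilon>0$ is there an algorithm that solves OMv in total time $O(n^{3-\varepsilon})$, preprocessing of $M$ included. In incremental (decremental) maximum cardinality bipartite matching an algorithm maintains a bipartite graph with $n$ vertices on each side, initially the empty graph (the complete bipartite graph), under a sequence of insertions of absent edges (deletions of present edges) and queries that arrive one at a time; each query has to be answered with the size of a maximum matching of the current graph. **Theorem.** Assume the OMv conjecture and let $\varepsilon>0$. Then there is no algorithm for incremental maximum cardinality bipartite matching with amortized time $O(n^{1-\varepsilon})$ per insertion and $O(n^{2-\varepsilon})$ per query, and there is no algorithm for decremental maximum cardinality bipartite matching with amortized time $O(n^{1-\varepsilon})$ per deletion and $O(n^{2-\varepsilon})$ per query. This holds even if $O(n^{3-\varepsilon})$ time may be charged to the initial graph: there are no algorithm and constant $C$ such that for all $n\ge1$ every sequence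 of $k$ updates and $q$ queries, together with the initialization, takes at most $C\,(n^{3-\varepsilon}+k\,n^{1-\varepsilon}+q\,n^{2-\varepsilon})$ steps. -/

import Mathlib

/-! ### Word RAM -/

/-- The arithmetic, bitwise and comparison instructions of the machine. -/
inductive BinOp
  | add | sub | mul | div | mod | land | lor | lxor | shl | shr | eq | lt

/-- Subtraction is truncated, division by zero gives zero, comparisons give `0` or `1`. -/
def BinOp.eval : BinOp → ℕ → ℕ → ℕ
  | .add, a, b => a + b
  | .sub, a, b => a - b
  | .mul, a, b => a * b
  | .div, a, b => a / b
  | .mod, a, b => a % b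
  | .land, a, b => a &&& b
  | .lor, a, b => a ||| b
  | .lxor, a, b => a ^^^ b
  | .shl, a, b => a <<< b
  | .shr, a, b => a >>> b
  | .eq, a, b => if a = b then 1 else 0
  | .lt, a, b => if a < b then 1 else 0

/-- Word RAM programs in structured form. A program is a finite object, so it mentions only a
constant number of registers (`x`, `y`, `z`) and a constant number of arrays (`a`); the cells of
an array are addressed by the content of a register. -/
inductive Prog
  | skip
  /-- `x := k` -/
  | const (x k : ℕ)
  /-- `x := f y z` -/
  | op (f : BinOp) (x y z : ℕ)
  /-- `x := a[y]` -/
  | load (x a y : ℕ)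
  /-- `a[y] := x` -/
  | store (a y x : ℕ)
  | seq (p q : Prog)
  /-- if register `x` is nonzero then `p` else `q` -/
  | ite (x : ℕ) (p q : Prog)
  /-- while register `x` is nonzero do `p` -/
  | loop (x : ℕ) (p : Prog)

/-- `m a i` is the content of cell `i` of array `a`. -/
abbrev Memory := ℕ → ℕ → ℕ

/-- A machine state: the registers and the memory. -/
structure MState where
  reg : ℕ → ℕ
  mem : Memory

def MState.setReg (s : MState) (x k : ℕ) : MState :=
  { s with reg := Function.update s.reg x k }

def MState.setCell (s : MState) (a i k : ℕ) : MState :=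
  { s with mem := Function.update s.mem a (Function.update (s.mem a) i k) }

/-- `Exec w p s t s'`: on a machine with `w`-bit words, program `p` started in state `s` halts in
state `s'` after exactly `t` steps. Every instruction and every test costs one step. A value that
does not fit into `w` bits is an overflow, on which the machine is stuck (there is no `s'`). -/
inductive Exec (w : ℕ) : Prog → MState → ℕ → MState → Prop
  | skip (s : MState) : Exec w .skip s 1 s
  | const (s : MState) (x k : ℕ) (h : k < 2 ^ w) : Exec w (.const x k) s 1 (s.setReg x k)
  | op (s : MState) (f : BinOp) (x y z : ℕ) (h : f.eval (s.reg y) (s.reg z) < 2 ^ w) :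
      Exec w (.op f x y z) s 1 (s.setReg x (f.eval (s.reg y) (s.reg z)))
  | load (s : MState) (x a y : ℕ) (h : s.mem a (s.reg y) < 2 ^ w) :
      Exec w (.load x a y) s 1 (s.setReg x (s.mem a (s.reg y)))
  | store (s : MState) (a y x : ℕ) : Exec w (.store a y x) s 1 (s.setCell a (s.reg y) (s.reg x))
  | seq {p q : Prog} {s₁ s₂ s₃ : MState} {t₁ t₂ : ℕ}
      (hp : Exec w p s₁ t₁ s₂) (hq : Exec w q s₂ t₂ s₃) : Exec w (.seq p q) s₁ (t₁ + t₂) s₃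
  | ite_true {x : ℕ} {p q : Prog} {s s' : MState} {t : ℕ} (hx : s.reg x ≠ 0)
      (hp : Exec w p s t s') : Exec w (.ite x p q) s (t + 1) s'
  | ite_false {x : ℕ} {p q : Prog} {s s' : MState} {t : ℕ} (hx : s.reg x = 0)
      (hq : Exec w q s t s') : Exec w (.ite x p q) s (t + 1) s'
  | loop_done {x : ℕ} {p : Prog} {s : MState} (hx : s.reg x = 0) : Exec w (.loop x p) s 1 s
  | loop_step {x : ℕ} {p : Prog} {s₁ s₂ s₃ : MState} {t₁ t₂ : ℕ} (hx : s₁.reg x ≠ 0)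
      (hp : Exec w p s₁ t₁ s₂) (hl : Exec w (.loop x p) s₂ t₂ s₃) :
      Exec w (.loop x p) s₁ (t₁ + t₂ + 1) s₃

/-- The machine is deterministic: the halting state and the number of steps are functions of the
program and the starting state. -/
theorem Exec.deterministic {w : ℕ} {p : Prog} {s : MState} {t₁ t₂ : ℕ} {s₁ s₂ : MState}
    (h₁ : Exec w p s t₁ s₁) (h₂ : Exec w p s t₂ s₂) : t₁ = t₂ ∧ s₁ = s₂ := by
  induction h₁ generalizing t₂ s₂ with
  | skip | const | op | load | store => cases h₂; exact ⟨rfl, rfl⟩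
  | seq _ _ ihp ihq =>
    cases h₂ with
    | seq hp hq =>
      obtain ⟨rfl, rfl⟩ := ihp hp
      obtain ⟨rfl, rfl⟩ := ihq hq
      exact ⟨rfl, rfl⟩
  | ite_true hx _ ih =>
    cases h₂ with
    | ite_true _ h => obtain ⟨rfl, rfl⟩ := ih h; exact ⟨rfl, rfl⟩
    | ite_false hx' _ => exact absurd hx' hx
  | ite_false hx _ ih =>
    cases h₂ with
    | ite_true hx' _ => exact absurd hx hx'
    | ite_false _ h => obtain ⟨rfl, rfl⟩ := ih h; exact ⟨rfl, rfl⟩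
  | loop_done hx =>
    cases h₂ with
    | loop_done _ => exact ⟨rfl, rfl⟩
    | loop_step hx' _ _ => exact absurd hx hx'
  | loop_step hx _ _ ihp ihl =>
    cases h₂ with
    | loop_done hx' => exact absurd hx' hx
    | loop_step _ hp hl =>
      obtain ⟨rfl, rfl⟩ := ihp hp
      obtain ⟨rfl, rfl⟩ := ihl hl
      exact ⟨rfl, rfl⟩

/-- The memory is initially all zero. -/
def Memory.zero : Memory := fun _ _ => 0

/-- The environment writes a list of words into the first cells of array `0`. -/
def Memory.withInput (m : Memory) (l : List ℕ) : Memory :=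
  Function.update m 0 (fun i => l.getD i (m 0 i))

/-- One call of a routine of an interactive algorithm. The memory persists between calls, the
registers are cleared; the arguments of the call are found in the first cells of array `0`.
The answer of a call is read off the first cells of array `1` of the resulting memory `m'`. -/
def Call (w : ℕ) (p : Prog) (input : List ℕ) (m : Memory) (t : ℕ) (m' : Memory) : Prop :=
  ∃ r : ℕ → ℕ, Exec w p ⟨fun _ => 0, m.withInput input⟩ t ⟨r, m'⟩

/-- Words of `c (⌊log₂ n⌋ + 1)` bits, that is, of `O(log n)` bits. -/
def wordSize (c n : ℕ) : ℕ := c * (Nat.log 2 n + 1)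

/-! ### Online Boolean matrix-vector multiplication -/

/-- An algorithm for OMv: a routine that receives `n` and the matrix, and a routine that receives
one vector and returns the product. -/
structure OMvAlg where
  setup : Prog
  multiply : Prog

/-- The input `n, M₀₀, M₀₁, …` (row by row). -/
def encodeMatrix {n : ℕ} (M : Matrix (Fin n) (Fin n) Bool) : List ℕ :=
  n :: (List.ofFn fun i => List.ofFn fun j => (M i j).toNat).flatten

def encodeVector {n : ℕ} (v : Fin n → Bool) : List ℕ :=
  List.ofFn fun j => (v j).toNat

/-- The Boolean matrix-vector product. -/
def boolMulVec {n : ℕ} (M : Matrix (Fin n) (Fin n) Bool) (v : Fin n → Bool) (i : Fin n) : Bool :=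
  decide (∃ j, M i j = true ∧ v j = true)

/-- Started with memory `m`, the algorithm answers the vectors of the list one after the other,
each correctly, and in `T` steps altogether. The call for a vector depends on nothing but
that vector and the memory left behind by the earlier calls. -/
def OMvAlg.Answers (A : OMvAlg) (w : ℕ) {n : ℕ} (M : Matrix (Fin n) (Fin n) Bool) :
    Memory → List (Fin n → Bool) → ℕ → Prop
  | _, [], T => T = 0
  | m, v :: vs, T => ∃ (t : ℕ) (m' : Memory) (T' : ℕ),
      Call w A.multiply (encodeVector v) m t m' ∧
      (∀ i : Fin n, m' 1 i = (boolMulVec M v i).toNat) ∧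
      A.Answers w M m' vs T' ∧ T = t + T'

/-- `A` solves OMv (an `n × n` matrix followed by `n` vectors, one at a time) in total time
`O(f n)`, preprocessing included, on a word RAM with `O(log n)`-bit words. -/
def OMvAlg.SolvesIn (A : OMvAlg) (f : ℕ → ℝ) : Prop :=
  ∃ (c : ℕ) (C : ℝ), 0 < c ∧ ∀ n : ℕ, 1 ≤ n →
    ∀ (M : Matrix (Fin n) (Fin n) Bool) (vs : List (Fin n → Bool)), vs.length = n →
      ∃ (t : ℕ) (m : Memory) (T : ℕ),
        Call (wordSize c n) A.setup (encodeMatrix M) Memory.zero t m ∧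
        A.Answers (wordSize c n) M m vs T ∧
        (t + T : ℝ) ≤ C * f n

/-- The OMv conjecture: no algorithm solves OMv in time `O(n ^ (3 - ε))`, for any `ε > 0`. -/
def OMvConjecture : Prop :=
  ∀ ε : ℝ, 0 < ε → ¬ ∃ A : OMvAlg, A.SolvesIn fun n => (n : ℝ) ^ (3 - ε)

/-! ### Partially dynamic maximum cardinality bipartite matching -/

/-- The edge set of a bipartite graph with `n` vertices on each side. -/
abbrev BipEdges (n : ℕ) := Finset (Fin n × Fin n)

/-- The bipartite graph in which `u` on the left is adjacent to `v` on the right iff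
`(u, v) ∈ E`. -/
def BipEdges.graph {n : ℕ} (E : BipEdges n) : SimpleGraph (Fin n ⊕ Fin n) :=
  SimpleGraph.fromRel fun x y => ∃ u v, x = Sum.inl u ∧ y = Sum.inr v ∧ (u, v) ∈ E

/-- `k` is the size (number of edges) of a maximum cardinality matching of `G`. -/
def IsMaxMatchingSize {V : Type*} (G : SimpleGraph V) (k : ℕ) : Prop :=
  IsGreatest {j : ℕ | ∃ M : G.Subgraph, M.IsMatching ∧ M.edgeSet.ncard = j} k

/-- The two partially dynamic settings. -/
inductive Setting
  | incremental
  | decremental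

/-- The initial graph: empty in the incremental setting, complete bipartite in the decremental
setting. -/
def Setting.start : Setting → (n : ℕ) → BipEdges n
  | .incremental, _ => ∅
  | .decremental, _ => Finset.univ

/-- An edge may be inserted if it is absent, and deleted if it is present. -/
def Setting.Allowed : Setting → {n : ℕ} → BipEdges n → Fin n × Fin n → Prop
  | .incremental, _, E, e => e ∉ E
  | .decremental, _, E, e => e ∈ E

/-- The graph after the update (insertion or deletion) of the edge `e`. -/
def Setting.apply : Setting → {n : ℕ} → BipEdges n → Fin n × Fin n → BipEdges n
  | .incremental, _, E, e => insert e E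
  | .decremental, _, E, e => E.erase e

/-- The operations: an update (insertion or deletion, according to the setting) of an edge, and
a query for the size of a maximum matching. -/
inductive MatchOp (n : ℕ)
  | update (e : Fin n × Fin n)
  | query

/-- The sequence of operations is legal when started from the graph `E`. -/
def Setting.Legal (S : Setting) {n : ℕ} : BipEdges n → List (MatchOp n) → Prop
  | _, [] => True
  | E, .update e :: ops => S.Allowed E e ∧ S.Legal (S.apply E e) ops
  | E, .query :: ops => S.Legal E ops

def numUpdates {n : ℕ} : List (MatchOp n) → ℕ
  | [] => 0
  | .update _ :: ops => numUpdates ops + 1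
  | .query :: ops => numUpdates ops

def numQueries {n : ℕ} : List (MatchOp n) → ℕ
  | [] => 0
  | .update _ :: ops => numQueries ops
  | .query :: ops => numQueries ops + 1

/-- A partially dynamic matching algorithm: a routine that receives `n` and sets up the data
structure for the initial graph, a routine that receives the end points of an edge and performs
the update, and a routine that answers a query. -/
structure MatchingAlg where
  setup : Prog
  update : Prog
  query : Prog

/-- Started with memory `m` and current graph `E`, the algorithm performs the operations one after
the other, answers every query correctly, and takes `T` steps altogether. -/
def MatchingAlg.Serves (A : MatchingAlg) (S : Setting) (w : ℕ) {n : ℕ} :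
    BipEdges n → Memory → List (MatchOp n) → ℕ → Prop
  | _, _, [], T => T = 0
  | E, m, .update e :: ops, T => ∃ (t : ℕ) (m' : Memory) (T' : ℕ),
      Call w A.update [(e.1 : ℕ), (e.2 : ℕ)] m t m' ∧
      A.Serves S w (S.apply E e) m' ops T' ∧ T = t + T'
  | E, m, .query :: ops, T => ∃ (t : ℕ) (m' : Memory) (T' : ℕ),
      Call w A.query [] m t m' ∧
      IsMaxMatchingSize E.graph (m' 1 0) ∧
      A.Serves S w E m' ops T' ∧ T = t + T'

/-- `A` solves partially dynamic maximum cardinality bipartite matching on a word RAM with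
`O(log n)`-bit words, with amortized time `O(upd n)` per update and `O(qry n)` per query:
for every legal sequence of operations from the initial graph, the total time is at most
a constant times the sum of the amortized bounds of the operations, plus the cost `O(start n)`
that is charged to the initial graph. -/
def MatchingAlg.Solves (A : MatchingAlg) (S : Setting) (start upd qry : ℕ → ℝ) : Prop :=
  ∃ (c : ℕ) (C : ℝ), 0 < c ∧ ∀ n : ℕ, 1 ≤ n →
    ∃ (t : ℕ) (m : Memory),
      Call (wordSize c n) A.setup [n] Memory.zero t m ∧
      ∀ ops : List (MatchOp n), S.Legal (S.start n) ops →
        ∃ T : ℕ, A.Serves S (wordSize c n) (S.start n) m ops T ∧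
          (t + T : ℝ) ≤ C * (start n + numUpdates ops * upd n + numQueries ops * qry n)

/-! The core is a gadget that evaluates a bilinear form `uᵀMv` over the Booleans for an `s × s`
block `M` with one matching query. The edges `lᵢ l'ᵢ` and `rⱼ r'ⱼ` form a matching of size `2s`, and
`rⱼ l'ᵢ` is an edge iff `M i j`. Joining `lᵢ` to a fresh vertex `s_k` for `u i`, and a fresh vertex
`t_k` to `r'ⱼ` for `v j`, creates an augmenting path `t_k r'ⱼ rⱼ l'ᵢ lᵢ s_k` exactly when `u i`, `M
i j` and `v j` hold for some `i, j`. If there are no such indices, a vertex cover of size `2s`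
certifies that the matching cannot grow (`QueryGraph.lt_answer`, `QueryGraph.answer_le`).

Updates cannot be undone, so each of `s` successive phases has its own pair `s_k, t_k`, and other
phases are kept harmless by edges `tⱼ yⱼ` and `xⱼ sⱼ`: such a pair raises the matching and the cover
by two alike. With insertions, a phase is neutralized after its query. With deletions, all phases
start neutralized and with complete stars; a phase deletes the superfluous star edges and its
neutralizing edges, asks, and then deletes the rest of its stars. No edge is updated twice, so an
instance on `4s + 4s` vertices sees at most `16s²` updates and `s` queries, which cost `O(s^(3-ε))`
together with its initialization.

For OMv, take `s` about `n^(1/3)`, cut the matrix into `s × s` blocks and the vectors into epochs of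
length `s`, and keep one instance per block and epoch. For a new vector, each block is tested with
`u` marking the rows whose output bit is still `0`. A negative answer means that the block adds
nothing; after a positive one it is multiplied naively in `O(s²)` steps, which sets a new output bit
and hence happens `O(n)` times per vector (`runs_processBlock`). The `O((n/s)³)` instances cost
`O(n³ s^(-ε))`, and the remaining work is `O(n³/s + n²s²)`, where `s³ ≤ n` makes the second term
`O(n³/s)`. Altogether this is `O(n^(3-ε/3))` for `ε ≤ 1` (`total_cost_le`).

The reduction has to be an actual word RAM program. Its own code is written with expressions whose
values are polynomially bounded, so that words of `O(log n)` bits never overflow (`Fits`). All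
instances live in one memory: each gets a window of addresses in which the given routines are
simulated with factor two in time (`Exec.guest`). Determinism turns the guarantee for complete
operation sequences into one for operations chosen adaptively (`History.serves`). -/

/-! ### Verified programming on the word RAM

Registers `0, …, 7` are the variables of a program; all the others are scratch space, which
expressions use as an evaluation stack. Arrays `0, …, 4` hold the data of the program. -/

/-- Expressions over the variables and the data arrays. -/
inductive RamExpr
  | var (x : ℕ)
  | lit (k : ℕ)
  | bin (f : BinOp) (e₁ e₂ : RamExpr)
  | rd (a : ℕ) (e : RamExpr)

namespace RamExpr

instance : Add RamExpr := ⟨bin .add⟩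
instance : Sub RamExpr := ⟨bin .sub⟩
instance : Mul RamExpr := ⟨bin .mul⟩
instance : Div RamExpr := ⟨bin .div⟩
instance : Mod RamExpr := ⟨bin .mod⟩
instance (k : ℕ) : OfNat RamExpr k := ⟨lit k⟩

/-- The value of `e₁ == e₂` is `1` or `0`. -/
def eqE (e₁ e₂ : RamExpr) : RamExpr := bin .eq e₁ e₂

/-- The value of `e₁ < e₂` is `1` or `0`. -/
def ltE (e₁ e₂ : RamExpr) : RamExpr := bin .lt e₁ e₂

def eval : RamExpr → MState → ℕ
  | var x, σ => σ.reg x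
  | lit k, _ => k
  | bin f e₁ e₂, σ => f.eval (e₁.eval σ) (e₂.eval σ)
  | rd a e, σ => σ.mem a (e.eval σ)

/-- Code that evaluates an expression into register `d`, with scratch registers above `d`. -/
def compile : RamExpr → ℕ → Prog
  | var x, d => .op .land d x x
  | lit k, d => .const d k
  | bin f e₁ e₂, d => .seq (.seq (e₁.compile d) (e₂.compile (d + 1))) (.op f d d (d + 1))
  | rd a e, d => .seq (e.compile d) (.load d a d)

/-- The running time of the compiled code. -/
def size : RamExpr → ℕ
  | var _ => 1
  | lit _ => 1
  | bin _ e₁ e₂ => e₁.size + e₂.size + 1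
  | rd _ e => e.size + 1

def leaves : RamExpr → ℕ
  | var _ => 1
  | lit _ => 1
  | bin _ e₁ e₂ => e₁.leaves + e₂.leaves
  | rd _ e => e.leaves

/-- The operations whose result is at most the product of the arguments if these are large. -/
def tame : BinOp → Bool
  | .add | .sub | .mul | .div | .mod | .eq | .lt => true
  | _ => false

/-- The expression mentions only variables, data arrays, small constants and tame operations. -/
def wf : RamExpr → Bool
  | var x => decide (x < 8)
  | lit k => decide (k ≤ 16)
  | bin f e₁ e₂ => tame f && e₁.wf && e₂.wf
  | rd a e => decide (a < 5) && e.wf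

/-- Well-formed expressions of bounded size, whose evaluation cannot overflow. -/
def ok (e : RamExpr) : Bool := e.wf && decide (e.leaves ≤ 200)

section eval
variable (σ : MState) (e₁ e₂ : RamExpr)
@[simp] theorem eval_var (x : ℕ) : (var x).eval σ = σ.reg x := rfl
@[simp] theorem eval_lit (k : ℕ) : (lit k).eval σ = k := rfl
@[simp] theorem eval_ofNat (k : ℕ) :
    (no_index (OfNat.ofNat k) : RamExpr).eval σ = OfNat.ofNat k := rfl
@[simp] theorem eval_zero : (0 : RamExpr).eval σ = 0 := rfl
@[simp] theorem eval_one : (1 : RamExpr).eval σ = 1 := rfl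
@[simp] theorem eval_add : (e₁ + e₂).eval σ = e₁.eval σ + e₂.eval σ := rfl
@[simp] theorem eval_sub : (e₁ - e₂).eval σ = e₁.eval σ - e₂.eval σ := rfl
@[simp] theorem eval_mul : (e₁ * e₂).eval σ = e₁.eval σ * e₂.eval σ := rfl
@[simp] theorem eval_div : (e₁ / e₂).eval σ = e₁.eval σ / e₂.eval σ := rfl
@[simp] theorem eval_mod : (e₁ % e₂).eval σ = e₁.eval σ % e₂.eval σ := rfl
@[simp] theorem eval_eqE : (eqE e₁ e₂).eval σ = if e₁.eval σ = e₂.eval σ then 1 else 0 := rfl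
@[simp] theorem eval_ltE : (ltE e₁ e₂).eval σ = if e₁.eval σ < e₂.eval σ then 1 else 0 := rfl
@[simp] theorem eval_rd (a : ℕ) : (rd a e₁).eval σ = σ.mem a (e₁.eval σ) := rfl
end eval

theorem leaves_pos (e : RamExpr) : 1 ≤ e.leaves := by
  induction e with
  | var | lit => exact le_rfl
  | bin _ _ _ h _ => exact h.trans (Nat.le_add_right _ _)
  | rd _ _ h => exact h

end RamExpr

namespace MState
variable (σ : MState)
@[simp] theorem setReg_reg (x k : ℕ) : (σ.setReg x k).reg = Function.update σ.reg x k := rfl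
@[simp] theorem setReg_mem (x k : ℕ) : (σ.setReg x k).mem = σ.mem := rfl
@[simp] theorem setCell_reg (a i k : ℕ) : (σ.setCell a i k).reg = σ.reg := rfl
theorem setCell_mem (a i k : ℕ) : (σ.setCell a i k).mem =
    Function.update σ.mem a (Function.update (σ.mem a) i k) := rfl
theorem setCell_mem_apply (a i k a' i' : ℕ) : (σ.setCell a i k).mem a' i' =
    if a' = a ∧ i' = i then k else σ.mem a' i' := by
  simp only [setCell_mem, Function.update_apply]
  split_ifs <;> simp_all
end MState

/-- Variables and data are bounded by `X`. -/
structure SmallState (X : ℕ) (σ : MState) : Prop where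
  reg : ∀ r < 8, σ.reg r ≤ X
  mem : ∀ a < 5, ∀ j, σ.mem a j ≤ X

theorem SmallState.setReg {X : ℕ} {σ : MState} (h : SmallState X σ) {x k : ℕ} (hk : k ≤ X) :
    SmallState X (σ.setReg x k) := by
  refine ⟨fun r hr => ?_, h.mem⟩
  simp only [MState.setReg_reg, Function.update_apply]
  split_ifs
  · exact hk
  · exact h.reg r hr

theorem SmallState.setCell {X : ℕ} {σ : MState} (h : SmallState X σ) {a i k : ℕ} (hk : k ≤ X) :
    SmallState X (σ.setCell a i k) := by
  refine ⟨h.reg, fun a' ha j => ?_⟩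
  rw [MState.setCell_mem_apply]
  split_ifs
  · exact hk
  · exact h.mem a' ha j

/-- Words of `w` bits have room for polynomials in `X`. -/
structure Fits (X w : ℕ) : Prop where
  le : 16 ≤ X
  lt : X ^ 200 < 2 ^ w

theorem Fits.lt_word {X w : ℕ} (h : Fits X w) {k : ℕ} (hk : k ≤ X) : k < 2 ^ w :=
  (hk.trans (Nat.le_self_pow (by norm_num) X)).trans_lt h.lt

/-! ### Polynomial bounds that exclude overflow. -/

namespace RamExpr

/-- Multiplication dictates the bound. For addition, both powers are at least `2`, so their sum is
at most their product; the other operations do not exceed the first argument or `1`. -/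
theorem tame_eval_le {f : BinOp} (hf : tame f = true) {X a b m n : ℕ} (hX : 16 ≤ X)
    (hm : 1 ≤ m) (hn : 1 ≤ n) (ha : a ≤ X ^ m) (hb : b ≤ X ^ n) : f.eval a b ≤ X ^ (m + n) := by
  have h1 : 2 ≤ X ^ m := (by omega : 2 ≤ X).trans (Nat.le_self_pow (by omega) X)
  have h2 : 2 ≤ X ^ n := (by omega : 2 ≤ X).trans (Nat.le_self_pow (by omega) X)
  rw [pow_add]
  have hma : X ^ m ≤ X ^ m * X ^ n := Nat.le_mul_of_pos_right _ (by omega)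
  cases f <;> simp only [tame, Bool.false_eq_true] at hf <;> simp only [BinOp.eval]
  · nlinarith
  · omega
  · exact Nat.mul_le_mul ha hb
  · exact (Nat.div_le_self _ _).trans (ha.trans hma)
  · exact (Nat.mod_le _ _).trans (ha.trans hma)
  · split_ifs <;> omega
  · split_ifs <;> omega

/-- The number of leaves plays the role of a degree. An array access resets the bound to `X`,
whatever its index is. -/
theorem eval_le {X : ℕ} {σ : MState} (hX : 16 ≤ X) (hσ : SmallState X σ) :
    ∀ e : RamExpr, e.wf = true → e.eval σ ≤ X ^ e.leaves
  | var x, h => by simpa [leaves] using hσ.reg x (by simpa [wf] using h)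
  | lit k, h => by
    have : k ≤ 16 := by simpa [wf] using h
    simpa [leaves] using this.trans hX
  | bin f e₁ e₂, h => by
    simp only [wf, Bool.and_eq_true] at h
    exact tame_eval_le h.1.1 hX e₁.leaves_pos e₂.leaves_pos (eval_le hX hσ e₁ h.1.2)
      (eval_le hX hσ e₂ h.2)
  | rd a e, h => by
    simp only [wf, Bool.and_eq_true, decide_eq_true_eq] at h
    exact (hσ.mem a h.1 _).trans (Nat.le_self_pow (Nat.one_le_iff_ne_zero.1 e.leaves_pos) X)

end RamExpr

/-- The states agree up to scratch registers. -/
structure Agree (s σ : MState) : Prop where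
  mem : s.mem = σ.mem
  reg : ∀ r < 8, s.reg r = σ.reg r

theorem Agree.setReg {s σ : MState} (h : Agree s σ) (x k : ℕ) :
    Agree (s.setReg x k) (σ.setReg x k) := by
  refine ⟨h.mem, fun r hr => ?_⟩
  simp only [MState.setReg_reg, Function.update_apply, h.reg r hr]

/-- Started in `σ`, up to scratch registers, the program halts in `σ'` after at most `T` steps. -/
def Runs (w : ℕ) (p : Prog) (σ : MState) (T : ℕ) (σ' : MState) : Prop :=
  ∀ s, Agree s σ → ∃ t ≤ T, ∃ s', Exec w p s t s' ∧ Agree s' σ'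

/-- Stack discipline: code for register `d` leaves all registers below `d` alone, so the first
operand, kept in `d`, survives the evaluation of the second one into `d + 1`. Every subexpression
stays below `X ^ 200`, so no instruction gets stuck. -/
theorem RamExpr.exec_compile_of_leaves {w X : ℕ} (hX : Fits X w) {σ : MState} (hσ : SmallState X σ) :
    ∀ (e : RamExpr), e.wf = true → e.leaves ≤ 200 → ∀ (d : ℕ), 8 ≤ d → ∀ s, Agree s σ →
      ∃ s', Exec w (e.compile d) s e.size s' ∧ s'.mem = s.mem ∧
        (∀ r < d, s'.reg r = s.reg r) ∧ s'.reg d = e.eval σ := by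
  have key : ∀ e : RamExpr, e.wf = true → e.leaves ≤ 200 → e.eval σ < 2 ^ w := fun e h h' =>
    ((eval_le hX.le hσ e h).trans
      (Nat.pow_le_pow_right (by have := hX.le; omega) h')).trans_lt hX.lt
  intro e
  induction e with
  | var x =>
    intro h h' d hd s hs
    have hx : x < 8 := by simpa [wf] using h
    have hv : BinOp.eval .land (s.reg x) (s.reg x) = σ.reg x := by
      simp [BinOp.eval, hs.reg x hx]
    refine ⟨_, .op s .land d x x (by rw [hv]; exact key _ h h'), rfl, fun r hr => ?_, ?_⟩
    · simp [hr.ne]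
    · simp [hv]
  | lit k =>
    intro h h' d hd s hs
    refine ⟨_, .const s d k (key _ h h'), rfl, fun r hr => ?_, ?_⟩
    · simp [hr.ne]
    · simp
  | bin f e₁ e₂ ih₁ ih₂ =>
    intro h h' d hd s hs
    have hw := h
    simp only [wf, Bool.and_eq_true] at hw
    simp only [leaves] at h'
    obtain ⟨s₁, hx₁, hm₁, hr₁, hv₁⟩ := ih₁ hw.1.2 (by omega) d hd s hs
    have hs₁ : Agree s₁ σ := ⟨hm₁.trans hs.mem, fun r hr => (hr₁ r (by omega)).trans (hs.reg r hr)⟩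
    obtain ⟨s₂, hx₂, hm₂, hr₂, hv₂⟩ := ih₂ hw.2 (by omega) (d + 1) (by omega) s₁ hs₁
    have hd₂ : s₂.reg d = e₁.eval σ := (hr₂ d (by omega)).trans hv₁
    refine ⟨_, .seq (.seq hx₁ hx₂) (.op s₂ f d d (d + 1) ?_), ?_, fun r hr => ?_, ?_⟩
    · rw [hd₂, hv₂]; exact key (bin f e₁ e₂) h h'
    · exact hm₂.trans hm₁
    · simp only [MState.setReg_reg, Function.update_apply, hr.ne, if_false]
      exact (hr₂ r (by omega)).trans (hr₁ r hr)
    · simp [hd₂, hv₂, eval]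
  | rd a e ih =>
    intro h h' d hd s hs
    have hw := h
    simp only [wf, Bool.and_eq_true] at hw
    obtain ⟨s₁, hx₁, hm₁, hr₁, hv₁⟩ := ih hw.2 h' d hd s hs
    have hv : s₁.mem a (s₁.reg d) = (rd a e).eval σ := by
      rw [hm₁, hs.mem, hv₁]; rfl
    refine ⟨_, .seq hx₁ (.load s₁ d a d ?_), hm₁, fun r hr => ?_, ?_⟩
    · rw [hv]; exact key (rd a e) h h'
    · simp only [MState.setReg_reg, Function.update_apply, hr.ne, if_false]
      exact hr₁ r hr
    · simp [hv]

theorem RamExpr.exec_compile {w X : ℕ} (hX : Fits X w) {σ : MState} (hσ : SmallState X σ)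
    {e : RamExpr} (he : e.ok = true) {d : ℕ} (hd : 8 ≤ d) {s : MState} (hs : Agree s σ) :
    ∃ s', Exec w (e.compile d) s e.size s' ∧ s'.mem = s.mem ∧
      (∀ r < d, s'.reg r = s.reg r) ∧ s'.reg d = e.eval σ := by
  simp only [ok, Bool.and_eq_true, decide_eq_true_eq] at he
  exact exec_compile_of_leaves hX hσ e he.1 he.2 d hd s hs

/-! ### Structured commands and their proof rules. -/

namespace Prog

/-- `x := e` -/
def assign (x : ℕ) (e : RamExpr) : Prog := .seq (e.compile 8) (.op .land x 8 8)

/-- `a[e₁] := e₂` -/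
def write (a : ℕ) (e₁ e₂ : RamExpr) : Prog :=
  .seq (.seq (e₁.compile 8) (e₂.compile 9)) (.store a 8 9)

/-- if `e` is nonzero then `p` else `q` -/
def cond (e : RamExpr) (p q : Prog) : Prog := .seq (e.compile 8) (.ite 8 p q)

/-- for `x = 0, …, e - 1` do `p`, where `p` must not change `x` and the value of `e` -/
def forLoop (x : ℕ) (e : RamExpr) (p : Prog) : Prog :=
  .seq (assign x 0) (.seq ((RamExpr.ltE (.var x) e).compile 8)
    (.loop 8 (.seq p (.seq (assign x (.var x + 1)) ((RamExpr.ltE (.var x) e).compile 8)))))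

end Prog

theorem Runs.mono {w T T' : ℕ} {p : Prog} {σ σ' : MState} (h : Runs w p σ T σ') (hT : T ≤ T') :
    Runs w p σ T' σ' := fun s hs => by
  obtain ⟨t, ht, s', h'⟩ := h s hs
  exact ⟨t, ht.trans hT, s', h'⟩

theorem Runs.seq {w T₁ T₂ : ℕ} {p q : Prog} {σ₁ σ₂ σ₃ : MState} (hp : Runs w p σ₁ T₁ σ₂)
    (hq : Runs w q σ₂ T₂ σ₃) : Runs w (.seq p q) σ₁ (T₁ + T₂) σ₃ := fun s hs => by
  obtain ⟨t₁, ht₁, s₁, hx₁, ha₁⟩ := hp s hs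
  obtain ⟨t₂, ht₂, s₂, hx₂, ha₂⟩ := hq s₁ ha₁
  exact ⟨t₁ + t₂, by omega, s₂, .seq hx₁ hx₂, ha₂⟩

theorem Runs.skip {w : ℕ} {σ : MState} : Runs w .skip σ 1 σ :=
  fun s hs => ⟨1, le_rfl, s, .skip s, hs⟩

section
variable {w X : ℕ} {σ : MState}

theorem Runs.assign (hX : Fits X w) (hσ : SmallState X σ) (x : ℕ) {e : RamExpr}
    (he : e.ok = true) (hv : e.eval σ ≤ X) :
    Runs w (.assign x e) σ (e.size + 1) (σ.setReg x (e.eval σ)) := fun s hs => by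
  obtain ⟨s₁, hx₁, hm₁, hr₁, hv₁⟩ := RamExpr.exec_compile hX hσ he le_rfl hs
  have ha : Agree s₁ σ := ⟨hm₁.trans hs.mem, fun r hr => (hr₁ r hr).trans (hs.reg r hr)⟩
  -- The machine has no move instruction; the bitwise conjunction of a word with itself serves as
  -- one.
  have hl : BinOp.eval .land (s₁.reg 8) (s₁.reg 8) = e.eval σ := by simp [BinOp.eval, hv₁]
  refine ⟨_, le_rfl, _, .seq hx₁ (.op s₁ .land x 8 8 (by rw [hl]; exact hX.lt_word hv)), ?_⟩
  rw [hl]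
  exact ha.setReg x _

theorem Runs.write (hX : Fits X w) (hσ : SmallState X σ) (a : ℕ) {e₁ e₂ : RamExpr}
    (he₁ : e₁.ok = true) (he₂ : e₂.ok = true) :
    Runs w (.write a e₁ e₂) σ (e₁.size + e₂.size + 1) (σ.setCell a (e₁.eval σ) (e₂.eval σ)) :=
  fun s hs => by
  obtain ⟨s₁, hx₁, hm₁, hr₁, hv₁⟩ := RamExpr.exec_compile hX hσ he₁ le_rfl hs
  have hs₁ : Agree s₁ σ := ⟨hm₁.trans hs.mem, fun r hr => (hr₁ r hr).trans (hs.reg r hr)⟩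
  obtain ⟨s₂, hx₂, hm₂, hr₂, hv₂⟩ := RamExpr.exec_compile hX hσ he₂ (by norm_num : 8 ≤ 9) hs₁
  have h8 : s₂.reg 8 = e₁.eval σ := (hr₂ 8 (by norm_num)).trans hv₁
  refine ⟨_, le_rfl, _, .seq (.seq hx₁ hx₂) (.store s₂ a 8 9), ?_, fun r hr => ?_⟩
  · rw [h8, hv₂, MState.setCell_mem, MState.setCell_mem, hm₂, hs₁.mem]
  · exact (hr₂ r (by omega)).trans (hs₁.reg r hr)

theorem Runs.cond_true (hX : Fits X w) (hσ : SmallState X σ) {e : RamExpr} (he : e.ok = true)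
    (hv : e.eval σ ≠ 0) {p q : Prog} {T : ℕ} {σ' : MState} (hp : Runs w p σ T σ') :
    Runs w (.cond e p q) σ (T + (e.size + 1)) σ' := fun s hs => by
  obtain ⟨s₁, hx₁, hm₁, hr₁, hv₁⟩ := RamExpr.exec_compile hX hσ he le_rfl hs
  have hs₁ : Agree s₁ σ := ⟨hm₁.trans hs.mem, fun r hr => (hr₁ r hr).trans (hs.reg r hr)⟩
  obtain ⟨t, ht, s', hx, ha⟩ := hp s₁ hs₁
  exact ⟨_, by omega, s', .seq hx₁ (.ite_true (by rwa [hv₁]) hx), ha⟩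

theorem Runs.cond_false (hX : Fits X w) (hσ : SmallState X σ) {e : RamExpr} (he : e.ok = true)
    (hv : e.eval σ = 0) {p q : Prog} {T : ℕ} {σ' : MState} (hq : Runs w q σ T σ') :
    Runs w (.cond e p q) σ (T + (e.size + 1)) σ' := fun s hs => by
  obtain ⟨s₁, hx₁, hm₁, hr₁, hv₁⟩ := RamExpr.exec_compile hX hσ he le_rfl hs
  have hs₁ : Agree s₁ σ := ⟨hm₁.trans hs.mem, fun r hr => (hr₁ r hr).trans (hs.reg r hr)⟩
  obtain ⟨t, ht, s', hx, ha⟩ := hq s₁ hs₁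
  exact ⟨_, by omega, s', .seq hx₁ (.ite_false (by rwa [hv₁]) hx), ha⟩

/-- The rule for counting loops; `I k σ T` says that after `k` rounds the state may be `σ`, and
the rounds took `T` steps without the bookkeeping of the loop. -/
theorem Runs.forLoop (hX : Fits X w) {x b : ℕ} (hx : x < 8) {e : RamExpr}
    (he : (RamExpr.ltE (.var x) e).ok = true) {p : Prog} (I : ℕ → MState → ℕ → Prop)
    (hσ : SmallState X σ) (hb : b ≤ X)
    (h₀ : I 0 (σ.setReg x 0) 0)
    (hI : ∀ k ≤ b, ∀ σ T, I k σ T → SmallState X σ ∧ σ.reg x = k ∧ e.eval σ = b)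
    (step : ∀ k < b, ∀ σ T, I k σ T → ∃ T' σ', Runs w p σ T' σ' ∧ SmallState X σ' ∧ σ'.reg x = k ∧
      I (k + 1) (σ'.setReg x (k + 1)) (T + T')) :
    ∃ T σ', Runs w (.forLoop x e p) σ (T + (b + 1) * (e.size + 10)) σ' ∧ I b σ' T := by
  have heval : ∀ k ≤ b, ∀ σ T, I k σ T →
      (RamExpr.ltE (.var x) e).eval σ = if k < b then 1 else 0 := by
    intro k hk σ T h
    obtain ⟨_, h1, h2⟩ := hI k hk σ T h
    simp [h1, h2]
  have hsz : (RamExpr.ltE (.var x) e).size = e.size + 2 := by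
    simp only [RamExpr.ltE, RamExpr.size]; omega
  -- Induction on the number `j` of rounds left, at a moment when the test has just been evaluated
  -- into register `8`. The subtracted term reflects that the last of the `j + 1` tests costs a
  -- single step.
  have main : ∀ j k, k + j = b → ∀ σ T, I k σ T → ∃ T' σ',
      (∀ s, Agree s σ → s.reg 8 = (if k < b then 1 else 0) →
        ∃ t ≤ T' + (j + 1) * (e.size + 10) - (e.size + 9), ∃ s', Exec w
          (.loop 8 (.seq p (.seq (.assign x (.var x + 1)) ((RamExpr.ltE (.var x) e).compile 8))))
          s t s' ∧ Agree s' σ') ∧ I b σ' (T + T') := by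
    intro j
    induction j with
    | zero =>
      intro k hk σ T h
      have hk : k = b := by omega
      subst hk
      refine ⟨0, σ, fun s hs h8 => ⟨1, by omega, s, .loop_done (by simpa using h8), hs⟩, h⟩
    | succ j ih =>
      intro k hk σ T h
      have hkb : k < b := by omega
      obtain ⟨T₁, σ₁, hp, hσ₁, hx₁, hI₁⟩ := step k hkb σ T h
      obtain ⟨T₂, σ₂, hl, hI₂⟩ := ih (k + 1) (by omega) _ _ hI₁
      obtain ⟨hσ₂, -, -⟩ := hI (k + 1) hkb _ _ hI₁
      have hinc : (RamExpr.var x + 1).eval σ₁ = k + 1 := by simp [hx₁]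
      have hok : (RamExpr.var x + 1).ok = true := by
        have h1 : (RamExpr.var x).wf = true := decide_eq_true hx
        change ((true && (RamExpr.var x).wf && true) && true) = true
        rw [h1]; rfl
      have ha := Runs.assign hX hσ₁ x hok (by rw [hinc]; omega)
      rw [hinc] at ha
      refine ⟨T₁ + T₂, σ₂, fun s hs h8 => ?_, by rwa [← add_assoc]⟩
      obtain ⟨t₁, ht₁, s₁, hx₁, ha₁⟩ := hp s hs
      obtain ⟨t₂, ht₂, s₂, hx₂, ha₂⟩ := ha s₁ ha₁
      obtain ⟨s₃, hx₃, hm₃, hr₃, hv₃⟩ := RamExpr.exec_compile hX hσ₂ he le_rfl ha₂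
      have ha₃ : Agree s₃ (σ₁.setReg x (k + 1)) :=
        ⟨hm₃.trans ha₂.mem, fun r hr => (hr₃ r hr).trans (ha₂.reg r hr)⟩
      obtain ⟨t₄, ht₄, s₄, hx₄, ha₄⟩ := hl s₃ ha₃ (by rw [hv₃, heval (k + 1) hkb _ _ hI₁])
      refine ⟨_, ?_, s₄, .loop_step (by simp [h8, hkb]) (.seq hx₁ (.seq hx₂ hx₃)) hx₄, ha₄⟩
      have : (RamExpr.var x + 1).size = 3 := rfl
      rw [hsz]
      rw [this] at ht₂
      rw [add_mul (j + 1) 1]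
      have : e.size + 10 ≤ (j + 1) * (e.size + 10) := Nat.le_mul_of_pos_left _ (by omega)
      omega
  obtain ⟨T, σ', hl, hI'⟩ := main b 0 (by omega) _ _ h₀
  rw [zero_add] at hI'
  refine ⟨T, σ', fun s hs => ?_, hI'⟩
  obtain ⟨hσ₀, -, -⟩ := hI 0 (by omega) _ _ h₀
  obtain ⟨t₁, ht₁, s₁, hx₁, ha₁⟩ := Runs.assign hX hσ x (e := 0) (by decide) (by simp) s hs
  rw [RamExpr.eval_zero] at ha₁
  obtain ⟨s₃, hx₃, hm₃, hr₃, hv₃⟩ := RamExpr.exec_compile hX hσ₀ he le_rfl ha₁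
  have ha₃ : Agree s₃ (σ.setReg x 0) :=
    ⟨hm₃.trans ha₁.mem, fun r hr => (hr₃ r hr).trans (ha₁.reg r hr)⟩
  obtain ⟨t₄, ht₄, s₄, hx₄, ha₄⟩ := hl s₃ ha₃ (by rw [hv₃, heval 0 (by omega) _ _ h₀])
  refine ⟨_, ?_, s₄, .seq hx₁ (.seq hx₃ hx₄), ha₄⟩
  have : (0 : RamExpr).size = 1 := rfl
  rw [this] at ht₁
  rw [hsz]
  have : e.size + 10 ≤ (b + 1) * (e.size + 10) := Nat.le_mul_of_pos_left _ (by omega)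
  omega

end

/-! ### Running a program inside a window of the memory

A guest program is run with its registers moved beyond the scratch space and its arrays moved
beyond the data arrays, at an offset that is found in register `5`. -/

namespace Prog

/-- The guest version of a program. -/
def guest : Prog → Prog
  | skip => skip
  | const x k => const (x + 10) k
  | op f x y z => op f (x + 10) (y + 10) (z + 10)
  | load x a y => seq (op .add 8 5 (y + 10)) (load (x + 10) (a + 5) 8)
  | store a y x => seq (op .add 8 5 (y + 10)) (store (a + 5) 8 (x + 10))
  | seq p q => seq p.guest q.guest
  | ite x p q => ite (x + 10) p.guest q.guest
  | loop x p => loop (x + 10) p.guest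

/-- A strict bound on the registers that a program mentions. -/
def regBound : Prog → ℕ
  | skip => 0
  | const x _ => x + 1
  | op _ x y z => max (x + 1) (max (y + 1) (z + 1))
  | load x _ y => max (x + 1) (y + 1)
  | store _ y x => max (x + 1) (y + 1)
  | seq p q => max p.regBound q.regBound
  | ite x p q => max (x + 1) (max p.regBound q.regBound)
  | loop x p => max (x + 1) p.regBound

/-- Clear the first `k` guest registers. -/
def clear : ℕ → Prog
  | 0 => skip
  | k + 1 => seq (clear k) (const (k + 10) 0)

/-- Write the values of the expressions into the cells `k, k + 1, …` of guest array `0`. -/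
def writeArgs : ℕ → List RamExpr → Prog
  | _, [] => skip
  | k, e :: es => seq (write 5 (.var 5 + .lit k) e) (writeArgs (k + 1) es)

/-- Call a routine of the guest whose window starts at the content of register `5`. -/
def guestCall (p : Prog) (es : List RamExpr) : Prog :=
  seq (writeArgs 0 es) (seq (clear p.regBound) p.guest)

end Prog

/-- The window of length `st` at `base` contains the memory `m` of the guest. -/
def Holds (base st : ℕ) (m mem : Memory) : Prop :=
  ∀ a, ∀ j < st, mem (a + 5) (base + j) = m a j

/-- Nothing but the window has changed. -/
def FrameEq (base st : ℕ) (mem mem' : Memory) : Prop :=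
  ∀ a j, (a < 5 ∨ j < base ∨ base + st ≤ j) → mem' a j = mem a j

/-- The memory `mem` with `m` put into the window. -/
def overlay (base st : ℕ) (m mem : Memory) : Memory := fun a j =>
  if 5 ≤ a ∧ base ≤ j ∧ j < base + st then m (a - 5) (j - base) else mem a j

theorem FrameEq.refl (base st : ℕ) (mem : Memory) : FrameEq base st mem mem := fun _ _ _ => rfl

theorem FrameEq.trans {base st : ℕ} {m₁ m₂ m₃ : Memory} (h : FrameEq base st m₁ m₂)
    (h' : FrameEq base st m₂ m₃) : FrameEq base st m₁ m₃ :=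
  fun a j hj => (h' a j hj).trans (h a j hj)

theorem FrameEq.data {base st : ℕ} {m₁ m₂ : Memory} (h : FrameEq base st m₁ m₂) {a : ℕ}
    (ha : a < 5) : m₂ a = m₁ a := funext fun j => h a j (.inl ha)

theorem FrameEq.smallState {base st X : ℕ} {σ : MState} {mem' : Memory}
    (h : FrameEq base st σ.mem mem') (hσ : SmallState X σ) : SmallState X ⟨σ.reg, mem'⟩ :=
  ⟨hσ.reg, fun a ha j => (h a j (.inl ha)).trans_le (hσ.mem a ha j)⟩

theorem overlay_frame (base st : ℕ) (m mem : Memory) :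
    FrameEq base st mem (overlay base st m mem) := by
  intro a j h
  rw [overlay, if_neg]
  omega

theorem overlay_holds (base st : ℕ) (m mem : Memory) :
    Holds base st m (overlay base st m mem) := by
  intro a j h
  rw [overlay, if_pos (by omega)]
  congr 1; omega

/-- Contents of the window and an unchanged frame determine the whole memory. This supplies a
definite final state for `Runs`, whose final state may not depend on the scratch registers at the
start. -/
theorem eq_overlay {base st : ℕ} {m mem mem' : Memory} (h : Holds base st m mem')
    (hf : FrameEq base st mem mem') : mem' = overlay base st m mem := by
  funext a j
  by_cases hc : 5 ≤ a ∧ base ≤ j ∧ j < base + st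
  · rw [overlay, if_pos hc]
    have := h (a - 5) (j - base) (by omega)
    rwa [show a - 5 + 5 = a by omega, show base + (j - base) = j by omega] at this
  · rw [overlay, if_neg hc]
    exact hf a j (by omega)

theorem Holds.of_frame {base base' st : ℕ} {m mem mem' : Memory} (h : Holds base st m mem)
    (hf : FrameEq base' st mem mem') (hd : base + st ≤ base' ∨ base' + st ≤ base) :
    Holds base st m mem' := fun a j hj => by
  rw [hf _ _ (by omega)]; exact h a j hj

theorem FrameEq.setCell {base st : ℕ} (σ : MState) {a j k : ℕ} (ha : 5 ≤ a)
    (hj : base ≤ j ∧ j < base + st) : FrameEq base st σ.mem (σ.setCell a j k).mem := by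
  intro a' j' h
  rw [MState.setCell_mem_apply, if_neg]
  omega

theorem Holds.setCell {base st : ℕ} {s z : MState} (h : Holds base st s.mem z.mem) {a j k : ℕ} :
    Holds base st (s.setCell a j k).mem (z.setCell (a + 5) (base + j) k).mem := by
  intro a' j' h'
  rw [MState.setCell_mem_apply, MState.setCell_mem_apply, h a' j' h']
  simp

/-- The relation between a guest state and a host state. -/
structure GuestRel (w' base st K : ℕ) (s z : MState) : Prop where
  lt : ∀ r < K, s.reg r < 2 ^ w'
  reg : ∀ r < K, z.reg (r + 10) = s.reg r
  offset : z.reg 5 = base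
  mem : Holds base st s.mem z.mem

theorem GuestRel.setReg {w' base st K : ℕ} {s z : MState} (h : GuestRel w' base st K s z)
    {x k : ℕ} (hk : k < 2 ^ w') :
    GuestRel w' base st K (s.setReg x k) (z.setReg (x + 10) k) := by
  refine ⟨fun r hr => ?_, fun r hr => ?_, ?_, h.mem⟩
  · simp only [MState.setReg_reg, Function.update_apply]
    split_ifs
    · exact hk
    · exact h.lt r hr
  · simp only [MState.setReg_reg, Function.update_apply, Nat.add_right_cancel_iff, h.reg r hr]
  · simpa [Function.update_apply] using h.offset

/-- A halting run with `w'`-bit words never overflows, so wider words compute the same values. Guest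
registers stay below `2 ^ w' ≤ st`, hence every address stays inside the window, and adding the
offset does not overflow since `base + st ≤ 2 ^ w`. This addition, one extra step per load and
store, is the reason for the factor two. -/
theorem Exec.guest {w w' base st K t : ℕ} {p : Prog} {s s' : MState} (h : Exec w' p s t s')
    (hw : w' ≤ w) (hst : 2 ^ w' ≤ st) (hb : base + st ≤ 2 ^ w) :
    p.regBound ≤ K → ∀ z, GuestRel w' base st K s z →
      ∃ t' ≤ 2 * t, ∃ z', Exec w p.guest z t' z' ∧ GuestRel w' base st K s' z' ∧
        (∀ r < 8, z'.reg r = z.reg r) ∧ FrameEq base st z.mem z'.mem := by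
  have hww : 2 ^ w' ≤ 2 ^ w := Nat.pow_le_pow_right (by norm_num) hw
  have upd : ∀ (z : MState) (x k : ℕ), ∀ r < 8, (z.setReg (x + 8) k).reg r = z.reg r := by
    intro z x k r hr
    rw [MState.setReg_reg, Function.update_of_ne (by omega)]
  induction h with
  | skip s =>
    intro _ z hz
    exact ⟨1, by omega, z, .skip z, hz, fun _ _ => rfl, .refl _ _ _⟩
  | const s x k h =>
    intro _ z hz
    exact ⟨1, by omega, _, .const z _ _ (h.trans_le hww), hz.setReg h, upd z (x + 2) k, .refl _ _ _⟩
  | op s f x y y' h =>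
    intro hK z hz
    simp only [Prog.regBound, max_le_iff] at hK
    have e : f.eval (z.reg (y + 10)) (z.reg (y' + 10)) = f.eval (s.reg y) (s.reg y') := by
      rw [hz.reg y (by omega), hz.reg y' (by omega)]
    refine ⟨1, by omega, _, .op z _ _ _ _ ?_, ?_, ?_, ?_⟩
    · rw [e]; exact h.trans_le hww
    · rw [e]; exact hz.setReg h
    · exact upd z (x + 2) _
    · exact .refl _ _ _
  | load s x a y h =>
    intro hK z hz
    simp only [Prog.regBound, max_le_iff] at hK
    have hy := hz.lt y (by omega)
    have e : BinOp.eval .add (z.reg 5) (z.reg (y + 10)) = base + s.reg y := by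
      rw [hz.offset, hz.reg y (by omega)]; rfl
    have e₂ : (z.setReg 8 (base + s.reg y)).mem (a + 5) ((z.setReg 8 (base + s.reg y)).reg 8) =
        s.mem a (s.reg y) := by
      simpa using hz.mem a (s.reg y) (by omega)
    have hx₁ := Exec.op (w := w) z .add 8 5 (y + 10) (by rw [e]; omega)
    rw [e] at hx₁
    have hx₂ := Exec.load (w := w) (z.setReg 8 (base + s.reg y)) (x + 10) (a + 5) 8
      (by rw [e₂]; omega)
    rw [e₂] at hx₂
    have hz₁ : GuestRel w' base st K s (z.setReg 8 (base + s.reg y)) := by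
      refine ⟨hz.lt, fun r hr => ?_, ?_, hz.mem⟩
      · rw [MState.setReg_reg, Function.update_of_ne (by omega), hz.reg r hr]
      · rw [MState.setReg_reg, Function.update_of_ne (by omega), hz.offset]
    refine ⟨_, by omega, _, .seq hx₁ hx₂, hz₁.setReg h, fun r hr => ?_, .refl _ _ _⟩
    rw [upd _ (x + 2) _ r hr, upd _ 0 _ r hr]
  | store s a y x =>
    intro hK z hz
    simp only [Prog.regBound, max_le_iff] at hK
    have hy := hz.lt y (by omega)
    have e : BinOp.eval .add (z.reg 5) (z.reg (y + 10)) = base + s.reg y := by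
      rw [hz.offset, hz.reg y (by omega)]; rfl
    have hx₁ := Exec.op (w := w) z .add 8 5 (y + 10) (by rw [e]; omega)
    rw [e] at hx₁
    have hx₂ := Exec.store (w := w) (z.setReg 8 (base + s.reg y)) (a + 5) 8 (x + 10)
    have e₂ : (z.setReg 8 (base + s.reg y)).reg (x + 10) = s.reg x := by
      rw [MState.setReg_reg, Function.update_of_ne (by omega), hz.reg x (by omega)]
    have e₃ : (z.setReg 8 (base + s.reg y)).reg 8 = base + s.reg y := by simp
    rw [e₂, e₃] at hx₂
    refine ⟨_, by omega, _, .seq hx₁ hx₂, ⟨hz.lt, fun r hr => ?_, ?_, ?_⟩, fun r hr => ?_, ?_⟩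
    · rw [MState.setCell_reg, MState.setReg_reg, Function.update_of_ne (by omega), hz.reg r hr,
        MState.setCell_reg]
    · rw [MState.setCell_reg, MState.setReg_reg, Function.update_of_ne (by omega), hz.offset]
    · exact Holds.setCell (z := z.setReg 8 (base + s.reg y)) hz.mem
    · rw [MState.setCell_reg, upd _ 0 _ r hr]
    · exact FrameEq.setCell (z.setReg 8 (base + s.reg y)) (by omega) (by omega)
  | seq hp hq ihp ihq =>
    intro hK z hz
    simp only [Prog.regBound, max_le_iff] at hK
    obtain ⟨t₁, ht₁, z₁, hx₁, hz₁, hr₁, hf₁⟩ := ihp hK.1 z hz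
    obtain ⟨t₂, ht₂, z₂, hx₂, hz₂, hr₂, hf₂⟩ := ihq hK.2 z₁ hz₁
    exact ⟨_, by omega, z₂, .seq hx₁ hx₂, hz₂, fun r hr => (hr₂ r hr).trans (hr₁ r hr),
      hf₁.trans hf₂⟩
  | @ite_true x p q s s' t hx hp ih =>
    intro hK z hz
    simp only [Prog.regBound, max_le_iff] at hK
    obtain ⟨t₁, ht₁, z₁, hx₁, hz₁, hr₁, hf₁⟩ := ih hK.2.1 z hz
    exact ⟨_, by omega, z₁, .ite_true (by rwa [hz.reg x (by omega)]) hx₁, hz₁, hr₁, hf₁⟩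
  | @ite_false x p q s s' t hx hp ih =>
    intro hK z hz
    simp only [Prog.regBound, max_le_iff] at hK
    obtain ⟨t₁, ht₁, z₁, hx₁, hz₁, hr₁, hf₁⟩ := ih hK.2.2 z hz
    exact ⟨_, by omega, z₁, .ite_false (by rwa [hz.reg x (by omega)]) hx₁, hz₁, hr₁, hf₁⟩
  | @loop_done x p s hx =>
    intro hK z hz
    simp only [Prog.regBound, max_le_iff] at hK
    exact ⟨1, by omega, z, .loop_done (by rwa [hz.reg x (by omega)]), hz, fun _ _ => rfl,
      .refl _ _ _⟩
  | @loop_step x p s₁ s₂ s₃ t₁ t₂ hx hp hl ihp ihl =>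
    intro hK z hz
    have hK' := hK
    simp only [Prog.regBound, max_le_iff] at hK
    obtain ⟨t₁, ht₁, z₁, hx₁, hz₁, hr₁, hf₁⟩ := ihp hK.2 z hz
    obtain ⟨t₂, ht₂, z₂, hx₂, hz₂, hr₂, hf₂⟩ := ihl hK' z₁ hz₁
    exact ⟨_, by omega, z₂, .loop_step (by rwa [hz.reg x (by omega)]) hx₁ hx₂, hz₂,
      fun r hr => (hr₂ r hr).trans (hr₁ r hr), hf₁.trans hf₂⟩

/-- Guest registers overlap the evaluation stack of the host, which is harmless because a call
starts with cleared registers. Only the finitely many registers that the routine mentions have to be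
cleared, so this costs a constant. -/
theorem Exec.clear (w : ℕ) (z : MState) : ∀ K, ∃ z', Exec w (.clear K) z (K + 1) z' ∧
    z'.mem = z.mem ∧ (∀ r < K, z'.reg (r + 10) = 0) ∧ ∀ r < 8, z'.reg r = z.reg r
  | 0 => ⟨z, .skip z, rfl, by simp, fun _ _ => rfl⟩
  | K + 1 => by
    obtain ⟨z₁, hx, hm, hc, hr⟩ := Exec.clear w z K
    refine ⟨_, .seq hx (.const z₁ (K + 10) 0 (by positivity)), hm, fun r hr' => ?_,
      fun r hr' => ?_⟩
    · rw [MState.setReg_reg, Function.update_apply]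
      split_ifs with h
      · rfl
      · exact hc r (by omega)
    · rw [MState.setReg_reg, Function.update_of_ne (by omega), hr r hr']

/-- The values of well-formed expressions depend only on variables and data arrays. -/
theorem RamExpr.eval_congr {σ σ' : MState} (hr : ∀ r < 8, σ'.reg r = σ.reg r)
    (hm : ∀ a < 5, σ'.mem a = σ.mem a) : ∀ e : RamExpr, e.wf = true → e.eval σ' = e.eval σ
  | var x, h => hr x (by simpa [wf] using h)
  | lit _, _ => rfl
  | bin f e₁ e₂, h => by
    simp only [wf, Bool.and_eq_true] at h
    rw [eval, eval, eval_congr hr hm e₁ h.1.2, eval_congr hr hm e₂ h.2]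
  | rd a e, h => by
    simp only [wf, Bool.and_eq_true, decide_eq_true_eq] at h
    rw [eval, eval, eval_congr hr hm e h.2, hm a h.1]

theorem RamExpr.eval_frame {base st : ℕ} {σ : MState} {mem' : Memory}
    (hf : FrameEq base st σ.mem mem') {e : RamExpr} (he : e.ok = true) :
    e.eval ⟨σ.reg, mem'⟩ = e.eval σ := by
  simp only [ok, Bool.and_eq_true] at he
  exact eval_congr (σ := σ) (σ' := ⟨σ.reg, mem'⟩) (fun _ _ => rfl) (fun a ha => hf.data ha) e he.1

section
variable {w X base st : ℕ}

/-- Writing into the window does not affect later arguments, since well-formed expressions read data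
arrays only. For `k = 0` the resulting guest memory is the one that `Memory.withInput` prescribes.
-/
theorem Runs.writeArgs (hX : Fits X w) : ∀ (es : List RamExpr) (k : ℕ), (∀ e ∈ es, e.ok = true) →
    k + es.length ≤ st → k + es.length ≤ 16 → ∀ {σ : MState} {m : Memory}, SmallState X σ →
    σ.reg 5 = base → Holds base st m σ.mem → ∃ mem',
      Runs w (.writeArgs k es) σ ((es.map RamExpr.size).sum + 4 * es.length + 1) ⟨σ.reg, mem'⟩ ∧
      FrameEq base st σ.mem mem' ∧
      Holds base st (Function.update m 0 fun i => if k ≤ i then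
        (es.map fun e => e.eval σ).getD (i - k) (m 0 i) else m 0 i) mem'
  | [], k, _, _, _, σ, m, hσ, h5, hm => by
    refine ⟨σ.mem, Runs.skip.mono (by simp), .refl _ _ _, ?_⟩
    convert hm using 1
    simp
  | e :: es, k, he, hk, hk', σ, m, hσ, h5, hm => by
    simp only [List.length_cons] at hk hk'
    have hok : (RamExpr.var 5 + RamExpr.lit k).ok = true := by
      have h1 : (RamExpr.lit k).wf = true := decide_eq_true (by omega)
      change ((true && true && (RamExpr.lit k).wf) && true) = true
      rw [h1]; rfl
    have hw := Runs.write hX hσ 5 hok (he e (by simp))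
    have ha : (RamExpr.var 5 + RamExpr.lit k).eval σ = base + k := by simp [h5]
    rw [ha] at hw
    have hf : FrameEq base st σ.mem (σ.setCell 5 (base + k) (e.eval σ)).mem :=
      .setCell σ le_rfl (by omega)
    have hm' := Holds.setCell (s := ⟨σ.reg, m⟩) (a := 0) (j := k) (k := e.eval σ) hm
    obtain ⟨mem', hr, hf', hh⟩ := Runs.writeArgs hX es (k + 1) (fun e he' => he e (by simp [he']))
      (by omega) (by omega) (hf.smallState hσ) h5 hm'
    refine ⟨mem', (Runs.seq hw hr).mono ?_, hf.trans hf', ?_⟩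
    · simp only [List.map_cons, List.sum_cons, List.length_cons]
      have : (RamExpr.var 5 + RamExpr.lit k).size = 3 := rfl
      omega
    · convert hh using 1
      funext a i
      simp only [MState.setCell_mem, Function.update_apply]
      by_cases h0 : a = 0
      · subst h0
        simp only [if_true]
        have hmap : (es.map fun e' => e'.eval ⟨σ.reg, (σ.setCell 5 (base + k) (e.eval σ)).mem⟩) =
            es.map fun e' => e'.eval σ :=
          List.map_congr_left fun e' he' => RamExpr.eval_frame hf (he e' (by simp [he']))
        rw [MState.setCell_mem] at hmap
        rw [hmap]
        rcases lt_trichotomy i k with h | h | h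
        · rw [if_neg (by omega), if_neg (by omega), Function.update_of_ne (by omega)]
        · subst h
          simp
        · rw [if_pos (by omega), if_pos (by omega), Function.update_of_ne (by omega), List.map_cons,
            show i - k = (i - (k + 1)) + 1 by omega, List.getD_cons_succ]
      · simp [h0]

/-- A call of a guest routine changes the window of the guest as the routine does. -/
theorem Runs.guestCall {w' t : ℕ} (hX : Fits X w) (hw : w' ≤ w) (hst : 2 ^ w' ≤ st)
    (hb : base + st ≤ 2 ^ w) {es : List RamExpr} (hes : ∀ e ∈ es, e.ok = true)
    (hlen : es.length ≤ st) (hlen' : es.length ≤ 16) {σ : MState} (hσ : SmallState X σ)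
    (h5 : σ.reg 5 = base) {m m' : Memory} (hm : Holds base st m σ.mem) {p : Prog}
    {l : List ℕ} (hl : (es.map fun e => e.eval σ) = l) (hc : Call w' p l m t m') :
    ∃ mem', Runs w (.guestCall p es) σ
        (2 * t + (p.regBound + (es.map RamExpr.size).sum + 4 * es.length + 2)) ⟨σ.reg, mem'⟩ ∧
      FrameEq base st σ.mem mem' ∧ Holds base st m' mem' := by
  subst hl
  obtain ⟨mem₁, hr₁, hf₁, hm₁⟩ := Runs.writeArgs hX es 0 hes (by omega) (by omega) hσ h5 hm
  obtain ⟨r, hc⟩ := hc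
  -- The final memory has to be named before the starting state `s` is known; `eq_overlay` later
  -- identifies the memory reached with it.
  refine ⟨overlay base st m' σ.mem, fun s hs => ?_, overlay_frame _ _ _ _, overlay_holds _ _ _ _⟩
  obtain ⟨t₁, ht₁, s₁, hx₁, ha₁⟩ := hr₁ s hs
  obtain ⟨s₂, hx₂, hm₂, hc₂, hr₂⟩ := Exec.clear w s₁ p.regBound
  have hrel : GuestRel w' base st p.regBound
      ⟨fun _ => 0, m.withInput (es.map fun e => e.eval σ)⟩ s₂ := by
    refine ⟨fun _ _ => by positivity, hc₂, ?_, ?_⟩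
    · rw [hr₂ 5 (by norm_num), ha₁.reg 5 (by norm_num), h5]
    · rw [hm₂, ha₁.mem]
      convert hm₁ using 1
      simp [Memory.withInput]
  obtain ⟨t₃, ht₃, s₃, hx₃, hz₃, hr₃, hf₃⟩ := hc.guest hw hst hb le_rfl s₂ hrel
  refine ⟨_, ?_, s₃, .seq hx₁ (.seq hx₂ hx₃), ?_, fun x hx => ?_⟩
  · omega
  · refine eq_overlay hz₃.mem (hf₁.trans ?_)
    rw [hm₂, ha₁.mem] at hf₃
    exact hf₃
  · rw [hr₃ x hx, hr₂ x hx, ha₁.reg x hx]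

end

/-! ### Histories of a partially dynamic matching algorithm -/

theorem Call.deterministic {w : ℕ} {p : Prog} {l : List ℕ} {m m₁ m₂ : Memory} {t₁ t₂ : ℕ}
    (h₁ : Call w p l m t₁ m₁) (h₂ : Call w p l m t₂ m₂) : t₁ = t₂ ∧ m₁ = m₂ := by
  obtain ⟨r₁, h₁⟩ := h₁
  obtain ⟨r₂, h₂⟩ := h₂
  obtain ⟨ht, hs⟩ := h₁.deterministic h₂
  exact ⟨ht, congrArg MState.mem hs⟩

/-- From memory `m₀`, the operations lead to the graph `E` and the memory `m` in `T` steps. -/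
inductive History (A : MatchingAlg) (S : Setting) (w : ℕ) {N : ℕ} (m₀ : Memory) :
    List (MatchOp N) → BipEdges N → Memory → ℕ → Prop
  | nil : History A S w m₀ [] (S.start N) m₀ 0
  | update {ops E m T e t m'} (h : History A S w m₀ ops E m T) (ha : S.Allowed E e)
      (hc : Call w A.update [(e.1 : ℕ), (e.2 : ℕ)] m t m') :
      History A S w m₀ (ops ++ [.update e]) (S.apply E e) m' (T + t)
  | query {ops E m T t m'} (h : History A S w m₀ ops E m T) (hc : Call w A.query [] m t m') :
      History A S w m₀ (ops ++ [.query]) E m' (T + t)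

section
variable {A : MatchingAlg} {S : Setting} {w N : ℕ} {m₀ m : Memory} {ops : List (MatchOp N)}
  {E : BipEdges N} {T : ℕ}

/-- By determinism, any run that serves `ops ++ rest` passes through the memory `m` after exactly
`T` steps. So the next operation may be chosen in view of the answers given so far. -/
theorem History.serves (h : History A S w m₀ ops E m T) : ∀ {rest : List (MatchOp N)} {T' : ℕ},
    A.Serves S w (S.start N) m₀ (ops ++ rest) T' →
      ∃ T'', A.Serves S w E m rest T'' ∧ T' = T + T'' := by
  induction h with
  | nil => intro rest T' h; exact ⟨T', h, by simp⟩
  | update _ ha hc ih =>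
    intro rest T' h
    rw [List.append_assoc] at h
    obtain ⟨T'', ⟨t₁, m₁, T₁, hc₁, hs, rfl⟩, rfl⟩ := ih h
    obtain ⟨rfl, rfl⟩ := hc.deterministic hc₁
    exact ⟨T₁, hs, by omega⟩
  | query _ hc ih =>
    intro rest T' h
    rw [List.append_assoc] at h
    obtain ⟨T'', ⟨t₁, m₁, T₁, hc₁, -, hs, rfl⟩, rfl⟩ := ih h
    obtain ⟨rfl, rfl⟩ := hc.deterministic hc₁
    exact ⟨T₁, hs, by omega⟩

theorem History.legal (h : History A S w m₀ ops E m T) : ∀ {rest : List (MatchOp N)},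
    S.Legal E rest → S.Legal (S.start N) (ops ++ rest) := by
  induction h with
  | nil => exact fun h => h
  | update _ ha hc ih => intro rest h; rw [List.append_assoc]; exact ih ⟨ha, h⟩
  | query _ hc ih => intro rest h; rw [List.append_assoc]; exact ih h

/-- The edges that have been updated when the current graph is `E`. -/
def Setting.touched (S : Setting) (E : BipEdges N) : BipEdges N :=
  match S with
  | .incremental => E
  | .decremental => Eᶜ

theorem Setting.touched_touched (S : Setting) (E : BipEdges N) :
    S.touched (S.touched E) = E := by
  cases S <;> simp [touched]

theorem Setting.touched_start (S : Setting) : S.touched (S.start N) = ∅ := by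
  cases S <;> simp [touched, start]

theorem Setting.allowed_iff (S : Setting) {E : BipEdges N} {e : Fin N × Fin N} :
    S.Allowed E e ↔ e ∉ S.touched E := by
  cases S <;> simp [touched, Allowed]

theorem Setting.touched_apply (S : Setting) (E : BipEdges N) (e : Fin N × Fin N) :
    S.touched (S.apply E e) = insert e (S.touched E) := by
  cases S
  · rfl
  · simp [touched, apply, Finset.compl_erase]

theorem numUpdates_append (l₁ l₂ : List (MatchOp N)) :
    numUpdates (l₁ ++ l₂) = numUpdates l₁ + numUpdates l₂ := by
  induction l₁ with
  | nil => simp [numUpdates]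
  | cons a l ih => cases a <;> simp [numUpdates, ih]; omega

theorem numQueries_append (l₁ l₂ : List (MatchOp N)) :
    numQueries (l₁ ++ l₂) = numQueries l₁ + numQueries l₂ := by
  induction l₁ with
  | nil => simp [numQueries]
  | cons a l ih => cases a <;> simp [numQueries, ih]; omega

/-- Allowed updates concern untouched edges, so each one enlarges the touched set by one. This
bounds the updates of an instance by the number of vertex pairs. -/
theorem History.numUpdates (h : History A S w m₀ ops E m T) :
    numUpdates ops = (S.touched E).card := by
  induction h with
  | nil => rw [S.touched_start]; rfl
  | update _ ha hc ih =>
    rw [S.touched_apply, Finset.card_insert_of_notMem (S.allowed_iff.1 ha), numUpdates_append, ih]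
    rfl
  | query _ hc ih => rw [numUpdates_append, ih]; rfl

end

/-- An algorithm that serves all operation sequences on graphs with `N + N` vertices, with
words of `w` bits: after `t₀` steps of initialization with memory `m₀`. -/
structure Server (A : MatchingAlg) (S : Setting) (w N t₀ : ℕ) (m₀ : Memory) (cst upd qry : ℝ) :
    Prop where
  setup : Call w A.setup [N] Memory.zero t₀ m₀
  serves : ∀ ops : List (MatchOp N), S.Legal (S.start N) ops →
    ∃ T : ℕ, A.Serves S w (S.start N) m₀ ops T ∧
      (t₀ + T : ℝ) ≤ cst + numUpdates ops * upd + numQueries ops * qry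

/-- The algorithm is in memory state `m` after the edges `D` have been updated and `q` queries
have been answered, in `τ` steps altogether. -/
def Reached (A : MatchingAlg) (S : Setting) (w : ℕ) {N : ℕ} (t₀ : ℕ) (m₀ : Memory)
    (D : BipEdges N) (q : ℕ) (m : Memory) (τ : ℕ) : Prop :=
  ∃ ops E T, History A S w m₀ ops E m T ∧ S.touched E = D ∧ numQueries ops = q ∧ τ = t₀ + T

section
variable {A : MatchingAlg} {S : Setting} {w N t₀ : ℕ} {m₀ m : Memory} {cst upd qry : ℝ}
  {D : BipEdges N} {q τ : ℕ}

theorem Reached.init : Reached A S w t₀ m₀ (∅ : BipEdges N) 0 m₀ t₀ :=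
  ⟨[], S.start N, 0, .nil, S.touched_start, rfl, rfl⟩

/-- The past operations followed by this update form a legal sequence. Serving it continues the
known history, and its last call is the one wanted. -/
theorem Reached.update (h : Reached A S w t₀ m₀ D q m τ)
    (hA : Server A S w N t₀ m₀ cst upd qry) {e : Fin N × Fin N} (he : e ∉ D) :
    ∃ t m', Call w A.update [(e.1 : ℕ), (e.2 : ℕ)] m t m' ∧
      Reached A S w t₀ m₀ (insert e D) q m' (τ + t) := by
  obtain ⟨ops, E, T, hh, rfl, rfl, rfl⟩ := h
  have ha := S.allowed_iff.2 he
  obtain ⟨T', hs, -⟩ := hA.serves (ops ++ [.update e]) (hh.legal (rest := [.update e]) ⟨ha, trivial⟩)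
  obtain ⟨_, ⟨t, m', _, hc, -⟩, -⟩ := hh.serves hs
  refine ⟨t, m', hc, _, _, _, hh.update ha hc, S.touched_apply E e, ?_, by omega⟩
  simp [numQueries_append, numQueries]

theorem Reached.query (h : Reached A S w t₀ m₀ D q m τ)
    (hA : Server A S w N t₀ m₀ cst upd qry) :
    ∃ t m', Call w A.query [] m t m' ∧ IsMaxMatchingSize (S.touched D).graph (m' 1 0) ∧
      Reached A S w t₀ m₀ D (q + 1) m' (τ + t) := by
  obtain ⟨ops, E, T, hh, rfl, rfl, rfl⟩ := h
  obtain ⟨T', hs, -⟩ := hA.serves (ops ++ [.query]) (hh.legal (rest := [.query]) trivial)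
  obtain ⟨_, ⟨t, m', _, hc, hm, -⟩, -⟩ := hh.serves hs
  refine ⟨t, m', hc, by rwa [S.touched_touched], _, _, _, hh.query hc, rfl, ?_, by omega⟩
  simp [numQueries_append, numQueries]

/-- The amortized guarantee is applied to the finished history only, where the number of updates is
`D.card`. -/
theorem Reached.time_le (h : Reached A S w t₀ m₀ D q m τ)
    (hA : Server A S w N t₀ m₀ cst upd qry) : (τ : ℝ) ≤ cst + D.card * upd + q * qry := by
  obtain ⟨ops, E, T, hh, rfl, rfl, rfl⟩ := h
  have hl : S.Legal E [] := by trivial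
  obtain ⟨T', hs, hT⟩ := hA.serves (ops ++ []) (hh.legal hl)
  obtain ⟨T'', h0, rfl⟩ := hh.serves hs
  rw [List.append_nil, hh.numUpdates] at hT
  push_cast at hT ⊢
  have : (0 : ℝ) ≤ T'' := by positivity
  linarith

end

/-! ### The matching gadget -/

section
variable {N : ℕ}

theorem BipEdges.graph_adj (E : BipEdges N) {x y : Fin N ⊕ Fin N} :
    E.graph.Adj x y ↔ (∃ u v, x = .inl u ∧ y = .inr v ∧ (u, v) ∈ E) ∨
      (∃ u v, y = .inl u ∧ x = .inr v ∧ (u, v) ∈ E) := by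
  rw [graph, SimpleGraph.fromRel_adj]
  constructor
  · exact fun h => h.2
  · intro h
    refine ⟨?_, h⟩
    rcases h with ⟨u, v, rfl, rfl, -⟩ | ⟨u, v, rfl, rfl, -⟩ <;> simp

/-- A vertex cover bounds the size of a matching. -/
theorem IsMaxMatchingSize.le_of_cover {E : BipEdges N} {k : ℕ}
    (h : IsMaxMatchingSize E.graph k) (X Y : Finset (Fin N))
    (hc : ∀ u v, (u, v) ∈ E → u ∈ X ∨ v ∈ Y) : k ≤ X.card + Y.card := by
  classical
  obtain ⟨M, hM, rfl⟩ := h.1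
  have key : ∀ e ∈ M.edgeSet, ∃ z ∈ X.disjSum Y, z ∈ e := by
    intro e
    induction e with
    | h x y =>
      intro he
      rw [SimpleGraph.Subgraph.mem_edgeSet] at he
      rcases E.graph_adj.1 (M.adj_sub he) with ⟨u, v, rfl, rfl, huv⟩ | ⟨u, v, rfl, rfl, huv⟩ <;>
      rcases hc u v huv with hu | hv
      · exact ⟨.inl u, by simpa using hu, by simp⟩
      · exact ⟨.inr v, by simpa using hv, by simp⟩
      · exact ⟨.inl u, by simpa using hu, by simp⟩
      · exact ⟨.inr v, by simpa using hv, by simp⟩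
  -- The choice of a covering vertex for each edge needs a default value, so the case without
  -- vertices is separate.
  rcases isEmpty_or_nonempty (Fin N ⊕ Fin N) with hN | hN
  · rw [Set.eq_empty_of_isEmpty M.edgeSet, Set.ncard_empty]
    exact Nat.zero_le _
  choose! f hf hf' using key
  rw [← Finset.card_disjSum, ← Set.ncard_coe_finset]
  refine Set.ncard_le_ncard_of_injOn f hf ?_ (Finset.finite_toSet _)
  -- Two matching edges assigned the same cover vertex share that vertex, hence coincide.
  intro e he e' he' hee
  have h1 := hf' e he
  have h2 := hf' e' he'
  rw [← hee] at h2
  obtain ⟨y, hy⟩ := h1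
  obtain ⟨y', hy'⟩ := h2
  rw [hy, SimpleGraph.Subgraph.mem_edgeSet] at he
  rw [hy', SimpleGraph.Subgraph.mem_edgeSet] at he'
  rw [hy, hy', hM.eq_of_adj_left he he']

/-- A family of pairwise disjoint edges is a lower bound for the size of a maximum matching. -/
theorem IsMaxMatchingSize.card_le {E : BipEdges N} {k : ℕ}
    (h : IsMaxMatchingSize E.graph k) {ι : Type*} [Fintype ι] {f g : ι → Fin N}
    (hf : Function.Injective f) (hg : Function.Injective g) (hfg : ∀ i, (f i, g i) ∈ E) :
    Fintype.card ι ≤ k := by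
  classical
  let M : E.graph.Subgraph :=
    { verts := {x | ∃ i, x = .inl (f i) ∨ x = .inr (g i)}
      Adj := fun x y => ∃ i, (x = .inl (f i) ∧ y = .inr (g i)) ∨ (y = .inl (f i) ∧ x = .inr (g i))
      adj_sub := by
        rintro x y ⟨i, ⟨rfl, rfl⟩ | ⟨rfl, rfl⟩⟩
        · exact E.graph_adj.2 (.inl ⟨_, _, rfl, rfl, hfg i⟩)
        · exact E.graph_adj.2 (.inr ⟨_, _, rfl, rfl, hfg i⟩)
      edge_vert := by
        rintro x y ⟨i, ⟨rfl, rfl⟩ | ⟨rfl, rfl⟩⟩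
        · exact ⟨i, .inl rfl⟩
        · exact ⟨i, .inr rfl⟩
      symm := ⟨by
        rintro x y ⟨i, h⟩
        exact ⟨i, h.symm⟩⟩ }
  have hM : M.IsMatching := by
    rintro x ⟨i, rfl | rfl⟩
    · refine ⟨.inr (g i), ⟨i, .inl ⟨rfl, rfl⟩⟩, ?_⟩
      rintro y ⟨j, ⟨h1, rfl⟩ | ⟨rfl, h1⟩⟩
      · rw [hf (Sum.inl.inj h1)]
      · cases h1
    · refine ⟨.inl (f i), ⟨i, .inr ⟨rfl, rfl⟩⟩, ?_⟩
      rintro y ⟨j, ⟨h1, rfl⟩ | ⟨rfl, h1⟩⟩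
      · cases h1
      · rw [hg (Sum.inr.inj h1)]
  have hE : M.edgeSet = Set.range fun i => s(Sum.inl (f i), Sum.inr (g i)) := by
    ext e
    induction e with
    | h x y =>
      rw [SimpleGraph.Subgraph.mem_edgeSet]
      constructor
      · rintro ⟨i, ⟨rfl, rfl⟩ | ⟨rfl, rfl⟩⟩
        · exact ⟨i, rfl⟩
        · exact ⟨i, Sym2.eq_swap⟩
      · rintro ⟨i, hi⟩
        rcases Sym2.eq_iff.1 hi with ⟨rfl, rfl⟩ | ⟨rfl, rfl⟩
        · exact ⟨i, .inl ⟨rfl, rfl⟩⟩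
        · exact ⟨i, .inr ⟨rfl, rfl⟩⟩
  refine h.2 ⟨M, hM, ?_⟩
  rw [hE, ← Nat.card_coe_set_eq, Nat.card_range_of_injective, Nat.card_eq_fintype_card]
  intro i j hij
  rcases Sym2.eq_iff.1 hij with ⟨h1, -⟩ | ⟨h1, -⟩
  · exact hf (Sum.inl.inj h1)
  · cases h1

end

/-- Vertex number `i` of class `c`. On the left, the classes are `l, r, t, x`; on the right, they
are `l', r', s, y`. -/
def vtx {s : ℕ} (c : Fin 4) (i : Fin s) : Fin (4 * s) := finProdFinEquiv (c, i)

section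
variable {s : ℕ}

theorem vtx_val (c : Fin 4) (i : Fin s) : (vtx c i : ℕ) = c * s + i := by
  simp [vtx, finProdFinEquiv, mul_comm, add_comm]

@[simp] theorem vtx_inj {c c' : Fin 4} {i i' : Fin s} : vtx c i = vtx c' i' ↔ c = c' ∧ i = i' := by
  simp [vtx]

theorem exists_vtx (p : Fin (4 * s)) : ∃ c i, p = vtx c i :=
  ⟨(finProdFinEquiv.symm p).1, (finProdFinEquiv.symm p).2, (finProdFinEquiv.apply_symm_apply p).symm⟩

/-- The permanent edges `lᵢ l'ᵢ`, `rⱼ r'ⱼ`, and `rⱼ l'ᵢ` for the ones of the matrix. -/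
def IsBaseEdge (M : Fin s → Fin s → Prop) (c : Fin 4) (i : Fin s) (c' : Fin 4) (i' : Fin s) :
    Prop :=
  (c = 0 ∧ c' = 0 ∧ i = i') ∨ (c = 1 ∧ c' = 1 ∧ i = i') ∨ (c = 1 ∧ c' = 0 ∧ M i' i)

/-- The edges at `sⱼ` and `tⱼ` that are subject to change. -/
def IsPhaseEdge (c : Fin 4) (i : Fin s) (c' : Fin 4) (i' : Fin s) : Prop :=
  (c = 0 ∧ c' = 2) ∨ (c = 2 ∧ c' = 1) ∨ (c = 2 ∧ c' = 3 ∧ i = i') ∨ (c = 3 ∧ c' = 2 ∧ i = i')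

/-- The graph when the query of phase `k` is asked, where the phases in `cov` are neutralized by
the edges `tⱼ yⱼ` and `xⱼ sⱼ`. -/
structure QueryGraph (M : Fin s → Fin s → Prop) (u v : Fin s → Prop) (k : Fin s)
    (cov : Finset (Fin s)) (E : BipEdges (4 * s)) : Prop where
  notMem : k ∉ cov
  base : ∀ c i c' i', ¬ IsPhaseEdge c i c' i' →
    ((vtx c i, vtx c' i') ∈ E ↔ IsBaseEdge M c i c' i')
  left : ∀ i, (vtx 0 i, vtx 2 k) ∈ E ↔ u i
  right : ∀ i, (vtx 2 k, vtx 1 i) ∈ E ↔ v i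
  left_other : ∀ i j, j ≠ k → j ∉ cov → (vtx 0 i, vtx 2 j) ∉ E
  right_other : ∀ i j, j ≠ k → j ∉ cov → (vtx 2 j, vtx 1 i) ∉ E
  cover_right : ∀ j, (vtx 2 j, vtx 3 j) ∈ E ↔ j ∈ cov
  cover_left : ∀ j, (vtx 3 j, vtx 2 j) ∈ E ↔ j ∈ cov

variable {M : Fin s → Fin s → Prop} {u v : Fin s → Prop} {k : Fin s} {cov : Finset (Fin s)}
  {E : BipEdges (4 * s)} {a : ℕ}

/-- The cover consists of `lᵢ` for `u i`, `l'ᵢ` for `¬ u i`, `r'ⱼ` for `v j`, `rⱼ` for `¬ v j`, and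
`tⱼ`, `sⱼ` for `j` in `cov`. The edges of phase `k` are met at `lᵢ` and `r'ⱼ`. An edge `rⱼ l'ᵢ`
would be missed only if `u i` and `v j` held, which `hM` excludes. -/
theorem QueryGraph.answer_le (h : QueryGraph M u v k cov E) (ha : IsMaxMatchingSize E.graph a)
    (hM : ∀ i j, u i → M i j → ¬ v j) : a ≤ 2 * s + 2 * cov.card := by
  classical
  let X : Finset (Fin (4 * s)) := (Finset.univ.filter u).image (vtx 0) ∪
    (Finset.univ.filter fun j => ¬ v j).image (vtx 1) ∪ cov.image (vtx 2)
  let Y : Finset (Fin (4 * s)) := (Finset.univ.filter fun i => ¬ u i).image (vtx 0) ∪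
    (Finset.univ.filter v).image (vtx 1) ∪ cov.image (vtx 2)
  have hX : X.card ≤ (Finset.univ.filter u).card + (Finset.univ.filter fun j => ¬ v j).card +
      cov.card := by
    refine (Finset.card_union_le _ _).trans (add_le_add ((Finset.card_union_le _ _).trans ?_) ?_)
    · exact add_le_add Finset.card_image_le Finset.card_image_le
    · exact Finset.card_image_le
  have hY : Y.card ≤ (Finset.univ.filter fun i => ¬ u i).card + (Finset.univ.filter v).card +
      cov.card := by
    refine (Finset.card_union_le _ _).trans (add_le_add ((Finset.card_union_le _ _).trans ?_) ?_)
    · exact add_le_add Finset.card_image_le Finset.card_image_le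
    · exact Finset.card_image_le
  have hu := Finset.card_filter_add_card_filter_not (s := (Finset.univ : Finset (Fin s))) u
  have hv := Finset.card_filter_add_card_filter_not (s := (Finset.univ : Finset (Fin s))) v
  rw [Finset.card_univ, Fintype.card_fin] at hu hv
  refine (ha.le_of_cover X Y ?_).trans (by omega)
  intro p q hpq
  obtain ⟨c, i, rfl⟩ := exists_vtx p
  obtain ⟨c', i', rfl⟩ := exists_vtx q
  by_cases hph : IsPhaseEdge c i c' i'
  · rcases hph with ⟨rfl, rfl⟩ | ⟨rfl, rfl⟩ | ⟨rfl, rfl, rfl⟩ | ⟨rfl, rfl, rfl⟩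
    · by_cases hk : i' = k
      · subst hk
        have := (h.left i).1 hpq
        left; simp [X, this]
      · by_cases hc : i' ∈ cov
        · right; simp [Y, hc]
        · exact absurd hpq (h.left_other i i' hk hc)
    · by_cases hk : i = k
      · subst hk
        have := (h.right i').1 hpq
        right; simp [Y, this]
      · by_cases hc : i ∈ cov
        · left; simp [X, hc]
        · exact absurd hpq (h.right_other i' i hk hc)
    · have := (h.cover_right i).1 hpq
      left; simp [X, this]
    · have := (h.cover_left i).1 hpq
      right; simp [Y, this]
  · rcases (h.base c i c' i' hph).1 hpq with ⟨rfl, rfl, rfl⟩ | ⟨rfl, rfl, rfl⟩ | ⟨rfl, rfl, hm⟩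
    · by_cases hi : u i
      · left; simp [X, hi]
      · right; simp [Y, hi]
    · by_cases hi : v i
      · right; simp [Y, hi]
      · left; simp [X, hi]
    · by_cases hi : u i'
      · left; simp [X, hM i' i hi hm]
      · right; simp [Y, hi]

/-- The matching formed by the edges `lᵢ l'ᵢ`, `rⱼ r'ⱼ` and the neutralizing edges is augmented
along `t_k r'_{j₀} r_{j₀} l'_{i₀} l_{i₀} s_k`. -/
theorem QueryGraph.lt_answer (h : QueryGraph M u v k cov E) (ha : IsMaxMatchingSize E.graph a)
    {i₀ j₀ : Fin s} (hu : u i₀) (hM : M i₀ j₀) (hv : v j₀) : 2 * s + 2 * cov.card < a := by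
  classical
  -- Matching edges are indexed by their left end points: the classes `l` and `r`, then `t_k` as
  -- `none` and `tⱼ` for covered phases, then `xⱼ`.
  let f : (Fin s ⊕ Fin s) ⊕ (Option cov ⊕ cov) → Fin (4 * s) := fun z => match z with
    | .inl (.inl i) => vtx 0 i
    | .inl (.inr i) => vtx 1 i
    | .inr (.inl none) => vtx 2 k
    | .inr (.inl (some j)) => vtx 2 j
    | .inr (.inr j) => vtx 3 j
  -- The partners after switching the path: `l_{i₀}` gets `s_k`, `r_{j₀}` gets `l'_{i₀}`, and `t_k`
  -- gets `r'_{j₀}`.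
  let g : (Fin s ⊕ Fin s) ⊕ (Option cov ⊕ cov) → Fin (4 * s) := fun z => match z with
    | .inl (.inl i) => if i = i₀ then vtx 2 k else vtx 0 i
    | .inl (.inr i) => if i = j₀ then vtx 0 i₀ else vtx 1 i
    | .inr (.inl none) => vtx 1 j₀
    | .inr (.inl (some j)) => vtx 3 j
    | .inr (.inr j) => vtx 2 j
  have hne : ∀ j : cov, k ≠ j := fun j hj => h.notMem (hj ▸ j.2)
  have hf : Function.Injective f := by
    rintro ((i | i) | ((_ | i) | i)) ((j | j) | ((_ | j) | j)) hij <;>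
      simp only [f, vtx_inj] at hij <;> revert hij <;> simp [hne, (hne _).symm]
  have hg : Function.Injective g := by
    rintro ((i | i) | ((_ | i) | i)) ((j | j) | ((_ | j) | j)) hij <;>
      simp only [g] at hij <;> revert hij <;> (try split_ifs) <;> simp [hne, (hne _).symm] <;> grind
  have hfg : ∀ z, (f z, g z) ∈ E := by
    rintro ((i | i) | ((_ | i) | i)) <;> simp only [f, g]
    · split_ifs with hi
      · subst hi; exact (h.left i).2 hu
      · exact (h.base 0 i 0 i (by simp [IsPhaseEdge])).2 (by simp [IsBaseEdge])
    · split_ifs with hi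
      · subst hi
        exact (h.base 1 i 0 i₀ (by simp [IsPhaseEdge])).2 (by simp [IsBaseEdge, hM])
      · exact (h.base 1 i 1 i (by simp [IsPhaseEdge])).2 (by simp [IsBaseEdge])
    · exact (h.right j₀).2 hv
    · exact (h.cover_right i).2 i.2
    · exact (h.cover_left i).2 i.2
  have := ha.card_le hf hg hfg
  simp only [Fintype.card_sum, Fintype.card_fin, Fintype.card_option, Fintype.card_coe] at this
  omega

end

/-! ### Phases of the gadget -/

/-- The phases that are neutralized at the query of phase `k`. -/
def Setting.covered (S : Setting) {s : ℕ} (k : Fin s) : Finset (Fin s) :=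
  match S with
  | .incremental => Finset.Iio k
  | .decremental => Finset.Ioi k

/-- The set `D` of updated edges after `k` phases. -/
structure PhaseState (S : Setting) {s : ℕ} (M : Fin s → Fin s → Prop) (k : ℕ)
    (D : BipEdges (4 * s)) : Prop where
  base : ∀ c i c' i', ¬ IsPhaseEdge c i c' i' →
    ((vtx c i, vtx c' i') ∈ S.touched D ↔ IsBaseEdge M c i c' i')
  left : ∀ (i j : Fin s), k ≤ j → (vtx 0 i, vtx 2 j) ∉ D
  right : ∀ (i j : Fin s), k ≤ j → (vtx 2 j, vtx 1 i) ∉ D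
  left_done : ∀ (i j : Fin s), j < k → S = .decremental → (vtx 0 i, vtx 2 j) ∈ D
  right_done : ∀ (i j : Fin s), j < k → S = .decremental → (vtx 2 j, vtx 1 i) ∈ D
  cover_right : ∀ j : Fin s, (vtx 2 j, vtx 3 j) ∈ D ↔ j < k
  cover_left : ∀ j : Fin s, (vtx 3 j, vtx 2 j) ∈ D ↔ j < k

/-- The star edges of phase `k` given by `P` and `Q` have been added to `D`. -/
def StarAdded {s : ℕ} (k : Fin s) (P Q : Fin s → Prop) (D D' : BipEdges (4 * s)) : Prop :=
  ∀ e, e ∈ D' ↔ e ∈ D ∨ (∃ i, P i ∧ e = (vtx 0 i, vtx 2 k)) ∨ ∃ i, Q i ∧ e = (vtx 2 k, vtx 1 i)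

/-- The edges that neutralize phase `k` have been added to `D`. -/
def CoverAdded {s : ℕ} (k : Fin s) (D D' : BipEdges (4 * s)) : Prop :=
  ∀ e, e ∈ D' ↔ e ∈ D ∨ e = (vtx 2 k, vtx 3 k) ∨ e = (vtx 3 k, vtx 2 k)

section
variable {s : ℕ} {M : Fin s → Fin s → Prop} {k : Fin s} {u v : Fin s → Prop}
  {D D₁ D₂ D₃ : BipEdges (4 * s)}

theorem StarAdded.mem_iff {P Q : Fin s → Prop} (h : StarAdded k P Q D D₁) {c c' : Fin 4}
    {i i' : Fin s} : (vtx c i, vtx c' i') ∈ D₁ ↔ (vtx c i, vtx c' i') ∈ D ∨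
      (c = 0 ∧ c' = 2 ∧ i' = k ∧ P i) ∨ (c = 2 ∧ c' = 1 ∧ i = k ∧ Q i') := by
  rw [h]
  simp only [Prod.mk.injEq, vtx_inj]
  refine or_congr Iff.rfl (or_congr ⟨?_, ?_⟩ ⟨?_, ?_⟩)
  · rintro ⟨j, hj, ⟨rfl, rfl⟩, rfl, rfl⟩; exact ⟨rfl, rfl, rfl, hj⟩
  · rintro ⟨rfl, rfl, rfl, hj⟩; exact ⟨i, hj, ⟨rfl, rfl⟩, rfl, rfl⟩
  · rintro ⟨j, hj, ⟨rfl, rfl⟩, rfl, rfl⟩; exact ⟨rfl, rfl, rfl, hj⟩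
  · rintro ⟨rfl, rfl, rfl, hj⟩; exact ⟨i', hj, ⟨rfl, rfl⟩, rfl, rfl⟩

theorem CoverAdded.mem_iff (h : CoverAdded k D D₁) {c c' : Fin 4}
    {i i' : Fin s} : (vtx c i, vtx c' i') ∈ D₁ ↔ (vtx c i, vtx c' i') ∈ D ∨
      (c = 2 ∧ c' = 3 ∧ i = k ∧ i' = k) ∨ (c = 3 ∧ c' = 2 ∧ i = k ∧ i' = k) := by
  rw [h]
  simp only [Prod.mk.injEq, vtx_inj]
  tauto

/-- Earlier phases carry their neutralizing edges, and later phases have no star edges yet; only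
phase `k` is active. -/
theorem PhaseState.queryGraph_incremental (h : PhaseState .incremental M k D)
    (h₁ : StarAdded k u v D D₁) :
    QueryGraph M u v k (Setting.covered .incremental k) (Setting.touched .incremental D₁) := by
  have e : ∀ D : BipEdges (4 * s), Setting.touched .incremental D = D := fun _ => rfl
  have hb := h.base
  rw [e] at hb ⊢
  refine ⟨by simp [Setting.covered], fun c i c' i' hp => ?_, fun i => ?_, fun i => ?_,
    fun i j hj hc => ?_, fun i j hj hc => ?_, fun j => ?_, fun j => ?_⟩
  · rw [h₁.mem_iff, ← hb c i c' i' hp]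
    simp only [IsPhaseEdge] at hp
    tauto
  · simp [h₁.mem_iff, h.left i k le_rfl]
  · simp [h₁.mem_iff, h.right i k le_rfl]
  · have : (k : ℕ) ≤ j := by simpa [Setting.covered] using hc
    simp [h₁.mem_iff, h.left i j this, hj]
  · have : (k : ℕ) ≤ j := by simpa [Setting.covered] using hc
    simp [h₁.mem_iff, h.right i j this, hj]
  · simp [h₁.mem_iff, h.cover_right, Setting.covered]
  · simp [h₁.mem_iff, h.cover_left, Setting.covered]

theorem PhaseState.next_incremental (h : PhaseState .incremental M k D)
    (h₁ : StarAdded k u v D D₁) (h₂ : CoverAdded k D₁ D₂) :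
    PhaseState .incremental M (k + 1) D₂ := by
  have e : ∀ D : BipEdges (4 * s), Setting.touched .incremental D = D := fun _ => rfl
  have hb := h.base
  rw [e] at hb
  refine ⟨fun c i c' i' hp => ?_, fun i j hj => ?_, fun i j hj => ?_, fun i j hj => by simp,
    fun i j hj => by simp, fun j => ?_, fun j => ?_⟩
  · rw [e, h₂.mem_iff, h₁.mem_iff, ← hb c i c' i' hp]
    simp only [IsPhaseEdge] at hp
    constructor
    · rintro ((h | h | h) | h | h)
      · exact h
      · exact absurd (Or.inl ⟨h.1, h.2.1⟩) hp
      · exact absurd (Or.inr (Or.inl ⟨h.1, h.2.1⟩)) hp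
      · exact absurd (Or.inr (Or.inr (Or.inl ⟨h.1, h.2.1, h.2.2.1.trans h.2.2.2.symm⟩))) hp
      · exact absurd (Or.inr (Or.inr (Or.inr ⟨h.1, h.2.1, h.2.2.1.trans h.2.2.2.symm⟩))) hp
    · exact fun h => Or.inl (Or.inl h)
  · have hk : j ≠ k := by rintro rfl; omega
    simp [h₂.mem_iff, h₁.mem_iff, h.left i j (by omega), hk]
  · have hk : j ≠ k := by rintro rfl; omega
    simp [h₂.mem_iff, h₁.mem_iff, h.right i j (by omega), hk]
  · simp only [h₂.mem_iff, h₁.mem_iff, h.cover_right]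
    simp [Fin.ext_iff]; omega
  · simp only [h₂.mem_iff, h₁.mem_iff, h.cover_left]
    simp [Fin.ext_iff]; omega

/-- The picture is reversed in time: later phases still have their neutralizing edges, and earlier
phases have lost all star edges. Deleting the star edges outside `u` and `v` leaves exactly the
required ones. -/
theorem PhaseState.queryGraph_decremental (h : PhaseState .decremental M k D)
    (h₁ : StarAdded k (fun i => ¬ u i) (fun i => ¬ v i) D D₁) (h₂ : CoverAdded k D₁ D₂) :
    QueryGraph M u v k (Setting.covered .decremental k) (Setting.touched .decremental D₂) := by
  have e : ∀ (D : BipEdges (4 * s)) x, x ∈ Setting.touched .decremental D ↔ x ∉ D :=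
    fun _ _ => Finset.mem_compl
  have hb := h.base
  refine ⟨by simp [Setting.covered], fun c i c' i' hp => ?_, fun i => ?_, fun i => ?_,
    fun i j hj hc => ?_, fun i j hj hc => ?_, fun j => ?_, fun j => ?_⟩
  · rw [← hb c i c' i' hp, e, e, not_iff_not, h₂.mem_iff, h₁.mem_iff]
    simp only [IsPhaseEdge] at hp
    constructor
    · rintro ((h | h | h) | h | h)
      · exact h
      · exact absurd (Or.inl ⟨h.1, h.2.1⟩) hp
      · exact absurd (Or.inr (Or.inl ⟨h.1, h.2.1⟩)) hp
      · exact absurd (Or.inr (Or.inr (Or.inl ⟨h.1, h.2.1, h.2.2.1.trans h.2.2.2.symm⟩))) hp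
      · exact absurd (Or.inr (Or.inr (Or.inr ⟨h.1, h.2.1, h.2.2.1.trans h.2.2.2.symm⟩))) hp
    · exact fun h => Or.inl (Or.inl h)
  · simp [e, h₂.mem_iff, h₁.mem_iff, h.left i k le_rfl]
  · simp [e, h₂.mem_iff, h₁.mem_iff, h.right i k le_rfl]
  · have : j ≤ k := by simpa [Setting.covered] using hc
    simp [e, h₂.mem_iff, h₁.mem_iff, h.left_done i j (Fin.lt_def.1 (lt_of_le_of_ne this hj)) rfl]
  · have : j ≤ k := by simpa [Setting.covered] using hc
    simp [e, h₂.mem_iff, h₁.mem_iff, h.right_done i j (Fin.lt_def.1 (lt_of_le_of_ne this hj)) rfl]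
  · rw [e, h₂.mem_iff, h₁.mem_iff, h.cover_right]
    simp [Setting.covered, Fin.ext_iff]; omega
  · rw [e, h₂.mem_iff, h₁.mem_iff, h.cover_left]
    simp [Setting.covered, Fin.ext_iff]; omega

/-- The deletions before the query and those after it are complementary, so all star edges of phase
`k` are gone. Phase `k` thereby becomes harmless although its neutralizing edges have been deleted.
-/
theorem PhaseState.next_decremental (h : PhaseState .decremental M k D)
    (h₁ : StarAdded k (fun i => ¬ u i) (fun i => ¬ v i) D D₁) (h₂ : CoverAdded k D₁ D₂)
    (h₃ : StarAdded k u v D₂ D₃) : PhaseState .decremental M (k + 1) D₃ := by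
  have e : ∀ (D : BipEdges (4 * s)) x, x ∈ Setting.touched .decremental D ↔ x ∉ D :=
    fun _ _ => Finset.mem_compl
  have hb := h.base
  refine ⟨fun c i c' i' hp => ?_, fun i j hj => ?_, fun i j hj => ?_, fun i j hj _ => ?_,
    fun i j hj _ => ?_, fun j => ?_, fun j => ?_⟩
  · rw [← hb c i c' i' hp, e, e, not_iff_not, h₃.mem_iff, h₂.mem_iff, h₁.mem_iff]
    simp only [IsPhaseEdge] at hp
    constructor
    · rintro (((h | h | h) | h | h) | h | h)
      · exact h
      · exact absurd (Or.inl ⟨h.1, h.2.1⟩) hp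
      · exact absurd (Or.inr (Or.inl ⟨h.1, h.2.1⟩)) hp
      · exact absurd (Or.inr (Or.inr (Or.inl ⟨h.1, h.2.1, h.2.2.1.trans h.2.2.2.symm⟩))) hp
      · exact absurd (Or.inr (Or.inr (Or.inr ⟨h.1, h.2.1, h.2.2.1.trans h.2.2.2.symm⟩))) hp
      · exact absurd (Or.inl ⟨h.1, h.2.1⟩) hp
      · exact absurd (Or.inr (Or.inl ⟨h.1, h.2.1⟩)) hp
    · exact fun h => Or.inl (Or.inl (Or.inl h))
  · have hk : j ≠ k := by rintro rfl; omega
    simp [h₃.mem_iff, h₂.mem_iff, h₁.mem_iff, h.left i j (by omega), hk]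
  · have hk : j ≠ k := by rintro rfl; omega
    simp [h₃.mem_iff, h₂.mem_iff, h₁.mem_iff, h.right i j (by omega), hk]
  · by_cases hk : j = k
    · simp [h₃.mem_iff, h₂.mem_iff, h₁.mem_iff, hk]; tauto
    · have : (j : ℕ) ≠ k := fun h => hk (Fin.ext h)
      simp [h₃.mem_iff, h₂.mem_iff, h₁.mem_iff, h.left_done i j (by omega) rfl]
  · by_cases hk : j = k
    · simp [h₃.mem_iff, h₂.mem_iff, h₁.mem_iff, hk]; tauto
    · have : (j : ℕ) ≠ k := fun h => hk (Fin.ext h)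
      simp [h₃.mem_iff, h₂.mem_iff, h₁.mem_iff, h.right_done i j (by omega) rfl]
  · simp only [h₃.mem_iff, h₂.mem_iff, h₁.mem_iff, h.cover_right]
    simp [Fin.ext_iff]; omega
  · simp only [h₃.mem_iff, h₂.mem_iff, h₁.mem_iff, h.cover_left]
    simp [Fin.ext_iff]; omega

end

/-! ### Running the gadget on the machine

Register `1` holds `s`, register `2` the number of the current vector, register `5` the offset of
the window of the instance; register `6` is the counter of inner loops, and register `7` receives
the answers of queries. -/

/-- A word RAM on which instances of a matching algorithm for graphs with `4 s + 4 s` vertices are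
run in windows of length `st`. -/
structure Host (A : MatchingAlg) (S : Setting) (w X w' st s t₀ : ℕ) (m₀ : Memory)
    (cst upd qry : ℝ) : Prop where
  fits : Fits X w
  le : w' ≤ w
  window : 2 ^ w' ≤ st
  two_le : 2 ≤ st
  pos : 0 < s
  edges_le : 16 * s * s ≤ X
  server : Server A S w' (4 * s) t₀ m₀ cst upd qry

/-- The window at `base` contains an instance with updated edges `D` and `q` queries, which has
taken `τ` steps so far. -/
def InstanceAt (A : MatchingAlg) (S : Setting) (w' st : ℕ) {N : ℕ} (t₀ : ℕ) (m₀ : Memory)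
    (base : ℕ) (mem : Memory) (D : BipEdges N) (q τ : ℕ) : Prop :=
  ∃ m, Holds base st m mem ∧ Reached A S w' t₀ m₀ D q m τ

/-- Only the window at `base`, the loop counter and the answer register have changed. -/
structure GuestStep (X base st : ℕ) (σ σ' : MState) : Prop where
  small : SmallState X σ'
  reg : ∀ r < 6, σ'.reg r = σ.reg r
  frame : FrameEq base st σ.mem σ'.mem

theorem GuestStep.trans {X base st : ℕ} {σ σ' σ'' : MState} (h : GuestStep X base st σ σ')
    (h' : GuestStep X base st σ' σ'') : GuestStep X base st σ σ'' :=
  ⟨h'.small, fun r hr => (h'.reg r hr).trans (h.reg r hr), h.frame.trans h'.frame⟩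

/-- In every state that the steps of a guest can lead to, `e` decides `P i` for the value `i` of
the loop counter. -/
def Decides {s : ℕ} (e : RamExpr) (σ : MState) (P : Fin s → Prop) : Prop :=
  ∀ (i : Fin s) (σ' : MState), (∀ r < 6, σ'.reg r = σ.reg r) → (∀ a < 5, σ'.mem a = σ.mem a) →
    σ'.reg 6 = i → (e.eval σ' ≠ 0 ↔ P i)

theorem Decides.of_step {s X base st : ℕ} {e : RamExpr} {σ σ' : MState} {P : Fin s → Prop}
    (h : Decides e σ P) (hs : GuestStep X base st σ σ') : Decides e σ' P :=
  fun i σ₁ h₁ h₂ h₃ => h i σ₁ (fun r hr => (h₁ r hr).trans (hs.reg r hr))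
    (fun a ha => (h₂ a ha).trans (hs.frame.data ha)) h₃

theorem Decides.eqE_zero {s : ℕ} {e : RamExpr} {σ : MState} {P : Fin s → Prop}
    (h : Decides e σ P) : Decides (.eqE e 0) σ fun i => ¬ P i := by
  intro i σ' h₁ h₂ h₃
  have := not_congr (h i σ' h₁ h₂ h₃)
  rw [not_not] at this
  refine Iff.trans ?_ this
  rw [RamExpr.eval_eqE, RamExpr.eval_zero]
  split_ifs with h0 <;> simp [h0]

open RamExpr in
/-- The number `2 s + k` of the special vertices of the current phase `k`. -/
def phaseVertexE : RamExpr := 2 * var 1 + var 2 % var 1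

namespace MatchingAlg
open RamExpr
variable (A : MatchingAlg)

/-- If `e` is nonzero, update the edge `(p, q)`. -/
def updateIf (e p q : RamExpr) : Prog := .cond e (.guestCall A.update [p, q]) .skip

/-- Update the star edges of the current phase that are selected by `eu` and `ev`. -/
def starLoop (eu ev : RamExpr) : Prog :=
  .forLoop 6 (var 1) (.seq (A.updateIf eu (var 6) phaseVertexE)
    (A.updateIf ev phaseVertexE (var 1 + var 6)))

/-- Update the edges that neutralize the current phase. -/
def coverUpdates : Prog :=
  .seq (A.updateIf 1 phaseVertexE (var 1 + phaseVertexE))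
    (A.updateIf 1 (var 1 + phaseVertexE) phaseVertexE)

/-- Ask a query and put the answer into register `7`. -/
def ask : Prog := .seq (.guestCall A.query []) (.load 7 6 5)

/-- One phase, for the vectors given by `eu` and `ev`. -/
def phase (S : Setting) (eu ev : RamExpr) : Prog :=
  match S with
  | .incremental => .seq (A.starLoop eu ev) (.seq A.ask A.coverUpdates)
  | .decremental => .seq (A.starLoop (eqE eu 0) (eqE ev 0))
      (.seq A.coverUpdates (.seq A.ask (A.starLoop eu ev)))

/-- Initialize an instance and update the edges `(p, q)` for which `e` is nonzero when the loop
counter is `4 s p + q`. -/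
def start (e : RamExpr) : Prog :=
  .seq (.guestCall A.setup [4 * var 1])
    (.forLoop 6 (16 * var 1 * var 1)
      (A.updateIf e (var 6 / (4 * var 1)) (var 6 % (4 * var 1))))

/-- A bound for the bookkeeping of single operations. -/
def overhead : ℕ := A.setup.regBound + A.update.regBound + A.query.regBound + 1000

end MatchingAlg

/-! ### Subroutines of one phase, with their running times. -/

section
variable {A : MatchingAlg} {S : Setting} {w X w' st s t₀ base q τ : ℕ} {m₀ : Memory}
  {cst upd qry : ℝ} {σ : MState} {D : BipEdges (4 * s)}

local notation "Inst" => InstanceAt A S w' st t₀ m₀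

/-- Throughout, the time of the host is compared with twice the growth of the guest time `τ`.
Keeping both values of `τ` in the inequality lets these bounds telescope without subtraction, and
the amortized guarantee is needed only once, at the very end. -/
theorem runs_updateIf (H : Host A S w X w' st s t₀ m₀ cst upd qry) (hσ : SmallState X σ)
    (h5 : σ.reg 5 = base) (hb : base + st ≤ X) (hD : Inst base σ.mem D q τ)
    {e p r : RamExpr} (he : e.ok = true) (hp : p.ok = true) (hr : r.ok = true)
    (hsz : e.size + p.size + r.size ≤ 800)
    {x : Fin (4 * s) × Fin (4 * s)} (hpx : p.eval σ = x.1) (hrx : r.eval σ = x.2)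
    (hx : e.eval σ ≠ 0 → x ∉ D) :
    ∃ T mem' D' τ', Runs w (A.updateIf e p r) σ T ⟨σ.reg, mem'⟩ ∧ FrameEq base st σ.mem mem' ∧
      Inst base mem' D' q τ' ∧ (∀ y, y ∈ D' ↔ y ∈ D ∨ e.eval σ ≠ 0 ∧ y = x) ∧
      T + 2 * τ ≤ A.overhead + 2 * τ' := by
  obtain ⟨m, hm, hreach⟩ := hD
  by_cases he0 : e.eval σ = 0
  · refine ⟨_, σ.mem, D, τ, Runs.cond_false H.fits hσ he he0 Runs.skip, .refl _ _ _,
      ⟨m, hm, hreach⟩, by simp [he0], ?_⟩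
    simp only [MatchingAlg.overhead]; omega
  · obtain ⟨t, m', hc, hreach'⟩ := hreach.update H.server (hx he0)
    obtain ⟨mem', hrun, hf, hm'⟩ := Runs.guestCall H.fits H.le H.window
      (H.fits.lt_word hb).le (es := [p, r]) (by simp [hp, hr]) H.two_le (by simp) hσ h5 hm
      (by simp [hpx, hrx]) hc
    refine ⟨_, mem', _, _, Runs.cond_true H.fits hσ he he0 hrun, hf, ⟨m', hm', hreach'⟩, ?_, ?_⟩
    · intro y
      simp [he0, or_comm]
    · simp only [MatchingAlg.overhead, List.map_cons, List.map_nil, List.sum_cons, List.sum_nil,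
        List.length_cons, List.length_nil]
      omega

theorem phaseVertexE_eval {σ : MState} {k : Fin s} (h1 : σ.reg 1 = s) (h2 : σ.reg 2 % s = k) :
    phaseVertexE.eval σ = vtx (2 : Fin 4) k := by
  simp [phaseVertexE, vtx_val, h1, h2]

theorem exists_lt_succ_iff {j : ℕ} (hj : j < s) (R : Fin s → Prop) :
    (∃ i : Fin s, i < j + 1 ∧ R i) ↔ (∃ i : Fin s, i < j ∧ R i) ∨ R ⟨j, hj⟩ := by
  constructor
  · rintro ⟨i, hi, h⟩
    rcases Nat.lt_succ_iff_lt_or_eq.1 hi with hi | hi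
    · exact .inl ⟨i, hi, h⟩
    · right
      have : i = ⟨j, hj⟩ := Fin.ext hi
      rwa [← this]
  · rintro (⟨i, hi, h⟩ | h)
    · exact ⟨i, by omega, h⟩
    · exact ⟨⟨j, hj⟩, by simp, h⟩

/-- One round of `starLoop`. -/
theorem runs_starRound (H : Host A S w X w' st s t₀ m₀ cst upd qry) (hσ : SmallState X σ)
    (h5 : σ.reg 5 = base) (hb : base + st ≤ X) (hD : Inst base σ.mem D q τ)
    (h1 : σ.reg 1 = s) {k : Fin s} (h2 : σ.reg 2 % s = k) {eu ev : RamExpr} (hu : eu.ok = true)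
    (hv : ev.ok = true) (hus : eu.size ≤ 100) (hvs : ev.size ≤ 100) {P Q : Fin s → Prop}
    (hP : Decides eu σ P) (hQ : Decides ev σ Q) {i : Fin s} (h6 : σ.reg 6 = i)
    (hPD : P i → (vtx 0 i, vtx 2 k) ∉ D) (hQD : Q i → (vtx 2 k, vtx 1 i) ∉ D) :
    ∃ T mem' D' τ', Runs w (.seq (A.updateIf eu (.var 6) phaseVertexE)
        (A.updateIf ev phaseVertexE (.var 1 + .var 6))) σ T ⟨σ.reg, mem'⟩ ∧
      FrameEq base st σ.mem mem' ∧ Inst base mem' D' q τ' ∧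
      (∀ e, e ∈ D' ↔ e ∈ D ∨ (P i ∧ e = (vtx 0 i, vtx 2 k)) ∨ (Q i ∧ e = (vtx 2 k, vtx 1 i))) ∧
      T + 2 * τ ≤ 2 * A.overhead + 2 * τ' := by
  have hPi := hP i σ (fun _ _ => rfl) (fun _ _ => rfl) h6
  obtain ⟨T₂, mem₂, D₂, τ₂, hr₂, hf₂, hI₂, hD₂, hT₂⟩ := runs_updateIf H hσ h5 hb hD
    hu (p := .var 6) (r := phaseVertexE) (by decide) (by decide)
    (by have : (RamExpr.var 6).size + phaseVertexE.size = 8 := rfl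
        omega)
    (x := (vtx 0 i, vtx 2 k)) (by simp [h6, vtx_val]) (phaseVertexE_eval h1 h2)
    (fun h0 => hPD (hPi.1 h0))
  have hs₂ : SmallState X ⟨σ.reg, mem₂⟩ := hf₂.smallState hσ
  have hQi := hQ i ⟨σ.reg, mem₂⟩ (fun _ _ => rfl) (fun a ha => hf₂.data ha) h6
  obtain ⟨T₃, mem₃, D₃, τ₃, hr₃, hf₃, hI₃, hD₃, hT₃⟩ := runs_updateIf H hs₂ h5 hb hI₂
    hv (p := phaseVertexE) (r := .var 1 + .var 6) (by decide) (by decide)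
    (by have : phaseVertexE.size + (RamExpr.var 1 + RamExpr.var 6).size = 10 := rfl
        omega)
    (x := (vtx 2 k, vtx 1 i)) (phaseVertexE_eval (σ := ⟨σ.reg, mem₂⟩) h1 h2)
    (by simp [h6, h1, vtx_val])
    (by
      intro h0
      rw [hD₂]
      rintro (h | ⟨-, h⟩)
      · exact hQD (hQi.1 h0) h
      · simp at h)
  refine ⟨T₂ + T₃, mem₃, D₃, τ₃, Runs.seq hr₂ hr₃, hf₂.trans hf₃, hI₃, fun e => ?_, by omega⟩
  rw [hD₃, hD₂, hPi, hQi, or_assoc]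

theorem runs_starLoop (H : Host A S w X w' st s t₀ m₀ cst upd qry) (hσ : SmallState X σ)
    (h5 : σ.reg 5 = base) (hb : base + st ≤ X) (hD : Inst base σ.mem D q τ)
    (h1 : σ.reg 1 = s) {k : Fin s} (h2 : σ.reg 2 % s = k) {eu ev : RamExpr} (hu : eu.ok = true)
    (hv : ev.ok = true) (hus : eu.size ≤ 100) (hvs : ev.size ≤ 100) {P Q : Fin s → Prop}
    (hP : Decides eu σ P) (hQ : Decides ev σ Q)
    (hPD : ∀ i, P i → (vtx 0 i, vtx 2 k) ∉ D) (hQD : ∀ i, Q i → (vtx 2 k, vtx 1 i) ∉ D) :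
    ∃ T σ' D' τ', Runs w (A.starLoop eu ev) σ T σ' ∧ GuestStep X base st σ σ' ∧
      σ'.reg 7 = σ.reg 7 ∧ Inst base σ'.mem D' q τ' ∧ StarAdded k P Q D D' ∧
      T + 2 * τ ≤ 3 * A.overhead * (s + 1) + 2 * τ' := by
  have hsX : s ≤ X := by rw [← h1]; exact hσ.reg 1 (by norm_num)
  -- After `j` rounds exactly the selected star edges with index below `j` have been added, so the
  -- two edges of round `j` are still untouched and may legally be updated.
  let I : ℕ → MState → ℕ → Prop := fun j σ' T => GuestStep X base st σ σ' ∧ σ'.reg 6 = j ∧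
    σ'.reg 7 = σ.reg 7 ∧ ∃ D' τ', Inst base σ'.mem D' q τ' ∧
      (∀ e, e ∈ D' ↔ e ∈ D ∨ (∃ i : Fin s, i < j ∧ P i ∧ e = (vtx 0 i, vtx 2 k)) ∨
        ∃ i : Fin s, i < j ∧ Q i ∧ e = (vtx 2 k, vtx 1 i)) ∧
      T + 2 * τ ≤ 2 * A.overhead * j + 2 * τ'
  have step : ∀ j < s, ∀ σ₁ T, I j σ₁ T → ∃ T' σ',
      Runs w (.seq (A.updateIf eu (.var 6) phaseVertexE)
        (A.updateIf ev phaseVertexE (.var 1 + .var 6))) σ₁ T' σ' ∧ SmallState X σ' ∧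
      σ'.reg 6 = j ∧ I (j + 1) (σ'.setReg 6 (j + 1)) (T + T') := by
    rintro j hj σ₁ T ⟨hg, h6, h7, D₁, τ₁, hI, hD₁, hT⟩
    obtain ⟨T₂, mem₂, D₂, τ₂, hr₂, hf₂, hI₂, hD₂, hT₂⟩ := runs_starRound H hg.small
      ((hg.reg 5 (by norm_num)).trans h5) hb hI ((hg.reg 1 (by norm_num)).trans h1) (k := k)
      (by rw [hg.reg 2 (by norm_num), h2]) hu hv hus hvs (hP.of_step hg) (hQ.of_step hg)
      (i := ⟨j, hj⟩) h6
      (by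
        intro h0
        rw [hD₁]
        rintro (h | ⟨i, hi, -, h⟩ | ⟨i, hi, -, h⟩)
        · exact hPD _ h0 h
        · simp only [Prod.mk.injEq, vtx_inj, true_and, and_true] at h
          subst h
          simp at hi
        · simp at h)
      (by
        intro h0
        rw [hD₁]
        rintro (h | ⟨i, hi, -, h⟩ | ⟨i, hi, -, h⟩)
        · exact hQD _ h0 h
        · simp at h
        · simp only [Prod.mk.injEq, vtx_inj, true_and] at h
          subst h
          simp at hi)
    have hs₂ := hf₂.smallState hg.small
    refine ⟨T₂, _, hr₂, hs₂, h6, ⟨hs₂.setReg (by omega), fun r hr => ?_, hg.frame.trans hf₂⟩,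
      by simp, by simpa using h7, D₂, τ₂, hI₂, fun e => ?_, ?_⟩
    · rw [MState.setReg_reg, Function.update_of_ne (by omega)]
      exact hg.reg r hr
    · rw [hD₂, hD₁, exists_lt_succ_iff hj, exists_lt_succ_iff hj]
      have key : ∀ a b c d e : Prop, ((a ∨ b ∨ c) ∨ d ∨ e) ↔ (a ∨ (b ∨ d) ∨ (c ∨ e)) := by tauto
      exact key _ _ _ _ _
    · rw [mul_add]; omega
  obtain ⟨T, σ', hrun, hg, -, h7, D', τ', hI, hD', hT⟩ := Runs.forLoop (σ := σ) (b := s)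
    (e := .var 1) H.fits (x := 6) (by norm_num) (by decide) I hσ hsX
    ⟨⟨hσ.setReg (by omega), fun r hr => by
      rw [MState.setReg_reg, Function.update_of_ne (by omega)], .refl _ _ _⟩, by simp, by simp, D, τ,
      hD, by simp, by simp⟩
    (fun j _ σ' T h => ⟨h.1.small, h.2.1, by simp [h.1.reg 1 (by norm_num), h1]⟩) step
  refine ⟨_, σ', D', τ', hrun, hg, h7, hI, fun e => ?_, ?_⟩
  · rw [hD']
    simp
  · have : (RamExpr.var 1).size = 1 := rfl
    have h300 : 1000 ≤ A.overhead := by simp only [MatchingAlg.overhead]; omega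
    rw [this]
    generalize A.overhead = o at *
    have := Nat.mul_le_mul_right (s + 1) h300
    linarith

theorem runs_coverUpdates (H : Host A S w X w' st s t₀ m₀ cst upd qry) (hσ : SmallState X σ)
    (h5 : σ.reg 5 = base) (hb : base + st ≤ X) (hD : Inst base σ.mem D q τ)
    (h1 : σ.reg 1 = s) {k : Fin s} (h2 : σ.reg 2 % s = k)
    (hr : (vtx 2 k, vtx 3 k) ∉ D) (hl : (vtx 3 k, vtx 2 k) ∉ D) :
    ∃ T σ' D' τ', Runs w A.coverUpdates σ T σ' ∧ GuestStep X base st σ σ' ∧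
      σ'.reg = σ.reg ∧ Inst base σ'.mem D' q τ' ∧ CoverAdded k D D' ∧
      T + 2 * τ ≤ 2 * A.overhead + 2 * τ' := by
  have h3 : ∀ mem, (RamExpr.var 1 + phaseVertexE).eval ⟨σ.reg, mem⟩ = vtx (3 : Fin 4) k := by
    intro mem
    rw [RamExpr.eval_add, phaseVertexE_eval (σ := ⟨σ.reg, mem⟩) (k := k) h1 h2]
    simp [vtx_val, h1]; ring
  obtain ⟨T₁, mem₁, D₁, τ₁, hr₁, hf₁, hI₁, hD₁, hT₁⟩ := runs_updateIf H hσ h5 hb hD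
    (e := 1) (p := phaseVertexE) (r := .var 1 + phaseVertexE) (by decide) (by decide) (by decide)
    (by decide) (x := (vtx 2 k, vtx 3 k)) (phaseVertexE_eval h1 h2) (h3 σ.mem) fun _ => hr
  have hs₁ : SmallState X ⟨σ.reg, mem₁⟩ := hf₁.smallState hσ
  obtain ⟨T₂, mem₂, D₂, τ₂, hr₂, hf₂, hI₂, hD₂, hT₂⟩ := runs_updateIf H hs₁ h5 hb hI₁
    (e := 1) (p := .var 1 + phaseVertexE) (r := phaseVertexE) (by decide) (by decide) (by decide)
    (by decide) (x := (vtx 3 k, vtx 2 k)) (h3 mem₁)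
    (phaseVertexE_eval (σ := ⟨σ.reg, mem₁⟩) h1 h2)
    fun _ => by rw [hD₁]; simpa using hl
  refine ⟨_, ⟨σ.reg, mem₂⟩, D₂, τ₂, Runs.seq hr₁ hr₂,
    ⟨hf₂.smallState hs₁, fun _ _ => rfl, hf₁.trans hf₂⟩, rfl, hI₂, fun e => ?_, by omega⟩
  rw [hD₂, hD₁]
  simp [or_assoc]

theorem runs_ask (H : Host A S w X w' st s t₀ m₀ cst upd qry) (hσ : SmallState X σ)
    (h5 : σ.reg 5 = base) (hb : base + st ≤ X) (hD : Inst base σ.mem D q τ) :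
    ∃ T σ' τ', Runs w A.ask σ T σ' ∧ GuestStep X base st σ σ' ∧
      Inst base σ'.mem D (q + 1) τ' ∧ IsMaxMatchingSize (S.touched D).graph (σ'.reg 7) ∧
      T + 2 * τ ≤ A.overhead + 2 * τ' := by
  obtain ⟨m, hm, hreach⟩ := hD
  obtain ⟨t, m', hc, hmax, hreach'⟩ := hreach.query H.server
  obtain ⟨mem', hrun, hf, hm'⟩ := Runs.guestCall H.fits H.le H.window
    (H.fits.lt_word hb).le (es := []) (by simp) (by simp) (by simp) hσ h5 hm (by simp) hc
  -- The left side is a vertex cover, so the answer is at most `4 s`; it fits into a variable.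
  have hle : m' 1 0 ≤ X := by
    have h := hmax.le_of_cover Finset.univ ∅ (by simp)
    rw [Finset.card_univ, Fintype.card_fin, Finset.card_empty, add_zero] at h
    have := H.edges_le
    have := H.pos
    nlinarith
  have hval : mem' 6 (σ.reg 5) = m' 1 0 := by
    rw [h5]
    exact hm' 1 0 (by have := H.two_le; omega)
  -- Cell `0` of guest array `1` lies at the offset of the window in host array `6`. Expressions may
  -- not read guest arrays, hence a bare instruction.
  have hload : Runs w (.load 7 6 5) ⟨σ.reg, mem'⟩ 1 ((⟨σ.reg, mem'⟩ : MState).setReg 7 (m' 1 0)) := by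
    intro z hz
    have h : z.mem 6 (z.reg 5) = m' 1 0 := by
      rw [hz.mem, hz.reg 5 (by norm_num)]; exact hval
    have hx := Exec.load (w := w) z 7 6 5 (by rw [h]; exact H.fits.lt_word hle)
    rw [h] at hx
    exact ⟨1, le_rfl, _, hx, hz.setReg 7 _⟩
  refine ⟨_, _, _, Runs.seq hrun hload, ⟨(hf.smallState hσ).setReg hle, fun r hr => ?_, hf⟩,
    ⟨m', hm', hreach'⟩, by simpa using hmax, ?_⟩
  · rw [MState.setReg_reg, Function.update_of_ne (by omega)]
  · simp only [MatchingAlg.overhead, List.map_nil, List.sum_nil, List.length_nil]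
    omega

/-- The threshold for the answer in phase `k`. -/
def Setting.threshold (S : Setting) (s k : ℕ) : ℕ :=
  match S with
  | .incremental => 2 * s + 2 * k
  | .decremental => 2 * s + 2 * (s - 1 - k)

theorem Setting.threshold_eq (S : Setting) (k : Fin s) :
    S.threshold s k = 2 * s + 2 * (S.covered k).card := by
  cases S <;> simp [threshold, covered]

/-- A phase leads to the next phase, and the answer of its query tells whether `uᵀ M v = 1`. -/
theorem runs_phase (H : Host A S w X w' st s t₀ m₀ cst upd qry) (hσ : SmallState X σ)
    (h5 : σ.reg 5 = base) (hb : base + st ≤ X) (hD : Inst base σ.mem D q τ)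
    (h1 : σ.reg 1 = s) {k : Fin s} (h2 : σ.reg 2 % s = k) {eu ev : RamExpr} (hu : eu.ok = true)
    (hv : ev.ok = true) (hu' : (RamExpr.eqE eu 0).ok = true) (hv' : (RamExpr.eqE ev 0).ok = true)
    (hus : eu.size ≤ 98) (hvs : ev.size ≤ 98) {M : Fin s → Fin s → Prop} {u v : Fin s → Prop}
    (heu : Decides eu σ u) (hev : Decides ev σ v) (hM : PhaseState S M k D) :
    ∃ T σ' D' τ', Runs w (A.phase S eu ev) σ T σ' ∧ GuestStep X base st σ σ' ∧
      Inst base σ'.mem D' (q + 1) τ' ∧ PhaseState S M (k + 1) D' ∧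
      (S.threshold s k < σ'.reg 7 ↔ ∃ i j, u i ∧ M i j ∧ v j) ∧
      T + 2 * τ ≤ 9 * A.overhead * (s + 1) + 2 * τ' := by
  have answer : ∀ {E : BipEdges (4 * s)} {a : ℕ}, QueryGraph M u v k (S.covered k) E →
      IsMaxMatchingSize E.graph a → (S.threshold s k < a ↔ ∃ i j, u i ∧ M i j ∧ v j) := by
    intro E a hE ha
    rw [S.threshold_eq]
    constructor
    · intro hlt
      by_contra hc
      push Not at hc
      exact absurd (hE.answer_le ha hc) (by omega)
    · rintro ⟨i, j, hi, hij, hj⟩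
      exact hE.lt_answer ha hi hij hj
  have hso : A.overhead ≤ A.overhead * (s + 1) := Nat.le_mul_of_pos_right _ (by omega)
  cases S with
  | incremental =>
    obtain ⟨T₁, σ₁, D₁, τ₁, hr₁, hg₁, -, hI₁, hD₁, hT₁⟩ := runs_starLoop H hσ h5 hb hD h1 h2 hu hv
      (by omega) (by omega) heu hev (fun i _ => hM.left i k le_rfl)
      (fun i _ => hM.right i k le_rfl)
    obtain ⟨T₂, σ₂, τ₂, hr₂, hg₂, hI₂, hmax, hT₂⟩ := runs_ask H hg₁.small
      ((hg₁.reg 5 (by norm_num)).trans h5) hb hI₁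
    have hg₁₂ := hg₁.trans hg₂
    obtain ⟨T₃, σ₃, D₃, τ₃, hr₃, hg₃, hreg, hI₃, hD₃, hT₃⟩ := runs_coverUpdates H hg₂.small
      ((hg₁₂.reg 5 (by norm_num)).trans h5) hb hI₂ ((hg₁₂.reg 1 (by norm_num)).trans h1)
      (k := k) (by rw [hg₁₂.reg 2 (by norm_num), h2])
      (by simp [hD₁.mem_iff, hM.cover_right]) (by simp [hD₁.mem_iff, hM.cover_left])
    refine ⟨_, σ₃, D₃, τ₃, Runs.seq hr₁ (Runs.seq hr₂ hr₃), hg₁₂.trans hg₃, hI₃,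
      hM.next_incremental hD₁ hD₃, ?_, ?_⟩
    · rw [hreg]
      exact answer (hM.queryGraph_incremental hD₁) hmax
    · linarith
  | decremental =>
    have hsize : ∀ e : RamExpr, (RamExpr.eqE e 0).size = e.size + 2 := fun _ => rfl
    obtain ⟨T₁, σ₁, D₁, τ₁, hr₁, hg₁, -, hI₁, hD₁, hT₁⟩ := runs_starLoop H hσ h5 hb hD h1 h2 hu' hv'
      (by rw [hsize]; omega) (by rw [hsize]; omega) heu.eqE_zero hev.eqE_zero (fun i _ => hM.left i k le_rfl)
      (fun i _ => hM.right i k le_rfl)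
    obtain ⟨T₂, σ₂, D₂, τ₂, hr₂, hg₂, -, hI₂, hD₂, hT₂⟩ := runs_coverUpdates H hg₁.small
      ((hg₁.reg 5 (by norm_num)).trans h5) hb hI₁ ((hg₁.reg 1 (by norm_num)).trans h1)
      (k := k) (by rw [hg₁.reg 2 (by norm_num), h2])
      (by simp [hD₁.mem_iff, hM.cover_right]) (by simp [hD₁.mem_iff, hM.cover_left])
    have hg₁₂ := hg₁.trans hg₂
    obtain ⟨T₃, σ₃, τ₃, hr₃, hg₃, hI₃, hmax, hT₃⟩ := runs_ask H hg₂.small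
      ((hg₁₂.reg 5 (by norm_num)).trans h5) hb hI₂
    have hg₁₃ := hg₁₂.trans hg₃
    obtain ⟨T₄, σ₄, D₄, τ₄, hr₄, hg₄, h7, hI₄, hD₄, hT₄⟩ := runs_starLoop H hg₃.small
      ((hg₁₃.reg 5 (by norm_num)).trans h5) hb hI₃ ((hg₁₃.reg 1 (by norm_num)).trans h1)
      (k := k) (by rw [hg₁₃.reg 2 (by norm_num), h2]) hu hv (by omega) (by omega)
      (heu.of_step hg₁₃) (hev.of_step hg₁₃)
      (fun i hi => by simp [hD₂.mem_iff, hD₁.mem_iff, hM.left i k le_rfl, hi])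
      (fun i hi => by simp [hD₂.mem_iff, hD₁.mem_iff, hM.right i k le_rfl, hi])
    refine ⟨_, σ₄, D₄, τ₄, Runs.seq hr₁ (Runs.seq hr₂ (Runs.seq hr₃ hr₄)), hg₁₃.trans hg₄, hI₄,
      hM.next_decremental hD₁ hD₂ hD₄, ?_, ?_⟩
    · rw [h7]
      exact answer (hM.queryGraph_decremental hD₁ hD₂) hmax
    · linarith

theorem runs_start (H : Host A S w X w' st s t₀ m₀ cst upd qry) (hσ : SmallState X σ)
    (h5 : σ.reg 5 = base) (hb : base + st ≤ X) (hz : Holds base st Memory.zero σ.mem)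
    (h1 : σ.reg 1 = s) {e : RamExpr} (he : e.ok = true) (hes : e.size ≤ 700)
    {P : Fin (4 * s) → Fin (4 * s) → Prop}
    (hP : ∀ (p r : Fin (4 * s)) (σ' : MState), (∀ r < 6, σ'.reg r = σ.reg r) →
      (∀ a < 5, σ'.mem a = σ.mem a) → σ'.reg 6 = p * (4 * s) + r → (e.eval σ' ≠ 0 ↔ P p r)) :
    ∃ T σ' D τ, Runs w (A.start e) σ T σ' ∧ GuestStep X base st σ σ' ∧
      Inst base σ'.mem D 0 τ ∧ (∀ p r : Fin (4 * s), (p, r) ∈ D ↔ P p r) ∧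
      T ≤ 40 * A.overhead * (s * s) + 2 * τ := by
  have hs := H.pos
  have hss : 1 ≤ s * s := Nat.mul_pos hs hs
  have hoh : 1000 ≤ A.overhead := by simp only [MatchingAlg.overhead]; omega
  obtain ⟨mem₁, hr₁, hf₁, hm₁⟩ := Runs.guestCall H.fits H.le H.window
    (H.fits.lt_word hb).le (es := [4 * .var 1]) (by decide)
    (by have := H.two_le; simp; omega) (by simp) hσ h5 hz (by simp [h1]) H.server.setup
  have hs₁ := hf₁.smallState hσ
  -- The counter enumerates the pairs of vertices lexicographically; after `j` rounds the selected
  -- pairs with number below `j` have been updated.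
  let I : ℕ → MState → ℕ → Prop := fun j σ' T => GuestStep X base st ⟨σ.reg, mem₁⟩ σ' ∧
    σ'.reg 6 = j ∧ ∃ D' τ', Inst base σ'.mem D' 0 τ' ∧
      (∀ p r : Fin (4 * s), (p, r) ∈ D' ↔ (p * (4 * s) + r : ℕ) < j ∧ P p r) ∧
      T + 2 * t₀ ≤ A.overhead * j + 2 * τ'
  have step : ∀ j < 16 * s * s, ∀ σ₁ T, I j σ₁ T → ∃ T' σ',
      Runs w (A.updateIf e (.var 6 / (4 * .var 1)) (.var 6 % (4 * .var 1))) σ₁ T' σ' ∧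
      SmallState X σ' ∧ σ'.reg 6 = j ∧ I (j + 1) (σ'.setReg 6 (j + 1)) (T + T') := by
    rintro j hj σ₁ T ⟨hg, h6, D₁, τ₁, hI, hD₁, hT⟩
    have hjp : j / (4 * s) < 4 * s := Nat.div_lt_of_lt_mul (by linarith)
    have hjr : j % (4 * s) < 4 * s := Nat.mod_lt _ (by omega)
    have hdm : j / (4 * s) * (4 * s) + j % (4 * s) = j := Nat.div_add_mod' j (4 * s)
    have h1' : σ₁.reg 1 = s := (hg.reg 1 (by norm_num)).trans h1
    have hPj := hP ⟨j / (4 * s), hjp⟩ ⟨j % (4 * s), hjr⟩ σ₁ hg.reg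
      (fun a ha => (hg.frame.data ha).trans (hf₁.data ha)) (by rw [h6]; exact hdm.symm)
    obtain ⟨T₂, mem₂, D₂, τ₂, hr₂, hf₂, hI₂, hD₂, hT₂⟩ := runs_updateIf H hg.small
      ((hg.reg 5 (by norm_num)).trans h5) hb hI he (p := .var 6 / (4 * .var 1))
      (r := .var 6 % (4 * .var 1)) (by decide) (by decide)
      (by have : (RamExpr.var 6 / (4 * RamExpr.var 1)).size +
            (RamExpr.var 6 % (4 * RamExpr.var 1)).size = 10 := rfl
          omega)
      (x := (⟨j / (4 * s), hjp⟩, ⟨j % (4 * s), hjr⟩)) (by simp [h6, h1']) (by simp [h6, h1'])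
      (by
        intro _ h
        rw [hD₁] at h
        exact absurd h.1 (by simp only [hdm]; omega))
    have hs₂ := hf₂.smallState hg.small
    refine ⟨T₂, _, hr₂, hs₂, h6, ⟨hs₂.setReg (by have := H.edges_le; omega), fun r hr => ?_,
      hg.frame.trans hf₂⟩, by simp, D₂, τ₂, hI₂, fun p r => ?_, ?_⟩
    · rw [MState.setReg_reg, Function.update_of_ne (by omega)]
      exact hg.reg r hr
    · rw [hD₂, hD₁, hPj, Prod.mk.injEq]
      constructor
      · rintro (⟨h, h'⟩ | ⟨h, rfl, rfl⟩)
        · exact ⟨by omega, h'⟩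
        · exact ⟨by simp only [hdm]; omega, h⟩
      · rintro ⟨h, h'⟩
        rcases Nat.lt_succ_iff_lt_or_eq.1 h with h | h
        · exact .inl ⟨h, h'⟩
        · right
          have hp : p = ⟨j / (4 * s), hjp⟩ := Fin.ext (by
            change (p : ℕ) = j / (4 * s)
            rw [← h, add_comm, Nat.add_mul_div_right _ _ (by omega : 0 < 4 * s),
              Nat.div_eq_of_lt r.2, zero_add])
          have hr : r = ⟨j % (4 * s), hjr⟩ := Fin.ext (by
            change (r : ℕ) = j % (4 * s)
            rw [← h, add_comm, Nat.add_mul_mod_self_right, Nat.mod_eq_of_lt r.2])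
          rw [← hp, ← hr]
          exact ⟨h', rfl, rfl⟩
    · rw [mul_add]; omega
  obtain ⟨T, σ', hrun, hg, -, D', τ', hI, hD', hT⟩ := Runs.forLoop (σ := ⟨σ.reg, mem₁⟩)
    (b := 16 * s * s) (e := 16 * .var 1 * .var 1) H.fits (x := 6) (by norm_num) (by decide) I hs₁
    H.edges_le
    ⟨⟨hs₁.setReg (by omega), fun r hr => by
      rw [MState.setReg_reg, Function.update_of_ne (by omega)], .refl _ _ _⟩, by simp, ∅, t₀,
      ⟨m₀, hm₁, Reached.init⟩, by simp, by simp⟩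
    (fun j _ σ' T h => ⟨h.1.small, h.2.1, by
      have : σ'.reg 1 = s := (h.1.reg 1 (by norm_num)).trans h1
      simp [this]⟩) step
  refine ⟨_, σ', D', τ', Runs.seq hr₁ hrun, ⟨hg.small, hg.reg, hf₁.trans hg.frame⟩, hI,
    fun p r => ?_, ?_⟩
  · rw [hD', and_iff_right]
    have h₁ := Nat.mul_le_mul_right (4 * s) (Nat.succ_le_of_lt p.2)
    have h₂ := r.2
    rw [show 16 * s * s = 4 * s * (4 * s) by ring]
    rw [Nat.succ_mul] at h₁
    omega
  · have e1 : (16 * RamExpr.var 1 * RamExpr.var 1).size = 5 := rfl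
    have e2 : (4 * RamExpr.var 1).size = 3 := rfl
    have e3 : A.setup.regBound ≤ A.overhead := by simp only [MatchingAlg.overhead]; omega
    simp only [List.map_cons, List.map_nil, List.sum_cons, List.sum_nil, List.length_cons,
      List.length_nil, e1, e2]
    generalize A.overhead = o at *
    generalize A.setup.regBound = o' at *
    have h3 : o * 1 ≤ o * (s * s) := Nat.mul_le_mul_left o hss
    have h4 : 1000 * (s * s) ≤ o * (s * s) := Nat.mul_le_mul_right _ hoh
    have h5 : o * (16 * s * s) = 16 * (o * (s * s)) := by ring
    rw [h5] at hT
    have h6 : 40 * o * (s * s) = 40 * (o * (s * s)) := by ring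
    have h7 : (16 * s * s + 1) * (5 + 10) = 240 * (s * s) + 15 := by ring
    rw [h6, h7]
    omega

end

/-! ### The algorithm for OMv -/

/-- for `x₆ = 0, …, e - 1` do: if `ec` is nonzero then `a[ea] := ev` -/
def Prog.fill (a : ℕ) (e ec ea ev : RamExpr) : Prog :=
  .forLoop 6 e (.cond ec (.write a ea ev) .skip)

/-- The effect of a loop that fills an array, for conditions, addresses and values that do not
depend on that array. -/
theorem Runs.fill {w X : ℕ} {σ : MState} (hX : Fits X w) (hσ : SmallState X σ) {a b : ℕ}
    (hb : b ≤ X) {e ec ea ev : RamExpr} (he : (RamExpr.ltE (.var 6) e).ok = true)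
    (hec : ec.ok = true) (hea : ea.ok = true) (hev : ev.ok = true)
    {C : ℕ → Prop} {addr val : ℕ → ℕ} (hval : ∀ i < b, C i → val i ≤ X)
    (h : ∀ i ≤ b, ∀ σ' : MState, (∀ r < 8, r ≠ 6 → σ'.reg r = σ.reg r) →
      (∀ a' ≠ a, σ'.mem a' = σ.mem a') → σ'.reg 6 = i → e.eval σ' = b ∧
      (i < b → (ec.eval σ' ≠ 0 ↔ C i) ∧ (C i → ea.eval σ' = addr i ∧ ev.eval σ' = val i))) :
    ∃ σ', Runs w (.fill a e ec ea ev) σ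
        ((b + 1) * (e.size + ec.size + ea.size + ev.size + 20)) σ' ∧ SmallState X σ' ∧
      (∀ r < 8, r ≠ 6 → σ'.reg r = σ.reg r) ∧ (∀ a' ≠ a, σ'.mem a' = σ.mem a') ∧
      ∀ r, (∃ i < b, C i ∧ addr i = r ∧ σ'.mem a r = val i) ∨
        ((∀ i < b, C i → addr i ≠ r) ∧ σ'.mem a r = σ.mem a r) := by
  classical
  let I : ℕ → MState → ℕ → Prop := fun j σ' T => SmallState X σ' ∧ σ'.reg 6 = j ∧
    (∀ r < 8, r ≠ 6 → σ'.reg r = σ.reg r) ∧ (∀ a' ≠ a, σ'.mem a' = σ.mem a') ∧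
    (∀ r, (∃ i < j, C i ∧ addr i = r ∧ σ'.mem a r = val i) ∨
        ((∀ i < j, C i → addr i ≠ r) ∧ σ'.mem a r = σ.mem a r)) ∧
    T ≤ j * (ec.size + ea.size + ev.size + 3)
  obtain ⟨T, σ', hr, hs, -, h₁, h₂, h₃, hT⟩ := Runs.forLoop hX (x := 6) (by norm_num) he
    (p := .cond ec (.write a ea ev) .skip) I hσ hb
    ⟨hσ.setReg (by omega), by simp, fun r _ hr => by simp [hr], fun _ _ => rfl, by simp, by simp⟩
    (fun j hj σ' T hI => ⟨hI.1, hI.2.1, (h j hj σ' hI.2.2.1 hI.2.2.2.1 hI.2.1).1⟩) (by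
      rintro j hj σ₁ T ⟨hs, h6, h₁, h₂, h₃, hT⟩
      obtain ⟨hc, hav⟩ := (h j hj.le σ₁ h₁ h₂ h6).2 hj
      by_cases hC : C j
      · obtain ⟨h₄, h₅⟩ := hav hC
        have hw := Runs.cond_true hX hs hec (hc.2 hC) (q := .skip) (Runs.write hX hs a hea hev)
        rw [h₄, h₅] at hw
        have hs' : SmallState X (σ₁.setCell a (addr j) (val j)) := hs.setCell (hval j hj hC)
        refine ⟨_, _, hw, hs', h6, hs'.setReg (by omega), by simp, fun r hr hr6 => ?_,
          fun a' ha' => ?_, fun r => ?_, ?_⟩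
        · simpa [hr6] using h₁ r hr hr6
        · rw [MState.setReg_mem, MState.setCell_mem, Function.update_of_ne ha', h₂ a' ha']
        · rw [MState.setReg_mem, MState.setCell_mem_apply]
          by_cases hrj : r = addr j
          · exact .inl ⟨j, by omega, hC, hrj.symm, by simp [hrj]⟩
          · rw [if_neg (by tauto)]
            rcases h₃ r with ⟨i, hi, h⟩ | ⟨h, h'⟩
            · exact .inl ⟨i, by omega, h⟩
            · refine .inr ⟨fun i hi hCi => ?_, h'⟩
              rcases Nat.lt_succ_iff_lt_or_eq.1 hi with hi | rfl
              · exact h i hi hCi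
              · exact fun h => hrj h.symm
        · rw [add_mul]; omega
      · have hw := Runs.cond_false hX hs hec (p := .write a ea ev)
          (by by_contra h0; exact hC (hc.1 h0)) Runs.skip
        refine ⟨_, _, hw, hs, h6, hs.setReg (by omega), by simp, fun r hr hr6 => ?_,
          h₂, fun r => ?_, ?_⟩
        · simpa [hr6] using h₁ r hr hr6
        · rw [MState.setReg_mem]
          rcases h₃ r with ⟨i, hi, h⟩ | ⟨h, h'⟩
          · exact .inl ⟨i, by omega, h⟩
          · refine .inr ⟨fun i hi hCi => ?_, h'⟩
            rcases Nat.lt_succ_iff_lt_or_eq.1 hi with hi | rfl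
            · exact h i hi hCi
            · exact absurd hCi hC
        · rw [add_mul]; omega)
  refine ⟨σ', hr.mono ?_, hs, h₁, h₂, h₃⟩
  calc T + (b + 1) * (e.size + 10)
      ≤ (b + 1) * (ec.size + ea.size + ev.size + 3) + (b + 1) * (e.size + 10) := by
        gcongr
        exact hT.trans (Nat.mul_le_mul_right _ (by omega))
    _ ≤ _ := by rw [← mul_add]; exact Nat.mul_le_mul_left _ (by omega)

section expressions
open RamExpr

/-- The number of blocks per row. -/
def blocks (n s : ℕ) : ℕ := n / s + 1

def blocksE : RamExpr := var 0 / var 1 + 1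

/-- The first row of the current block. -/
def rowE : RamExpr := var 4 / blocksE % blocksE * var 1

/-- The first column of the current block. -/
def colE : RamExpr := var 4 % blocksE * var 1

def entryE (r c : RamExpr) : RamExpr := rd 3 (r * (2 * var 0) + c)

/-- The class and the index of the end points of the edge given by the loop counter. -/
def leftClassE : RamExpr := var 6 / (4 * var 1) / var 1
def leftIndexE : RamExpr := var 6 / (4 * var 1) % var 1
def rightClassE : RamExpr := var 6 % (4 * var 1) / var 1
def rightIndexE : RamExpr := var 6 % (4 * var 1) % var 1

def baseEdgeE : RamExpr :=
  eqE leftClassE 0 * eqE rightClassE 0 * eqE leftIndexE rightIndexE +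
  eqE leftClassE 1 * eqE rightClassE 1 * eqE leftIndexE rightIndexE +
  eqE leftClassE 1 * eqE rightClassE 0 * entryE (rowE + rightIndexE) (colE + leftIndexE)

def phaseEdgeE : RamExpr :=
  eqE leftClassE 0 * eqE rightClassE 2 + eqE leftClassE 2 * eqE rightClassE 1 +
  eqE leftClassE 2 * eqE rightClassE 3 * eqE leftIndexE rightIndexE +
  eqE leftClassE 3 * eqE rightClassE 2 * eqE leftIndexE rightIndexE

/-- The edges that are updated initially. -/
def startE : Setting → RamExpr
  | .incremental => baseEdgeE
  | .decremental => eqE phaseEdgeE 0 * eqE baseEdgeE 0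

/-- Whether a row of the current block is not yet known to contribute a one. -/
def openRowE : RamExpr := eqE (rd 1 (rowE + var 6)) 0

def vectorE : RamExpr := rd 4 (colE + var 6)

def thresholdE : Setting → RamExpr
  | .incremental => 2 * var 1 + 2 * (var 2 % var 1)
  | .decremental => 2 * var 1 + 2 * (var 1 - 1 - var 2 % var 1)

end expressions

namespace MatchingAlg
open RamExpr Prog
variable (A : MatchingAlg)

/-- `x₃ := (8 s) ^ c` -/
def windowLength : ℕ → Prog
  | 0 => assign 3 1
  | c + 1 => seq (windowLength c) (assign 3 (var 3 * (8 * var 1)))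

/-- The block size `s` is the integer part of the cube root of `n`. -/
def findBlockSize : Prog :=
  forLoop 6 (var 0 + 1) (cond (ltE (var 6 * var 6 * var 6) (var 0 + 1)) (assign 1 (var 6)) skip)

def copyMatrix : Prog :=
  fill 3 (var 0 * var 0) 1 (var 6 / var 0 * (2 * var 0) + var 6 % var 0) (rd 0 (var 6 + 1))

/-- Start one instance for each block and each epoch of `s` vectors. -/
def startInstances (S : Setting) : Prog :=
  forLoop 4 (blocksE * blocksE * blocksE) (seq (assign 5 (var 4 * var 3)) (A.start (startE S)))

def storeParameters : Prog :=
  seq (write 2 0 (var 0)) (seq (write 2 1 (var 1)) (write 2 3 (var 3)))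

def omvSetup (S : Setting) (c : ℕ) : Prog :=
  seq (assign 0 (rd 0 0)) (seq findBlockSize (seq copyMatrix (seq (windowLength c)
    (seq (A.startInstances S) storeParameters))))

def loadParameters : Prog :=
  seq (assign 0 (rd 2 0)) (seq (assign 1 (rd 2 1)) (seq (assign 2 (rd 2 2)) (assign 3 (rd 2 3))))

/-- Multiply the current block by the vector in the naive way. -/
def multiplyBlock : Prog :=
  fill 1 (var 1 * var 1)
    (entryE (rowE + var 6 / var 1) (colE + var 6 % var 1) * rd 4 (colE + var 6 % var 1))
    (rowE + var 6 / var 1) 1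

/-- Process the current block: multiply only if this yields new ones in the result. -/
def processBlock (S : Setting) : Prog :=
  seq (assign 5 ((var 2 / var 1 * blocksE * blocksE + var 4) * var 3))
    (seq (A.phase S openRowE vectorE) (cond (ltE (thresholdE S) (var 7)) multiplyBlock skip))

def omvMultiply (S : Setting) : Prog :=
  seq loadParameters (seq (fill 4 (var 0) 1 (var 6) (rd 0 (var 6)))
    (seq (fill 1 (2 * var 0) 1 (var 6) 0)
      (seq (forLoop 4 (blocksE * blocksE) (A.processBlock S)) (write 2 2 (var 2 + 1)))))

def omvAlg (S : Setting) (c : ℕ) : OMvAlg := ⟨A.omvSetup S c, A.omvMultiply S⟩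

end MatchingAlg

theorem startE_ok (S : Setting) : (startE S).ok = true ∧ (startE S).size ≤ 700 := by
  cases S <;> decide

/-- The block of an instance. -/
def blockOf (Mx : ℕ → ℕ → Bool) (n s id : ℕ) : Fin s → Fin s → Prop := fun i j =>
  Mx (id / blocks n s % blocks n s * s + i) (id % blocks n s * s + j) = true

/-- The padded matrix is stored in array `3`. -/
def HasMatrix (n : ℕ) (Mx : ℕ → ℕ → Bool) (mem : Memory) : Prop :=
  ∀ i < 2 * n, ∀ j < 2 * n, mem 3 (i * (2 * n) + j) = (Mx i j).toNat

section
variable {n s id : ℕ} {Mx : ℕ → ℕ → Bool} {σ : MState}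

theorem blocksE_eval (h0 : σ.reg 0 = n) (h1 : σ.reg 1 = s) : blocksE.eval σ = blocks n s := by
  simp [blocksE, blocks, h0, h1]

theorem rowE_eval (h0 : σ.reg 0 = n) (h1 : σ.reg 1 = s) (h4 : σ.reg 4 = id) :
    rowE.eval σ = id / blocks n s % blocks n s * s := by
  simp [rowE, blocksE_eval h0 h1, h1, h4]

theorem colE_eval (h0 : σ.reg 0 = n) (h1 : σ.reg 1 = s) (h4 : σ.reg 4 = id) :
    colE.eval σ = id % blocks n s * s := by
  simp [colE, blocksE_eval h0 h1, h1, h4]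

theorem blocks_pos : 0 < blocks n s := by simp [blocks]

/-- Rounding up by a whole block covers every index, even if `s` does not divide `n`; the overhang
is at most `n`. This is why matrix and vector are padded to dimension `2 n`. -/
theorem blocks_mul_le (hsn : s ≤ n) : blocks n s * s ≤ 2 * n := by
  have := Nat.div_mul_le_self n s
  rw [blocks, add_mul]
  omega

theorem block_index_lt {x i : ℕ} (hsn : s ≤ n) (hx : x < blocks n s) (hi : i < s) :
    x * s + i < 2 * n := by
  have h1 := Nat.mul_le_mul_right s (Nat.succ_le_of_lt hx)
  have h2 := blocks_mul_le hsn
  rw [Nat.succ_mul] at h1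
  omega

theorem vtx_div {c : Fin 4} {i : Fin s} : (vtx c i : ℕ) / s = c := by
  rw [vtx_val, add_comm, Nat.add_mul_div_right _ _ i.pos, Nat.div_eq_of_lt i.2, zero_add]

theorem vtx_mod {c : Fin 4} {i : Fin s} : (vtx c i : ℕ) % s = i := by
  rw [vtx_val, add_comm, Nat.add_mul_mod_self_right, Nat.mod_eq_of_lt i.2]

/-- Division and remainder by `4 s` and then by `s` recover class and index from the counter. On
truth values, products act as conjunctions and sums, tested against zero, as disjunctions. -/
theorem baseEdgeE_eval (hsn : s ≤ n) (hM : HasMatrix n Mx σ.mem) (h0 : σ.reg 0 = n)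
    (h1 : σ.reg 1 = s) (h4 : σ.reg 4 = id) {c c' : Fin 4} {i i' : Fin s}
    (h6 : σ.reg 6 = vtx c i * (4 * s) + vtx c' i') :
    (baseEdgeE.eval σ ≠ 0 ↔ IsBaseEdge (blockOf Mx n s id) c i c' i') ∧
      (phaseEdgeE.eval σ ≠ 0 ↔ IsPhaseEdge c i c' i') := by
  have hs : 0 < s := i.pos
  have hdiv : σ.reg 6 / (4 * s) = vtx c i := by
    rw [h6, add_comm, Nat.add_mul_div_right _ _ (by omega : 0 < 4 * s),
      Nat.div_eq_of_lt (vtx c' i').2, zero_add]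
  have hmod : σ.reg 6 % (4 * s) = vtx c' i' := by
    rw [h6, add_comm, Nat.add_mul_mod_self_right, Nat.mod_eq_of_lt (vtx c' i').2]
  have e1 : leftClassE.eval σ = c := by simp [leftClassE, h1, hdiv, vtx_div]
  have e2 : leftIndexE.eval σ = i := by simp [leftIndexE, h1, hdiv, vtx_mod]
  have e3 : rightClassE.eval σ = c' := by simp [rightClassE, h1, hmod, vtx_div]
  have e4 : rightIndexE.eval σ = i' := by simp [rightIndexE, h1, hmod, vtx_mod]
  have e5 : (entryE (rowE + rightIndexE) (colE + leftIndexE)).eval σ =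
      (Mx (id / blocks n s % blocks n s * s + i') (id % blocks n s * s + i)).toNat := by
    have hr := block_index_lt hsn (Nat.mod_lt (id / blocks n s) blocks_pos) i'.2
    have hc := block_index_lt hsn (Nat.mod_lt id (blocks_pos (n := n) (s := s))) i.2
    rw [← hM _ hr _ hc]
    simp [entryE, rowE_eval h0 h1 h4, colE_eval h0 h1 h4, e2, e4, h0]
  have hite : ∀ (p : Prop) [Decidable p], (if p then 1 else 0 : ℕ) ≠ 0 ↔ p := by
    intro p _; split_ifs with h <;> simp [h]
  have hbool : ∀ b : Bool, b.toNat ≠ 0 ↔ b = true := by decide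
  constructor
  · simp only [baseEdgeE, RamExpr.eval_add, RamExpr.eval_mul, RamExpr.eval_eqE, e1, e2, e3, e4,
      e5, RamExpr.eval_zero, RamExpr.eval_one, ne_eq, Nat.add_eq_zero_iff, Nat.mul_eq_zero,
      not_and_or, not_or]
    simp only [hite, hbool, IsBaseEdge, blockOf, Fin.ext_iff]
    simp only [Fin.val_zero, Fin.val_one]
    tauto
  · simp only [phaseEdgeE, RamExpr.eval_add, RamExpr.eval_mul, RamExpr.eval_eqE, e1, e2, e3, e4,
      RamExpr.eval_ofNat, ne_eq, Nat.add_eq_zero_iff,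
      Nat.mul_eq_zero, not_and_or, not_or]
    simp only [hite, IsPhaseEdge, Fin.ext_iff]
    simp only [Fin.val_zero, Fin.val_one, Fin.val_two]
    have : ((3 : Fin 4) : ℕ) = 3 := rfl
    simp only [this]
    tauto

/-- The edges that are updated initially. -/
def Setting.IsStartEdge (S : Setting) (M : Fin s → Fin s → Prop) (c : Fin 4) (i : Fin s)
    (c' : Fin 4) (i' : Fin s) : Prop :=
  match S with
  | .incremental => IsBaseEdge M c i c' i'
  | .decremental => ¬ IsPhaseEdge c i c' i' ∧ ¬ IsBaseEdge M c i c' i'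

theorem startE_eval (S : Setting) (hsn : s ≤ n) (hM : HasMatrix n Mx σ.mem) (h0 : σ.reg 0 = n)
    (h1 : σ.reg 1 = s) (h4 : σ.reg 4 = id) {c c' : Fin 4} {i i' : Fin s}
    (h6 : σ.reg 6 = vtx c i * (4 * s) + vtx c' i') :
    (startE S).eval σ ≠ 0 ↔ S.IsStartEdge (blockOf Mx n s id) c i c' i' := by
  obtain ⟨hb, hp⟩ := baseEdgeE_eval hsn hM h0 h1 h4 h6
  cases S with
  | incremental => exact hb
  | decremental =>
    rw [Setting.IsStartEdge, ← hb, ← hp]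
    simp only [startE, RamExpr.eval_mul, RamExpr.eval_eqE, RamExpr.eval_zero]
    by_cases h₁ : baseEdgeE.eval σ = 0 <;> by_cases h₂ : phaseEdgeE.eval σ = 0 <;> simp [h₁, h₂]

theorem PhaseState.start {S : Setting} {M : Fin s → Fin s → Prop} {D : BipEdges (4 * s)}
    (h : ∀ c i c' i', (vtx c i, vtx c' i') ∈ D ↔ S.IsStartEdge M c i c' i') :
    PhaseState S M 0 D := by
  cases S with
  | incremental =>
    refine ⟨fun c i c' i' _ => h c i c' i', fun i j _ => ?_, fun i j _ => ?_, fun i j hj => ?_,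
      fun i j hj => ?_, fun j => ?_, fun j => ?_⟩
    · simp [h, Setting.IsStartEdge, IsBaseEdge]
    · simp [h, Setting.IsStartEdge, IsBaseEdge]
    · omega
    · omega
    · simp [h, Setting.IsStartEdge, IsBaseEdge]
    · simp [h, Setting.IsStartEdge, IsBaseEdge]
  | decremental =>
    refine ⟨fun c i c' i' hp => ?_, fun i j _ => ?_, fun i j _ => ?_, fun i j hj => ?_,
      fun i j hj => ?_, fun j => ?_, fun j => ?_⟩
    · simp [Setting.touched, h, Setting.IsStartEdge, hp]
    · simp [h, Setting.IsStartEdge, IsPhaseEdge]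
    · simp [h, Setting.IsStartEdge, IsPhaseEdge]
    · omega
    · omega
    · simp [h, Setting.IsStartEdge, IsPhaseEdge]
    · simp [h, Setting.IsStartEdge, IsPhaseEdge]

end

/-! ### Correctness and running time of the algorithm for OMv -/

/-- The block size `s` and the window length `st` are suitable for dimension `n`. -/
structure Layout (n s st X : ℕ) : Prop where
  pos : 0 < s
  st_pos : 0 < st
  cube_le : s * s * s ≤ n
  windows : blocks n s * blocks n s * blocks n s * st ≤ X
  sq_le : 16 * n * n ≤ X

namespace Layout
variable {n s st X : ℕ}

theorem sq_le_dim (L : Layout n s st X) : s * s ≤ n := (Nat.le_mul_of_pos_right _ L.pos).trans L.cube_le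

theorem le_dim (L : Layout n s st X) : s ≤ n := (Nat.le_mul_of_pos_right _ L.pos).trans L.sq_le_dim

theorem dim_pos (L : Layout n s st X) : 0 < n := L.pos.trans_le L.le_dim

theorem le_of_sq (L : Layout n s st X) {k : ℕ} (hk : k ≤ 16 * n * n) : k ≤ X := hk.trans L.sq_le

theorem le_of_dim (L : Layout n s st X) {k : ℕ} (hk : k ≤ 16 * n) : k ≤ X :=
  L.le_of_sq (hk.trans (Nat.le_mul_of_pos_right _ L.dim_pos))

theorem blocks_cube_le (L : Layout n s st X) : blocks n s * blocks n s * blocks n s ≤ X :=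
  (Nat.le_mul_of_pos_right _ L.st_pos).trans L.windows

theorem window_le (L : Layout n s st X) {id : ℕ} (h : id < blocks n s * blocks n s * blocks n s) :
    id * st + st ≤ X := by
  have := Nat.mul_le_mul_right st (Nat.succ_le_of_lt h)
  rw [Nat.succ_mul] at this
  exact this.trans L.windows

end Layout

/-- The first `K` windows contain instances for the blocks of the matrix, which have done `ph id`
phases in `τ id` steps. -/
def Instances (A : MatchingAlg) (S : Setting) (w' st n s t₀ : ℕ) (m₀ : Memory)
    (Mx : ℕ → ℕ → Bool) (K : ℕ) (ph : ℕ → ℕ) (mem : Memory) (τ : ℕ → ℕ) : Prop :=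
  ∀ id < K, ∃ D : BipEdges (4 * s), InstanceAt A S w' st t₀ m₀ (id * st) mem D (ph id) (τ id) ∧
    PhaseState S (blockOf Mx n s id) (ph id) D

section
variable {A : MatchingAlg} {S : Setting} {w X w' st n s t₀ K t b : ℕ} {m₀ mem mem' : Memory}
  {cst upd qry : ℝ} {σ : MState} {Mx : ℕ → ℕ → Bool} {vx : ℕ → Bool} {ph τ : ℕ → ℕ}

theorem window_disjoint {id id' : ℕ} (h : id ≠ id') :
    id * st + st ≤ id' * st ∨ id' * st + st ≤ id * st := by
  rcases lt_or_gt_of_ne h with h | h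
  · left
    rw [← Nat.succ_mul]
    exact Nat.mul_le_mul_right _ h
  · right
    rw [← Nat.succ_mul]
    exact Nat.mul_le_mul_right _ h

/-- Distinct windows are disjoint, so a step of one instance leaves the others intact. Allowing a
bound `K'` other than `K` covers the creation of a new instance as well. -/
theorem Instances.update (h : Instances A S w' st n s t₀ m₀ Mx K ph mem τ) {K' id : ℕ}
    (hK : ∀ id' < K', id' ≠ id → id' < K) (hf : FrameEq (id * st) st mem mem')
    {D : BipEdges (4 * s)} {q τ₁ : ℕ} (hI : InstanceAt A S w' st t₀ m₀ (id * st) mem' D q τ₁)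
    (hD : PhaseState S (blockOf Mx n s id) q D) :
    Instances A S w' st n s t₀ m₀ Mx K' (Function.update ph id q) mem'
      (Function.update τ id τ₁) := by
  intro id' hid'
  by_cases he : id' = id
  · subst he
    exact ⟨D, by simpa using hI, by simpa using hD⟩
  · obtain ⟨D', ⟨m, hm, hr⟩, hD'⟩ := h id' (hK id' hid' he)
    refine ⟨D', ⟨m, hm.of_frame hf (window_disjoint he), ?_⟩, ?_⟩
    · simpa [he] using hr
    · simpa [he] using hD'

theorem Instances.congr (h : Instances A S w' st n s t₀ m₀ Mx K ph mem τ) {ph' : ℕ → ℕ}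
    (hph : ∀ id < K, ph' id = ph id) (hm : ∀ a, 5 ≤ a → mem' a = mem a) :
    Instances A S w' st n s t₀ m₀ Mx K ph' mem' τ := by
  intro id hid
  obtain ⟨D, ⟨m, hh, hr⟩, hD⟩ := h id hid
  rw [hph id hid]
  exact ⟨D, ⟨m, fun a j hj => by rw [hm _ (by omega)]; exact hh a j hj, hr⟩, hD⟩

/-- The epoch is the leading digit of an instance number in base `blocks n s`; the block depends on
the two lower digits only. -/
theorem blockOf_epoch (Mx : ℕ → ℕ → Bool) (n s e b : ℕ) :
    blockOf Mx n s (e * blocks n s * blocks n s + b) = blockOf Mx n s b := by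
  have hB := blocks_pos (n := n) (s := s)
  have h1 : (e * blocks n s * blocks n s + b) / blocks n s = e * blocks n s + b / blocks n s := by
    rw [add_comm, Nat.add_mul_div_right _ _ hB, add_comm]
  have h2 : (e * blocks n s * blocks n s + b) % blocks n s = b % blocks n s := by
    rw [add_comm, Nat.add_mul_mod_self_right]
  funext i j
  rw [blockOf, h1, h2, add_comm (e * blocks n s), Nat.add_mul_mod_self_right, blockOf]

theorem instance_lt (hb : b < blocks n s * blocks n s) (ht : t < n) :
    t / s * blocks n s * blocks n s + b < blocks n s * blocks n s * blocks n s := by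
  have h1 : t / s + 1 ≤ blocks n s := Nat.succ_le_succ (Nat.div_le_div_right ht.le)
  have h2 := Nat.mul_le_mul_right (blocks n s * blocks n s) h1
  rw [add_mul, one_mul] at h2
  rw [mul_assoc, mul_assoc]
  omega

theorem thresholdE_eval (h1 : σ.reg 1 = s) (h2 : σ.reg 2 = t) :
    (thresholdE S).eval σ = S.threshold s (t % s) := by
  cases S <;> simp [thresholdE, Setting.threshold, h1, h2]

theorem thresholdE_ok (S : Setting) : (RamExpr.ltE (thresholdE S) (.var 7)).ok = true ∧
    (RamExpr.ltE (thresholdE S) (.var 7)).size ≤ 20 := by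
  cases S <;> decide

/-- The result vector has been updated from `out` to `out'` by processing block `b`. -/
structure BlockDone (n s b : ℕ) (Mx : ℕ → ℕ → Bool) (vx : ℕ → Bool) (out out' : ℕ → ℕ) :
    Prop where
  sound : ∀ r, out' r = out r ∨ (out' r = 1 ∧ ∃ j, Mx r j = true ∧ vx j = true)
  complete : ∀ i < s, ∀ j < s, Mx (b / blocks n s % blocks n s * s + i)
    (b % blocks n s * s + j) = true → vx (b % blocks n s * s + j) = true →
    out' (b / blocks n s % blocks n s * s + i) = 1

theorem BlockDone.le {out out' : ℕ → ℕ} (h : BlockDone n s b Mx vx out out')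
    (h1 : ∀ r, out r ≤ 1) (r : ℕ) : out r ≤ out' r := by
  rcases h.sound r with h | h
  · exact h.ge
  · rw [h.1]; exact h1 r

theorem runs_multiplyBlock (hX : Fits X w) (L : Layout n s st X) (hσ : SmallState X σ)
    (h0 : σ.reg 0 = n) (h1 : σ.reg 1 = s) (h4 : σ.reg 4 = b) (hM : HasMatrix n Mx σ.mem)
    (hv : ∀ j < 2 * n, σ.mem 4 j = (vx j).toNat) :
    ∃ σ', Runs w MatchingAlg.multiplyBlock σ ((s * s + 1) * 100) σ' ∧ SmallState X σ' ∧
      (∀ r < 6, σ'.reg r = σ.reg r) ∧ (∀ a ≠ 1, σ'.mem a = σ.mem a) ∧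
      BlockDone n s b Mx vx (σ.mem 1) (σ'.mem 1) := by
  have hs := L.pos
  set row := b / blocks n s % blocks n s * s with hrow
  set col := b % blocks n s * s with hcol
  obtain ⟨σ', hr, hs', hreg, hmem, hout⟩ := Runs.fill hX hσ (a := 1) (b := s * s)
    (L.le_of_dim (by have := L.sq_le_dim; omega)) (e := .var 1 * .var 1)
    (ec := entryE (rowE + .var 6 / .var 1) (colE + .var 6 % .var 1) *
      .rd 4 (colE + .var 6 % .var 1)) (ea := rowE + .var 6 / .var 1) (ev := 1)
    (by decide) (by decide) (by decide) (by decide)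
    (C := fun e => Mx (row + e / s) (col + e % s) = true ∧ vx (col + e % s) = true)
    (addr := fun e => row + e / s) (val := fun _ => 1) (fun _ _ _ => by have := hX.le; omega) (by
      intro e he σ' hreg hmem h6
      have h0' : σ'.reg 0 = n := by rw [hreg 0 (by norm_num) (by norm_num), h0]
      have h1' : σ'.reg 1 = s := by rw [hreg 1 (by norm_num) (by norm_num), h1]
      have h4' : σ'.reg 4 = b := by rw [hreg 4 (by norm_num) (by norm_num), h4]
      have hre := rowE_eval h0' h1' h4'
      have hce := colE_eval h0' h1' h4'
      rw [← hrow] at hre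
      rw [← hcol] at hce
      refine ⟨by simp [h1'], fun he => ⟨?_, fun _ => ⟨by simp [hre, h6, h1'], by simp⟩⟩⟩
      have hi := block_index_lt L.le_dim (Nat.mod_lt (b / blocks n s) blocks_pos)
        (Nat.div_lt_of_lt_mul he)
      have hj := block_index_lt L.le_dim (Nat.mod_lt b (blocks_pos (n := n) (s := s)))
        (Nat.mod_lt e hs)
      rw [← hrow] at hi
      rw [← hcol] at hj
      have e1 : (entryE (rowE + .var 6 / .var 1) (colE + .var 6 % .var 1)).eval σ' =
          (Mx (row + e / s) (col + e % s)).toNat := by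
        rw [← hM _ hi _ hj, ← hmem 3 (by norm_num)]
        simp [entryE, hre, hce, h6, h1', h0']
      have e2 : (RamExpr.rd 4 (colE + .var 6 % .var 1)).eval σ' = (vx (col + e % s)).toNat := by
        rw [← hv _ hj, ← hmem 4 (by norm_num)]
        simp [hce, h6, h1']
      rw [RamExpr.eval_mul, e1, e2]
      cases Mx (row + e / s) (col + e % s) <;> cases vx (col + e % s) <;> simp)
  refine ⟨σ', hr.mono (Nat.mul_le_mul_left _ (by decide)), hs',
    fun r hr => hreg r (by omega) (by omega), hmem, fun r => ?_, fun i hi j hj hm hv' => ?_⟩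
  · rcases hout r with ⟨e, -, hC, rfl, h⟩ | ⟨-, h⟩
    · exact .inr ⟨h, _, hC⟩
    · exact .inl h
  · rw [← hrow] at hm ⊢
    rw [← hcol] at hm hv'
    have hdiv : (i * s + j) / s = i := by
      rw [add_comm, Nat.add_mul_div_right _ _ hs, Nat.div_eq_of_lt hj, zero_add]
    have hmod : (i * s + j) % s = j := by
      rw [add_comm, Nat.add_mul_mod_self_right, Nat.mod_eq_of_lt hj]
    rcases hout (row + i) with ⟨e, -, -, -, h⟩ | ⟨h, -⟩
    · exact h
    · refine absurd ?_ (h (i * s + j) ?_ ?_)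
      · simp only [hdiv]
      · have := Nat.mul_le_mul_right s (Nat.succ_le_of_lt hi)
        rw [Nat.succ_mul] at this
        omega
      · rw [hdiv, hmod]; exact ⟨hm, hv'⟩

/-- The number of ones in the output serves as a potential, with weight proportional to the cost `s
* s` of a naive multiplication. A positive answer yields an open row that becomes `1`, and this
increase pays for the multiplication. After a negative answer no open row of the block can receive a
one. -/
theorem runs_processBlock (H : Host A S w X w' st s t₀ m₀ cst upd qry) (L : Layout n s st X)
    (hσ : SmallState X σ) (h0 : σ.reg 0 = n) (h1 : σ.reg 1 = s) (h2 : σ.reg 2 = t)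
    (h3 : σ.reg 3 = st) (h4 : σ.reg 4 = b) (hb : b < blocks n s * blocks n s) (ht : t < n)
    (hM : HasMatrix n Mx σ.mem) (hv : ∀ j < 2 * n, σ.mem 4 j = (vx j).toNat)
    (hout : ∀ r, σ.mem 1 r ≤ 1)
    (hK : Instances A S w' st n s t₀ m₀ Mx (blocks n s * blocks n s * blocks n s) ph σ.mem τ)
    (hph : ph (t / s * blocks n s * blocks n s + b) = t % s) :
    ∃ T σ' τ₁, Runs w (A.processBlock S) σ T σ' ∧ SmallState X σ' ∧
      (∀ r < 5, σ'.reg r = σ.reg r) ∧ (∀ a < 5, a ≠ 1 → σ'.mem a = σ.mem a) ∧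
      Instances A S w' st n s t₀ m₀ Mx (blocks n s * blocks n s * blocks n s)
        (Function.update ph (t / s * blocks n s * blocks n s + b) (t % s + 1)) σ'.mem
        (Function.update τ (t / s * blocks n s * blocks n s + b) τ₁) ∧
      BlockDone n s b Mx vx (σ.mem 1) (σ'.mem 1) ∧
      T + 2 * τ (t / s * blocks n s * blocks n s + b) +
          A.overhead * (s * s) * ∑ r ∈ Finset.range (2 * n), σ.mem 1 r ≤
        10 * A.overhead * (s + 1) + 2 * τ₁ +
          A.overhead * (s * s) * ∑ r ∈ Finset.range (2 * n), σ'.mem 1 r := by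
  have hs := L.pos
  have hid := instance_lt (s := s) hb ht
  set id := t / s * blocks n s * blocks n s + b with hid_def
  have hbase := L.window_le hid
  have hoh : 1000 ≤ A.overhead := by simp only [MatchingAlg.overhead]; omega
  set row := b / blocks n s % blocks n s * s with hrow
  set col := b % blocks n s * s with hcol
  have e5 : ((RamExpr.var 2 / .var 1 * blocksE * blocksE + .var 4) * .var 3).eval σ = id * st := by
    simp [blocksE_eval h0 h1, h1, h2, h3, h4, hid_def]
  have hr₁ := Runs.assign H.fits hσ 5
    (e := (RamExpr.var 2 / .var 1 * blocksE * blocksE + .var 4) * .var 3) (by decide)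
    (by rw [e5]; omega)
  rw [e5] at hr₁
  have hs₁ : SmallState X (σ.setReg 5 (id * st)) := hσ.setReg (by omega)
  have hreg₁ : ∀ r ≠ 5, (σ.setReg 5 (id * st)).reg r = σ.reg r := fun r hr => by simp [hr]
  have ofstep : ∀ {σ' : MState}, (∀ r < 6, σ'.reg r = (σ.setReg 5 (id * st)).reg r) →
      ∀ r < 5, σ'.reg r = σ.reg r := fun h r hr =>
    (h r (by omega)).trans (hreg₁ r (by omega))
  obtain ⟨D, hI, hD⟩ := hK id hid
  rw [hph] at hI hD
  rw [hid_def, blockOf_epoch] at hD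
  rw [← hid_def] at *
  have hu : Decides openRowE (σ.setReg 5 (id * st))
      fun i : Fin s => σ.mem 1 (row + i) = 0 := by
    intro i σ' hr hm h6
    have hr' := ofstep hr
    have hre := rowE_eval (σ := σ') (id := b) (by rw [hr' 0 (by norm_num), h0])
      (by rw [hr' 1 (by norm_num), h1]) (by rw [hr' 4 (by norm_num), h4])
    rw [← hrow] at hre
    simp only [openRowE, RamExpr.eval_eqE, RamExpr.eval_rd, RamExpr.eval_add, hre,
      RamExpr.eval_var, h6, hm 1 (by norm_num), MState.setReg_mem, RamExpr.eval_zero]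
    split_ifs with h <;> simp [h]
  have hv' : Decides vectorE (σ.setReg 5 (id * st)) fun i : Fin s => vx (col + i) = true := by
    intro i σ' hr hm h6
    have hr' := ofstep hr
    have hce := colE_eval (σ := σ') (id := b) (by rw [hr' 0 (by norm_num), h0])
      (by rw [hr' 1 (by norm_num), h1]) (by rw [hr' 4 (by norm_num), h4])
    rw [← hcol] at hce
    have hj := block_index_lt L.le_dim (Nat.mod_lt b (blocks_pos (n := n) (s := s))) i.2
    rw [← hcol] at hj
    simp only [vectorE, RamExpr.eval_rd, RamExpr.eval_add, hce, RamExpr.eval_var, h6,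
      hm 4 (by norm_num), MState.setReg_mem, hv _ hj]
    cases vx (col + i) <;> simp
  obtain ⟨T₂, σ₂, D₂, τ₂, hr₂, hg₂, hI₂, hD₂, hans, hT₂⟩ := runs_phase H hs₁
    (base := id * st) (by simp) hbase hI (by simpa using h1) (k := ⟨t % s, Nat.mod_lt _ hs⟩)
    (by simp [h2]) (eu := openRowE) (ev := vectorE) (by decide) (by decide) (by decide)
    (by decide) (by decide) (by decide) hu hv' hD
  have hreg₂ := ofstep hg₂.reg
  have hmem₂ : ∀ a < 5, σ₂.mem a = σ.mem a := fun a ha => hg₂.frame.data ha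
  have hth : (RamExpr.ltE (thresholdE S) (.var 7)).eval σ₂ =
      if S.threshold s (t % s) < σ₂.reg 7 then 1 else 0 := by
    rw [RamExpr.eval_ltE, thresholdE_eval (by rw [hreg₂ 1 (by norm_num), h1])
      (by rw [hreg₂ 2 (by norm_num), h2])]
    rfl
  obtain ⟨hok, hsz⟩ := thresholdE_ok S
  have hinst : Instances A S w' st n s t₀ m₀ Mx (blocks n s * blocks n s * blocks n s)
      (Function.update ph id (t % s + 1)) σ₂.mem (Function.update τ id τ₂) := by
    refine hK.update (fun _ h _ => h) hg₂.frame hI₂ ?_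
    rw [hid_def, blockOf_epoch]
    exact hD₂
  have e5s : ((RamExpr.var 2 / .var 1 * blocksE * blocksE + .var 4) * .var 3).size ≤ 50 := by
    decide
  have hoh' : A.overhead ≤ A.overhead * (s + 1) := Nat.le_mul_of_pos_right _ (by omega)
  by_cases hpos : S.threshold s (t % s) < σ₂.reg 7
  · rw [if_pos hpos] at hth
    obtain ⟨σ₃, hr₃, hs₃, hreg₃, hmem₃, hdone⟩ := runs_multiplyBlock H.fits L hg₂.small
      (b := b) (Mx := Mx) (vx := vx)
      (by rw [hreg₂ 0 (by norm_num), h0]) (by rw [hreg₂ 1 (by norm_num), h1])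
      (by rw [hreg₂ 4 (by norm_num), h4])
      (fun i hi j hj => by rw [hmem₂ 3 (by norm_num)]; exact hM i hi j hj)
      (fun j hj => by rw [hmem₂ 4 (by norm_num)]; exact hv j hj)
    rw [hmem₂ 1 (by norm_num)] at hdone
    refine ⟨_, σ₃, τ₂, Runs.seq hr₁ (Runs.seq hr₂ (Runs.cond_true H.fits hg₂.small hok
      (by rw [hth]; norm_num) hr₃)), hs₃, fun r hr => ?_, fun a ha ha1 => ?_,
      hinst.congr (fun _ _ => rfl) (fun a ha => hmem₃ a (by omega)), hdone, ?_⟩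
    · rw [hreg₃ r (by omega), hreg₂ r hr]
    · rw [hmem₃ a ha1, hmem₂ a ha]
    -- The witness of the positive answer is a row whose output bit changes from `0` to `1`, so the
    -- potential increases strictly.
    · obtain ⟨i, j, hui, hmij, hvj⟩ := hans.1 hpos
      have hlt : ∑ r ∈ Finset.range (2 * n), σ.mem 1 r <
          ∑ r ∈ Finset.range (2 * n), σ₃.mem 1 r := by
        refine Finset.sum_lt_sum (fun r _ => hdone.le hout r) ⟨row + i, ?_, ?_⟩
        · rw [Finset.mem_range]
          exact block_index_lt L.le_dim (Nat.mod_lt (b / blocks n s) blocks_pos) i.2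
        · rw [hui, hdone.complete i i.2 j j.2 hmij hvj]
          norm_num
      have h7 := Nat.mul_le_mul_left (A.overhead * (s * s)) (Nat.succ_le_of_lt hlt)
      rw [Nat.mul_succ] at h7
      have h8 : 1000 * (s * s) ≤ A.overhead * (s * s) := Nat.mul_le_mul_right _ hoh
      have h9 : 1 ≤ s * s := Nat.mul_pos hs hs
      have h10 : 10 * A.overhead * (s + 1) = 9 * A.overhead * (s + 1) + A.overhead * (s + 1) := by
        ring
      rw [h10]
      omega
  · rw [if_neg hpos] at hth
    refine ⟨_, σ₂, τ₂, Runs.seq hr₁ (Runs.seq hr₂ (Runs.cond_false H.fits hg₂.small hok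
      hth Runs.skip)), hg₂.small, hreg₂, fun a ha _ => hmem₂ a ha, hinst, ⟨fun r => ?_,
      fun i hi j hj hm hvj => ?_⟩, ?_⟩
    · rw [hmem₂ 1 (by norm_num)]; exact .inl rfl
    · rw [hmem₂ 1 (by norm_num)]
      -- An output bit other than `1` is `0`, so row `i` is open and the query would have been
      -- answered positively.
      by_contra hne
      have := hout (row + i)
      rw [← hrow] at hne
      exact hpos (hans.2 ⟨⟨i, hi⟩, ⟨j, hj⟩, by change σ.mem 1 (row + i) = 0; omega, hm, hvj⟩)
    · rw [hmem₂ 1 (by norm_num)]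
      have h10 : 10 * A.overhead * (s + 1) = 9 * A.overhead * (s + 1) + A.overhead * (s + 1) := by
        ring
      rw [h10]
      omega

end

/-- The number of phases that an instance of epoch `e` has done after `t` vectors. -/
def phasesDone (s t e : ℕ) : ℕ := min s (t - e * s)

section
variable {s t e : ℕ}

theorem phasesDone_zero : phasesDone s 0 e = 0 := by simp [phasesDone]

theorem phasesDone_le : phasesDone s t e ≤ s := min_le_left _ _

theorem phasesDone_current (hs : 0 < s) : phasesDone s t (t / s) = t % s := by
  have h1 := Nat.mod_lt t hs
  have h2 := Nat.div_add_mod' t s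
  rw [phasesDone]
  omega

theorem phasesDone_succ_current (hs : 0 < s) : phasesDone s (t + 1) (t / s) = t % s + 1 := by
  have h1 := Nat.mod_lt t hs
  have h2 := Nat.div_add_mod' t s
  rw [phasesDone]
  omega

/-- A past epoch is capped at `s`; for a future one the truncated subtraction gives `0` both before
and after. -/
theorem phasesDone_succ_of_ne (hs : 0 < s) (he : e ≠ t / s) :
    phasesDone s (t + 1) e = phasesDone s t e := by
  have h1 := Nat.mod_lt t hs
  have h2 := Nat.div_add_mod' t s
  rw [phasesDone, phasesDone]
  rcases lt_or_gt_of_ne he with h | h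
  · have := Nat.mul_le_mul_right s (Nat.succ_le_of_lt h)
    rw [Nat.succ_mul] at this
    omega
  · have := Nat.mul_le_mul_right s (Nat.succ_le_of_lt h)
    rw [Nat.succ_mul] at this
    omega

end

theorem sum_range_update {f : ℕ → ℕ} {K i x : ℕ} (hi : i < K) :
    ∑ j ∈ Finset.range K, Function.update f i x j + f i = ∑ j ∈ Finset.range K, f j + x := by
  rw [Finset.sum_update_of_mem (Finset.mem_range.2 hi),
    ← Finset.sum_sdiff (Finset.singleton_subset_iff.2 (Finset.mem_range.2 hi)),
    Finset.sum_singleton]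
  omega

/-- The memory of the algorithm for OMv after `t` vectors. -/
structure Ready (A : MatchingAlg) (S : Setting) (w' st n s t₀ : ℕ) (m₀ : Memory) (X : ℕ)
    (Mx : ℕ → ℕ → Bool) (t : ℕ) (mem : Memory) (τ : ℕ → ℕ) : Prop where
  dim : mem 2 0 = n
  blockSize : mem 2 1 = s
  time : mem 2 2 = t
  length : mem 2 3 = st
  matrix : HasMatrix n Mx mem
  vector : ∀ j, n ≤ j → mem 4 j = 0
  bits : ∀ j, mem 1 j ≤ 1
  small : ∀ a < 5, ∀ j, mem a j ≤ X
  inst : Instances A S w' st n s t₀ m₀ Mx (blocks n s * blocks n s * blocks n s)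
    (fun id => phasesDone s t (id / (blocks n s * blocks n s))) mem τ

/-- A matrix padded by zeros. -/
def padMatrix {n : ℕ} (M : Matrix (Fin n) (Fin n) Bool) (i j : ℕ) : Bool :=
  if h : i < n ∧ j < n then M ⟨i, h.1⟩ ⟨j, h.2⟩ else false

/-- A vector padded by zeros. -/
def padVector {n : ℕ} (v : Fin n → Bool) (j : ℕ) : Bool :=
  if h : j < n then v ⟨j, h⟩ else false

theorem exists_padded_iff {n : ℕ} (M : Matrix (Fin n) (Fin n) Bool) (v : Fin n → Bool)
    (i : Fin n) : (∃ j, padMatrix M i j = true ∧ padVector v j = true) ↔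
      ∃ j, M i j = true ∧ v j = true := by
  constructor
  · rintro ⟨j, hM, hv⟩
    by_cases hj : j < n
    · exact ⟨⟨j, hj⟩, by simpa [padMatrix, hj] using hM, by simpa [padVector, hj] using hv⟩
    · simp [padVector, hj] at hv
  · rintro ⟨j, hM, hv⟩
    exact ⟨j, by simpa [padMatrix] using hM, by simpa [padVector] using hv⟩

theorem encodeVector_getD {n : ℕ} (v : Fin n → Bool) (j d : ℕ) :
    (encodeVector v).getD j d = if j < n then (padVector v j).toNat else d := by
  split_ifs with h
  · rw [List.getD_eq_getElem _ _ (by simpa [encodeVector] using h)]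
    simp [encodeVector, padVector, h]
  · rw [List.getD_eq_default _ _ (by simpa [encodeVector] using h)]

/-! ### Answering one vector. -/

section
variable {A : MatchingAlg} {S : Setting} {w X w' st n s t₀ t : ℕ} {m₀ mem : Memory}
  {cst upd qry : ℝ} {σ : MState} {Mx : ℕ → ℕ → Bool} {vx : ℕ → Bool} {τ : ℕ → ℕ}

theorem runs_loadParameters (hX : Fits X w) (hσ : SmallState X σ) (h0 : σ.mem 2 0 = n)
    (h1 : σ.mem 2 1 = s) (h2 : σ.mem 2 2 = t) (h3 : σ.mem 2 3 = st) :
    ∃ σ', Runs w MatchingAlg.loadParameters σ 12 σ' ∧ SmallState X σ' ∧ σ'.mem = σ.mem ∧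
      σ'.reg 0 = n ∧ σ'.reg 1 = s ∧ σ'.reg 2 = t ∧ σ'.reg 3 = st := by
  have hm := hσ.mem 2 (by norm_num)
  have r0 := Runs.assign hX hσ 0 (e := .rd 2 0) (by decide) (by simpa using hm 0)
  have s0 : SmallState X (σ.setReg 0 ((RamExpr.rd 2 0).eval σ)) :=
    hσ.setReg (by simpa using hm 0)
  have r1 := Runs.assign hX s0 1 (e := .rd 2 1) (by decide) (by simpa using hm 1)
  have s1 := s0.setReg (x := 1) (k := (RamExpr.rd 2 1).eval _) (by simpa using hm 1)
  have r2 := Runs.assign hX s1 2 (e := .rd 2 2) (by decide) (by simpa using hm 2)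
  have s2 := s1.setReg (x := 2) (k := (RamExpr.rd 2 2).eval _) (by simpa using hm 2)
  have r3 := Runs.assign hX s2 3 (e := .rd 2 3) (by decide) (by simpa using hm 3)
  have s3 := s2.setReg (x := 3) (k := (RamExpr.rd 2 3).eval _) (by simpa using hm 3)
  exact ⟨_, (r0.seq (r1.seq (r2.seq r3))).mono (by decide), s3, rfl, by simp [h0], by simp [h1],
    by simp [h2], by simp [h3]⟩

/-- The loop over all blocks computes the product with the vector. -/
theorem runs_blockLoop (H : Host A S w X w' st s t₀ m₀ cst upd qry) (L : Layout n s st X)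
    (hσ : SmallState X σ) (h0 : σ.reg 0 = n) (h1 : σ.reg 1 = s) (h2 : σ.reg 2 = t)
    (h3 : σ.reg 3 = st) (ht : t < n)
    (hM : HasMatrix n Mx σ.mem) (hv : ∀ j < 2 * n, σ.mem 4 j = (vx j).toNat)
    (hout : ∀ r < 2 * n, σ.mem 1 r = 0) (hout' : ∀ r, σ.mem 1 r ≤ 1)
    (hK : Instances A S w' st n s t₀ m₀ Mx (blocks n s * blocks n s * blocks n s)
      (fun id => phasesDone s t (id / (blocks n s * blocks n s))) σ.mem τ) :
    ∃ T σ' τ', Runs w (.forLoop 4 (blocksE * blocksE) (A.processBlock S)) σ T σ' ∧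
      SmallState X σ' ∧ (∀ r < 4, σ'.reg r = σ.reg r) ∧
      (∀ a < 5, a ≠ 1 → σ'.mem a = σ.mem a) ∧
      Instances A S w' st n s t₀ m₀ Mx (blocks n s * blocks n s * blocks n s)
        (fun id => phasesDone s (t + 1) (id / (blocks n s * blocks n s))) σ'.mem τ' ∧
      (∀ r, σ'.mem 1 r ≤ 1) ∧
      (∀ r < 2 * n, σ'.mem 1 r = 1 → ∃ j, Mx r j = true ∧ vx j = true) ∧
      (∀ r < n, ∀ j < n, Mx r j = true → vx j = true → σ'.mem 1 r = 1) ∧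
      T + 2 * ∑ id ∈ Finset.range (blocks n s * blocks n s * blocks n s), τ id ≤
        22 * A.overhead * (s * (blocks n s * blocks n s) + s * s * n) +
        2 * ∑ id ∈ Finset.range (blocks n s * blocks n s * blocks n s), τ' id := by
  have hs := L.pos
  have hB := blocks_pos (n := n) (s := s)
  set B := blocks n s with hBdef
  have hoh : 1000 ≤ A.overhead := by simp only [MatchingAlg.overhead]; omega
  have hBB : B * B ≤ X := (Nat.le_mul_of_pos_right _ hB).trans L.blocks_cube_le
  -- Phase counts after `b` blocks of the current vector. The condition ignores the epoch, which is
  -- harmless: the counts at `t` and `t + 1` agree outside the current epoch.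
  let ph : ℕ → ℕ → ℕ := fun b id =>
    if id % (B * B) < b then phasesDone s (t + 1) (id / (B * B)) else phasesDone s t (id / (B * B))
  let I : ℕ → MState → ℕ → Prop := fun b σ' T => SmallState X σ' ∧ σ'.reg 4 = b ∧
    (∀ r < 4, σ'.reg r = σ.reg r) ∧ (∀ a < 5, a ≠ 1 → σ'.mem a = σ.mem a) ∧
    (∀ r, σ'.mem 1 r ≤ 1) ∧
    (∀ r < 2 * n, σ'.mem 1 r = 1 → ∃ j, Mx r j = true ∧ vx j = true) ∧
    (∀ b' < b, ∀ i < s, ∀ j < s, Mx (b' / B % B * s + i) (b' % B * s + j) = true →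
      vx (b' % B * s + j) = true → σ'.mem 1 (b' / B % B * s + i) = 1) ∧
    ∃ τ', Instances A S w' st n s t₀ m₀ Mx (B * B * B) (ph b) σ'.mem τ' ∧
      T + 2 * ∑ id ∈ Finset.range (B * B * B), τ id ≤ 10 * A.overhead * (s + 1) * b +
        A.overhead * (s * s) * ∑ r ∈ Finset.range (2 * n), σ'.mem 1 r +
        2 * ∑ id ∈ Finset.range (B * B * B), τ' id
  have init : I 0 (σ.setReg 4 0) 0 := by
    refine ⟨hσ.setReg (by omega), by simp, fun r hr => ?_, fun _ _ _ => rfl, hout',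
      fun r hr h => ?_, by simp, τ, hK.congr (fun id _ => by simp [ph]) (fun _ _ => rfl), by omega⟩
    · rw [MState.setReg_reg, Function.update_of_ne (by omega)]
    · rw [MState.setReg_mem, hout r hr] at h
      omega
  have step : ∀ b < B * B, ∀ σ₁ T, I b σ₁ T → ∃ T' σ', Runs w (A.processBlock S) σ₁ T' σ' ∧
      SmallState X σ' ∧ σ'.reg 4 = b ∧ I (b + 1) (σ'.setReg 4 (b + 1)) (T + T') := by
    rintro b hb σ₁ T ⟨hs₁, h4, hreg, hmem, hbit, hsound, hcompl, τ₁, hK₁, hT⟩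
    have hmod : (t / s * B * B + b) % (B * B) = b := by
      rw [mul_assoc, add_comm, Nat.add_mul_mod_self_right, Nat.mod_eq_of_lt hb]
    have hdiv : (t / s * B * B + b) / (B * B) = t / s := by
      rw [mul_assoc, add_comm, Nat.add_mul_div_right _ _ (Nat.mul_pos hB hB),
        Nat.div_eq_of_lt hb, zero_add]
    obtain ⟨T₂, σ₂, τ₂, hr₂, hs₂, hreg₂, hmem₂, hK₂, hdone, hT₂⟩ := runs_processBlock H L hs₁
      (b := b) (t := t) (Mx := Mx) (vx := vx)
      ((hreg 0 (by norm_num)).trans h0) ((hreg 1 (by norm_num)).trans h1)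
      ((hreg 2 (by norm_num)).trans h2) ((hreg 3 (by norm_num)).trans h3) h4 hb ht
      (fun i hi j hj => by rw [hmem 3 (by norm_num) (by norm_num)]; exact hM i hi j hj)
      (fun j hj => by rw [hmem 4 (by norm_num) (by norm_num)]; exact hv j hj) hbit hK₁
      (by
        change (if (t / s * B * B + b) % (B * B) < b then _ else _) = _
        rw [hmod, hdiv, if_neg (lt_irrefl b), phasesDone_current hs])
    rw [← hBdef] at hK₂ hT₂
    have hid : t / s * B * B + b < B * B * B := instance_lt hb ht
    refine ⟨T₂, σ₂, hr₂, hs₂, (hreg₂ 4 (by norm_num)).trans h4, hs₂.setReg (by omega), by simp,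
      fun r hr => ?_, fun a ha ha1 => (hmem₂ a ha ha1).trans (hmem a ha ha1), fun r => ?_,
      fun r hr h => ?_, fun b' hb' i hi j hj hm hv' => ?_, _,
      hK₂.congr (fun id hid' => ?_) (fun _ _ => rfl), ?_⟩
    · rw [MState.setReg_reg, Function.update_of_ne (by omega), hreg₂ r (by omega), hreg r hr]
    · rcases hdone.sound r with h | h
      · exact h.trans_le (hbit r)
      · exact h.1.le
    · rcases hdone.sound r with h' | h'
      · exact hsound r hr (h'.symm.trans h)
      · exact h'.2
    · rcases Nat.lt_succ_iff_lt_or_eq.1 hb' with hb' | rfl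
      · have h1 := hcompl b' hb' i hi j hj hm hv'
        rcases hdone.sound (b' / B % B * s + i) with h | h
        · exact h.trans h1
        · exact h.1
      · exact hdone.complete i hi j hj hm hv'
    · simp only [ph, Function.update_apply]
      by_cases he : id = t / s * B * B + b
      · rw [if_pos he, he, hmod, hdiv, if_pos (Nat.lt_succ_self b), phasesDone_succ_current hs]
      · rw [if_neg he]
        by_cases hlt : id % (B * B) < b
        · rw [if_pos hlt, if_pos (by omega)]
        · rw [if_neg hlt]
          split_ifs with hlt'
          -- Here `id` has remainder `b`; in the current epoch it would be the instance just
          -- processed.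
          · refine phasesDone_succ_of_ne hs fun hc => he ?_
            have := Nat.div_add_mod' id (B * B)
            rw [hc, ← mul_assoc] at this
            omega
          · rfl
    · have hsum := sum_range_update (f := τ₁) (x := τ₂) hid
      rw [MState.setReg_mem, mul_add]
      generalize A.overhead * (s * s) * ∑ r ∈ Finset.range (2 * n), σ₁.mem 1 r = z₁ at *
      generalize A.overhead * (s * s) * ∑ r ∈ Finset.range (2 * n), σ₂.mem 1 r = z₂ at *
      omega
  obtain ⟨T, σ', hr, hs', -, hreg, hmem, hbit, hsound, hcompl, τ', hK', hT⟩ :=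
    Runs.forLoop (σ := σ) (b := B * B) (e := blocksE * blocksE) H.fits (x := 4) (by norm_num)
      (by decide) I hσ hBB init (fun b _ σ' T h => ⟨h.1, h.2.1, by
        rw [RamExpr.eval_mul, blocksE_eval ((h.2.2.1 0 (by norm_num)).trans h0)
          ((h.2.2.1 1 (by norm_num)).trans h1)]⟩) step
  refine ⟨_, σ', τ', hr, hs', hreg, hmem, hK'.congr (fun id _ => ?_) (fun _ _ => rfl), hbit,
    hsound, fun r hr j hj hm hv' => ?_, ?_⟩
  · simp only [ph]
    rw [if_pos (Nat.mod_lt _ (Nat.mul_pos hB hB))]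
  · have hi : r / s < B := Nat.lt_succ_of_le (Nat.div_le_div_right hr.le)
    have hj' : j / s < B := Nat.lt_succ_of_le (Nat.div_le_div_right hj.le)
    have hlt : r / s * B + j / s < B * B := by
      have := Nat.mul_le_mul_right B (Nat.succ_le_of_lt hi)
      rw [Nat.succ_mul] at this
      omega
    have hd : (r / s * B + j / s) / B % B = r / s := by
      rw [add_comm, Nat.add_mul_div_right _ _ hB, Nat.div_eq_of_lt hj', zero_add,
        Nat.mod_eq_of_lt hi]
    have hm' : (r / s * B + j / s) % B = j / s := by
      rw [add_comm, Nat.add_mul_mod_self_right, Nat.mod_eq_of_lt hj']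
    -- The entry `(r, j)` belongs to the block in row `r / s` and column `j / s`.
    have key := hcompl _ hlt (r % s) (Nat.mod_lt _ hs) (j % s) (Nat.mod_lt _ hs)
    rw [hd, hm', Nat.div_add_mod', Nat.div_add_mod'] at key
    exact key hm hv'
  -- The potential is at most the padded length, which bounds the total cost of naive
  -- multiplications for this vector.
  · have hsum : ∑ r ∈ Finset.range (2 * n), σ'.mem 1 r ≤ 2 * n := by
      refine (Finset.sum_le_sum fun r _ => hbit r).trans ?_
      simp
    have hz := Nat.mul_le_mul_left (A.overhead * (s * s)) hsum
    have e1 : (blocksE * blocksE).size = 11 := rfl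
    rw [e1]
    have hB1 : 1 ≤ B * B := Nat.mul_pos hB hB
    generalize A.overhead = o at *
    generalize B * B = Q at *
    have h1 : (s + 1) * Q ≤ 2 * (s * Q) := by nlinarith
    have h2 : o * ((s + 1) * Q) ≤ o * (2 * (s * Q)) := Nat.mul_le_mul_left o h1
    have h3 : Q ≤ s * Q := Nat.le_mul_of_pos_left _ hs
    have h4 : 1000 * (s * Q) ≤ o * (s * Q) := Nat.mul_le_mul_right _ hoh
    have h5 : 10 * o * (s + 1) * Q = 10 * (o * ((s + 1) * Q)) := by ring
    have h6 : o * (s * s) * (2 * n) = 2 * (o * (s * s * n)) := by ring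
    have h7 : 22 * o * (s * Q + s * s * n) = 22 * (o * (s * Q)) + 22 * (o * (s * s * n)) := by ring
    have h8 : o * (2 * (s * Q)) = 2 * (o * (s * Q)) := by ring
    rw [h5] at hT
    rw [h6] at hz
    rw [h7]
    rw [h8] at h2
    omega

/-- Between calls only the memory persists, so the parameters are reloaded from array `2` and the
vector count is written back. Copying the vector and clearing the output take `O(n)` steps,
dominated by `s * s * n`. -/
theorem ready_multiply (H : Host A S w X w' st s t₀ m₀ cst upd qry) (L : Layout n s st X)
    {M : Matrix (Fin n) (Fin n) Bool} (v : Fin n → Bool) (ht : t < n)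
    (hR : Ready A S w' st n s t₀ m₀ X (padMatrix M) t mem τ) :
    ∃ T mem' τ', Call w (A.omvMultiply S) (encodeVector v) mem T mem' ∧
      (∀ i : Fin n, mem' 1 i = (boolMulVec M v i).toNat) ∧
      Ready A S w' st n s t₀ m₀ X (padMatrix M) (t + 1) mem' τ' ∧
      T + 2 * ∑ id ∈ Finset.range (blocks n s * blocks n s * blocks n s), τ id ≤
        25 * A.overhead * (s * (blocks n s * blocks n s) + s * s * n) +
        2 * ∑ id ∈ Finset.range (blocks n s * blocks n s * blocks n s), τ' id := by
  have hX := H.fits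
  have hn := L.dim_pos
  have hs := L.pos
  have hoh : 1000 ≤ A.overhead := by simp only [MatchingAlg.overhead]; omega
  have hin : ∀ j, (mem.withInput (encodeVector v)) 0 j =
      if j < n then (padVector v j).toNat else mem 0 j := fun j => by
    rw [← encodeVector_getD]
    simp [Memory.withInput]
  have hother : ∀ a ≠ 0, (mem.withInput (encodeVector v)) a = mem a := fun a ha => by
    simp [Memory.withInput, ha]
  have hbool : ∀ b : Bool, b.toNat ≤ 1 := by decide
  let σ : MState := ⟨fun _ => 0, mem.withInput (encodeVector v)⟩
  have hσ : SmallState X σ := by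
    refine ⟨fun _ _ => Nat.zero_le _, fun a ha j => ?_⟩
    by_cases h : a = 0
    · subst h
      change (mem.withInput (encodeVector v)) 0 j ≤ X
      rw [hin]
      split_ifs
      · have := hX.le
        have := hbool (padVector v j)
        omega
      · exact hR.small 0 ha j
    · change (mem.withInput (encodeVector v)) a j ≤ X
      rw [hother a h]
      exact hR.small a ha j
  have h2 : σ.mem 2 = mem 2 := hother 2 (by norm_num)
  obtain ⟨σ₁, hr₁, hs₁, hm₁, h0₁, h1₁, h2₁, h3₁⟩ := runs_loadParameters hX hσ
    (by rw [h2, hR.dim]) (by rw [h2, hR.blockSize]) (by rw [h2, hR.time]) (by rw [h2, hR.length])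
  obtain ⟨σ₂, hr₂, hs₂, hreg₂, hm₂, ho₂⟩ := Runs.fill hX hs₁ (a := 4) (b := n)
    (L.le_of_dim (by omega)) (e := .var 0) (ec := 1) (ea := .var 6) (ev := .rd 0 (.var 6))
    (by decide) (by decide) (by decide) (by decide) (C := fun _ => True) (addr := fun i => i)
    (val := fun i => σ.mem 0 i) (fun i _ _ => hσ.mem 0 (by norm_num) i) (by
      intro i _ σ' hreg hmem h6
      refine ⟨by simp [hreg 0, h0₁], fun _ => ⟨by simp, fun _ => ⟨by simp [h6], ?_⟩⟩⟩
      simp [h6, hmem 0, hm₁])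
  obtain ⟨σ₃, hr₃, hs₃, hreg₃, hm₃, ho₃⟩ := Runs.fill hX hs₂ (a := 1) (b := 2 * n)
    (L.le_of_dim (by omega)) (e := 2 * .var 0) (ec := 1) (ea := .var 6) (ev := 0)
    (by decide) (by decide) (by decide) (by decide) (C := fun _ => True) (addr := fun i => i)
    (val := fun _ => 0) (fun _ _ _ => Nat.zero_le _) (by
      intro i _ σ' hreg hmem h6
      refine ⟨by simp [hreg 0, hreg₂ 0, h0₁], fun _ => ⟨by simp, fun _ => ⟨by simp [h6], by simp⟩⟩⟩)
  have hreg : ∀ r < 4, σ₃.reg r = σ₁.reg r := fun r hr => by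
    rw [hreg₃ r (by omega) (by omega), hreg₂ r (by omega) (by omega)]
  have hmem : ∀ a, a ≠ 0 → a ≠ 1 → a ≠ 4 → σ₃.mem a = mem a := fun a h h' h'' => by
    rw [hm₃ a h', hm₂ a h'', hm₁]
    exact hother a h
  have hvec : ∀ j, σ₃.mem 4 j = (padVector v j).toNat := by
    intro j
    rw [hm₃ 4 (by norm_num)]
    by_cases hj : j < n
    · rcases ho₂ j with ⟨i, -, -, rfl, h⟩ | ⟨h, -⟩
      · rw [h]
        change (mem.withInput (encodeVector v)) 0 i = _
        rw [hin, if_pos hj]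
      · exact absurd rfl (h j hj trivial)
    · rcases ho₂ j with ⟨i, hi, -, rfl, -⟩ | ⟨-, h⟩
      · exact absurd hi hj
      · rw [h, hm₁]
        -- Cells from `n` on are never written, so the padding of the vector is still zero.
        change (mem.withInput (encodeVector v)) 4 j = _
        rw [hother 4 (by norm_num), hR.vector j (by omega)]
        simp [padVector, hj]
  have hzero : ∀ r < 2 * n, σ₃.mem 1 r = 0 := fun r hr => by
    rcases ho₃ r with ⟨i, -, -, -, h⟩ | ⟨h, -⟩
    · exact h
    · exact absurd rfl (h r hr trivial)
  have hbits : ∀ r, σ₃.mem 1 r ≤ 1 := fun r => by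
    rcases ho₃ r with ⟨i, -, -, -, h⟩ | ⟨-, h⟩
    · rw [h]; exact Nat.zero_le _
    · rw [h, hm₂ 1 (by norm_num), hm₁]
      change (mem.withInput (encodeVector v)) 1 r ≤ 1
      rw [hother 1 (by norm_num)]
      exact hR.bits r
  obtain ⟨T₄, σ₄, τ', hr₄, hs₄, hreg₄, hm₄, hK₄, hbits₄, hsound, hcompl, hT₄⟩ :=
    runs_blockLoop H L hs₃ (Mx := padMatrix M) (vx := padVector v) (t := t) (τ := τ)
      ((hreg 0 (by norm_num)).trans h0₁) ((hreg 1 (by norm_num)).trans h1₁)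
      ((hreg 2 (by norm_num)).trans h2₁) ((hreg 3 (by norm_num)).trans h3₁) ht
      (fun i hi j hj => by
        rw [hmem 3 (by norm_num) (by norm_num) (by norm_num)]; exact hR.matrix i hi j hj)
      (fun j _ => hvec j) hzero hbits
      (hR.inst.congr (fun _ _ => rfl) fun a ha => hmem a (by omega) (by omega) (by omega))
  have h2₄ : σ₄.reg 2 = t := by rw [hreg₄ 2 (by norm_num), hreg 2 (by norm_num), h2₁]
  have hr₅ := Runs.write hX hs₄ 2 (e₁ := 2) (e₂ := .var 2 + 1) (by decide) (by decide)
  have ev₅ : (RamExpr.var 2 + 1).eval σ₄ = t + 1 := by simp [h2₄]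
  have ev₅' : (2 : RamExpr).eval σ₄ = 2 := by simp
  rw [ev₅, ev₅'] at hr₅
  have hs₅ : SmallState X (σ₄.setCell 2 2 (t + 1)) := hs₄.setCell (L.le_of_dim (by omega))
  have hm₅ : ∀ a ≠ 2, (σ₄.setCell 2 2 (t + 1)).mem a = σ₄.mem a := fun a ha => by
    rw [MState.setCell_mem, Function.update_of_ne ha]
  have hm₅' : ∀ j ≠ 2, (σ₄.setCell 2 2 (t + 1)).mem 2 j = mem 2 j := fun j hj => by
    rw [MState.setCell_mem_apply, if_neg (by tauto), hm₄ 2 (by norm_num) (by norm_num),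
      hmem 2 (by norm_num) (by norm_num) (by norm_num)]
  obtain ⟨T, hT, z, hx, hz⟩ := (hr₁.seq (hr₂.seq (hr₃.seq (hr₄.seq hr₅)))) σ
    ⟨rfl, fun _ _ => rfl⟩
  refine ⟨T, z.mem, τ', ⟨z.reg, hx⟩, fun i => ?_, ?_, ?_⟩
  · rw [hz.mem, hm₅ 1 (by norm_num)]
    by_cases hb : boolMulVec M v i = true
    · rw [hb]
      rw [boolMulVec, decide_eq_true_eq, ← exists_padded_iff] at hb
      obtain ⟨j, hm, hv⟩ := hb
      have hj : j < n := by
        by_contra hj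
        simp [padVector, hj] at hv
      exact hcompl i i.2 j hj hm hv
    · have hle := hbits₄ i
      have hne : σ₄.mem 1 i ≠ 1 := fun h => hb (by
        rw [boolMulVec, decide_eq_true_eq, ← exists_padded_iff]
        exact hsound i (by omega) h)
      rw [Bool.not_eq_true] at hb
      rw [hb, Bool.toNat_false]
      omega
  · rw [hz.mem]
    refine ⟨by rw [hm₅' 0 (by norm_num), hR.dim], by rw [hm₅' 1 (by norm_num), hR.blockSize],
      by rw [MState.setCell_mem_apply, if_pos ⟨rfl, rfl⟩], by rw [hm₅' 3 (by norm_num), hR.length],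
      fun i hi j hj => ?_, fun j hj => ?_, fun j => ?_, hs₅.mem,
      hK₄.congr (fun _ _ => rfl) fun a ha => hm₅ a (by omega)⟩
    · rw [hm₅ 3 (by norm_num), hm₄ 3 (by norm_num) (by norm_num),
        hmem 3 (by norm_num) (by norm_num) (by norm_num)]
      exact hR.matrix i hi j hj
    · rw [hm₅ 4 (by norm_num), hm₄ 4 (by norm_num) (by norm_num), hvec]
      simp [padVector, hj]
    · rw [hm₅ 1 (by norm_num)]
      exact hbits₄ j
  · have e1 : (RamExpr.var 0).size + (1 : RamExpr).size + (RamExpr.var 6).size +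
      (RamExpr.rd 0 (.var 6)).size + 20 = 25 := rfl
    have e2 : (2 * RamExpr.var 0).size + (1 : RamExpr).size + (RamExpr.var 6).size +
      (0 : RamExpr).size + 20 = 26 := rfl
    have e3 : (2 : RamExpr).size + (RamExpr.var 2 + 1).size + 1 = 5 := rfl
    rw [e1, e2, e3] at hT
    have hss : 1 ≤ s * s := Nat.mul_pos hs hs
    generalize A.overhead = o at *
    have h1 : n ≤ s * s * n := Nat.le_mul_of_pos_left _ hss
    have h4 : 1000 * (s * s * n) ≤ o * (s * s * n) := Nat.mul_le_mul_right _ hoh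
    have h7 : ∀ c : ℕ, c * o * (s * (blocks n s * blocks n s) + s * s * n) =
        c * (o * (s * (blocks n s * blocks n s))) + c * (o * (s * s * n)) := fun c => by ring
    rw [h7] at hT₄ ⊢
    omega

end

theorem encodeMatrix_getD {n : ℕ} (M : Matrix (Fin n) (Fin n) Bool) (k : ℕ) :
    (encodeMatrix M).getD k 0 = if k = 0 then n else
      if k - 1 < n * n then (padMatrix M ((k - 1) / n) ((k - 1) % n)).toNat else 0 := by
  have hflat : (List.ofFn fun i => List.ofFn fun j => (M i j).toNat).flatten =
      List.ofFn fun k : Fin (n * n) => (padMatrix M (k / n) (k % n)).toNat := by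
    rw [List.ofFn_mul]
    congr 2
    funext i
    congr 1
    funext j
    have hn : 0 < n := i.pos
    have hd : (i * n + j : ℕ) / n = i := by
      rw [add_comm, Nat.add_mul_div_right _ _ hn, Nat.div_eq_of_lt j.2, zero_add]
    have hm : (i * n + j : ℕ) % n = j := by
      rw [add_comm, Nat.add_mul_mod_self_right, Nat.mod_eq_of_lt j.2]
    simp only [hd, hm]
    simp [padMatrix]
  cases k with
  | zero => simp [encodeMatrix]
  | succ k =>
    rw [encodeMatrix, hflat, List.getD_cons_succ, if_neg (Nat.succ_ne_zero k),
      Nat.add_sub_cancel]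
    split_ifs with h
    · rw [List.getD_eq_getElem _ _ (by simpa using h)]
      simp
    · rw [List.getD_eq_default _ _ (by simpa using h)]

/-! ### Preprocessing of the matrix. -/

section
variable {A : MatchingAlg} {S : Setting} {w X w' st n s t₀ : ℕ} {m₀ : Memory}
  {cst upd qry : ℝ} {σ : MState} {Mx : ℕ → ℕ → Bool}

theorem runs_findBlockSize (hX : Fits X w) (hσ : SmallState X σ) (h0 : σ.reg 0 = n)
    (h1 : σ.reg 1 = 0) (hsn : s ≤ n) (hle : s * s * s ≤ n) (hlt : n < (s + 1) * (s + 1) * (s + 1))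
    (hn : n + 1 ≤ X) :
    ∃ σ', Runs w MatchingAlg.findBlockSize σ ((n + 2) * 30) σ' ∧ SmallState X σ' ∧
      σ'.reg 0 = n ∧ σ'.reg 1 = s ∧ σ'.mem = σ.mem := by
  -- Register `1` holds the largest number below `i` whose cube is at most `n`. The truncated `i -
  -- 1` covers the start, where the register is `0`.
  let I : ℕ → MState → ℕ → Prop := fun i σ' T => SmallState X σ' ∧ σ'.reg 6 = i ∧
    σ'.reg 0 = n ∧ σ'.mem = σ.mem ∧ σ'.reg 1 = min s (i - 1) ∧ T ≤ i * 15
  have step : ∀ i < n + 1, ∀ σ₁ T, I i σ₁ T → ∃ T' σ', Runs w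
      (.cond (.ltE (.var 6 * .var 6 * .var 6) (.var 0 + 1)) (.assign 1 (.var 6)) .skip) σ₁ T' σ' ∧
      SmallState X σ' ∧ σ'.reg 6 = i ∧ I (i + 1) (σ'.setReg 6 (i + 1)) (T + T') := by
    rintro i hi σ₁ T ⟨hs₁, h6, h0', hm, h1', hT⟩
    have hev : (RamExpr.ltE (.var 6 * .var 6 * .var 6) (.var 0 + 1)).eval σ₁ =
        if i * i * i < n + 1 then 1 else 0 := by
      simp [h6, h0']
    by_cases his : i ≤ s
    · have hc : i * i * i < n + 1 := Nat.lt_succ_of_le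
        ((Nat.mul_le_mul (Nat.mul_le_mul his his) his).trans hle)
      rw [if_pos hc] at hev
      have hr := Runs.assign hX hs₁ 1 (e := .var 6) (by decide) (by simp [h6]; omega)
      have ev : (RamExpr.var 6).eval σ₁ = i := by simp [h6]
      rw [ev] at hr
      have hs₂ : SmallState X (σ₁.setReg 1 i) := hs₁.setReg (by omega)
      refine ⟨_, _, Runs.cond_true hX hs₁ (by decide) (by rw [hev]; norm_num) hr, hs₂,
        by simpa using h6, hs₂.setReg (by omega), by simp, by simpa using h0', hm, ?_, ?_⟩
      · simp; omega
      · have : (RamExpr.var 6).size + 1 +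
          ((RamExpr.ltE (.var 6 * .var 6 * .var 6) (.var 0 + 1)).size + 1) = 12 := rfl
        omega
    · have hc : ¬ i * i * i < n + 1 := by
        have his : s + 1 ≤ i := by omega
        have := Nat.mul_le_mul (Nat.mul_le_mul his his) his
        omega
      rw [if_neg hc] at hev
      refine ⟨_, _, Runs.cond_false hX hs₁ (by decide) hev Runs.skip, hs₁, h6,
        hs₁.setReg (by omega), by simp, by simpa using h0', hm, ?_, ?_⟩
      · simp [h1']; omega
      · have : (RamExpr.ltE (.var 6 * .var 6 * .var 6) (.var 0 + 1)).size = 9 := rfl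
        omega
  obtain ⟨T, σ', hr, hs', -, h0', hm', h1', hT⟩ := Runs.forLoop (σ := σ) (b := n + 1)
    (e := .var 0 + 1) hX (x := 6) (by norm_num) (by decide) I hσ hn
    ⟨hσ.setReg (by omega), by simp, by simpa using h0, rfl, by simp [h1], by omega⟩
    (fun i _ σ' T h => ⟨h.1, h.2.1, by simp [h.2.2.1]⟩) step
  refine ⟨σ', hr.mono ?_, hs', h0', by rw [h1']; omega, hm'⟩
  have : (RamExpr.var 0 + 1).size = 3 := rfl
  rw [this]
  omega

theorem mul_add_inj {d a b a' b' : ℕ} (hb : b < d) (hb' : b' < d) (h : a * d + b = a' * d + b') :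
    a = a' ∧ b = b' := by
  have hd : 0 < d := by omega
  have h1 := congrArg (· / d) h
  have h2 := congrArg (· % d) h
  simp only [add_comm _ b, add_comm _ b', Nat.add_mul_div_right _ _ hd, Nat.div_eq_of_lt hb,
    Nat.div_eq_of_lt hb', zero_add, Nat.add_mul_mod_self_right, Nat.mod_eq_of_lt hb,
    Nat.mod_eq_of_lt hb'] at h1 h2
  exact ⟨h1, h2⟩

theorem runs_copyMatrix (hX : Fits X w) (hσ : SmallState X σ) (h0 : σ.reg 0 = n) (hn : 0 < n)
    (hnX : n * n ≤ X) {M : Matrix (Fin n) (Fin n) Bool}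
    (hin : ∀ k < n * n, σ.mem 0 (k + 1) = (padMatrix M (k / n) (k % n)).toNat)
    (h3 : ∀ j, σ.mem 3 j = 0) :
    ∃ σ', Runs w MatchingAlg.copyMatrix σ ((n * n + 1) * 40) σ' ∧ SmallState X σ' ∧
      (∀ r < 6, σ'.reg r = σ.reg r) ∧ (∀ a ≠ 3, σ'.mem a = σ.mem a) ∧
      HasMatrix n (padMatrix M) σ'.mem := by
  obtain ⟨σ', hr, hs', hreg, hm, ho⟩ := Runs.fill hX hσ (a := 3) (b := n * n) hnX
    (e := .var 0 * .var 0) (ec := 1) (ea := .var 6 / .var 0 * (2 * .var 0) + .var 6 % .var 0)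
    (ev := .rd 0 (.var 6 + 1)) (by decide) (by decide) (by decide) (by decide)
    (C := fun _ => True) (addr := fun i => i / n * (2 * n) + i % n)
    (val := fun i => σ.mem 0 (i + 1)) (fun i _ _ => hσ.mem 0 (by norm_num) _) (by
      intro i _ σ' hreg hmem h6
      have h0' : σ'.reg 0 = n := by rw [hreg 0 (by norm_num) (by norm_num), h0]
      exact ⟨by simp [h0'], fun _ => ⟨by simp, fun _ => ⟨by simp [h6, h0'], by
        simp [h6, hmem 0]⟩⟩⟩)
  refine ⟨σ', hr.mono (Nat.mul_le_mul_left _ (by decide)), hs',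
    fun r hr => hreg r (by omega) (by omega), hm, fun i hi j hj => ?_⟩
  have hmod : ∀ e, e % n < 2 * n := fun e => (Nat.mod_lt e hn).trans (by omega)
  rcases ho (i * (2 * n) + j) with ⟨e, he, -, hea, hv⟩ | ⟨h, hv⟩
  · obtain ⟨rfl, rfl⟩ := mul_add_inj (hmod e) hj hea
    rw [hv, hin e he]
  · rw [hv, h3]
    -- A cell without a copied entry lies in the padding, where memory is still zero.
    by_cases hij : i < n ∧ j < n
    · refine absurd ?_ (h (i * n + j) ?_ trivial)
      · simp only [add_comm _ j, Nat.add_mul_div_right _ _ hn, Nat.div_eq_of_lt hij.2, zero_add,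
          Nat.add_mul_mod_self_right, Nat.mod_eq_of_lt hij.2]
      · have := Nat.mul_le_mul_right n (Nat.succ_le_of_lt hij.1)
        rw [Nat.succ_mul] at this
        omega
    · simp [padMatrix, hij]

theorem runs_windowLength (hX : Fits X w) (hσ : SmallState X σ) (h1 : σ.reg 1 = s) (hs : 0 < s) :
    ∀ c, (8 * s) ^ c ≤ X →
      Runs w (MatchingAlg.windowLength c) σ (c * 10 + 10) (σ.setReg 3 ((8 * s) ^ c))
  | 0, h => (Runs.assign hX hσ 3 (e := 1) (by decide) (by simpa using h)).mono (by decide)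
  | c + 1, h => by
    have hle : (8 * s) ^ c ≤ X := (Nat.pow_le_pow_right (by omega) (Nat.le_succ c)).trans h
    have hr := runs_windowLength hX hσ h1 hs c hle
    have hs₁ : SmallState X (σ.setReg 3 ((8 * s) ^ c)) := hσ.setReg hle
    have ev : (RamExpr.var 3 * (8 * .var 1)).eval (σ.setReg 3 ((8 * s) ^ c)) =
        (8 * s) ^ (c + 1) := by
      simp [h1, pow_succ]
    have hr' := Runs.assign hX hs₁ 3 (e := .var 3 * (8 * .var 1)) (by decide) (by rwa [ev])
    rw [ev] at hr'
    have e : (σ.setReg 3 ((8 * s) ^ c)).setReg 3 ((8 * s) ^ (c + 1)) =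
        σ.setReg 3 ((8 * s) ^ (c + 1)) := by
      simp [MState.setReg]
    rw [e] at hr'
    refine (hr.seq hr').mono ?_
    have : (RamExpr.var 3 * (8 * .var 1)).size = 5 := rfl
    omega

/-- Instances are created from left to right. All guest cells to the right of the windows used so
far are zero, so the next instance finds the memory that its setup routine expects. -/
theorem runs_startInstances (H : Host A S w X w' st s t₀ m₀ cst upd qry) (L : Layout n s st X)
    (hσ : SmallState X σ) (h0 : σ.reg 0 = n) (h1 : σ.reg 1 = s) (h3 : σ.reg 3 = st)
    (hM : HasMatrix n Mx σ.mem) (hz : ∀ a, 5 ≤ a → ∀ j, σ.mem a j = 0) :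
    ∃ T σ' τ, Runs w (A.startInstances S) σ T σ' ∧ SmallState X σ' ∧
      (∀ r < 4, σ'.reg r = σ.reg r) ∧ (∀ a < 5, σ'.mem a = σ.mem a) ∧
      Instances A S w' st n s t₀ m₀ Mx (blocks n s * blocks n s * blocks n s) (fun _ => 0)
        σ'.mem τ ∧
      T ≤ 43 * A.overhead * (s * s * (blocks n s * blocks n s * blocks n s)) +
        2 * ∑ id ∈ Finset.range (blocks n s * blocks n s * blocks n s), τ id := by
  have hs := L.pos
  have hB := blocks_pos (n := n) (s := s)
  set B := blocks n s with hBdef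
  have hoh : 1000 ≤ A.overhead := by simp only [MatchingAlg.overhead]; omega
  let I : ℕ → MState → ℕ → Prop := fun k σ' T => SmallState X σ' ∧ σ'.reg 4 = k ∧
    (∀ r < 4, σ'.reg r = σ.reg r) ∧ (∀ a < 5, σ'.mem a = σ.mem a) ∧
    (∀ a, 5 ≤ a → ∀ j, k * st ≤ j → σ'.mem a j = 0) ∧
    ∃ τ, Instances A S w' st n s t₀ m₀ Mx k (fun _ => 0) σ'.mem τ ∧
      T ≤ 41 * A.overhead * (s * s) * k + 2 * ∑ id ∈ Finset.range k, τ id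
  have step : ∀ k < B * B * B, ∀ σ₁ T, I k σ₁ T → ∃ T' σ',
      Runs w (.seq (.assign 5 (.var 4 * .var 3)) (A.start (startE S))) σ₁ T' σ' ∧
      SmallState X σ' ∧ σ'.reg 4 = k ∧ I (k + 1) (σ'.setReg 4 (k + 1)) (T + T') := by
    rintro k hk σ₁ T ⟨hs₁, h4, hreg, hmem, hz₁, τ, hK, hT⟩
    have hwin := L.window_le hk
    have ev : (RamExpr.var 4 * .var 3).eval σ₁ = k * st := by
      simp [h4, hreg 3, h3]
    have hr₂ := Runs.assign H.fits hs₁ 5 (e := .var 4 * .var 3) (by decide) (by rw [ev]; omega)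
    rw [ev] at hr₂
    have hs₂ : SmallState X (σ₁.setReg 5 (k * st)) := hs₁.setReg (by omega)
    have hreg₂ : ∀ r ≠ 5, (σ₁.setReg 5 (k * st)).reg r = σ₁.reg r := fun r hr => by simp [hr]
    -- `runs_start` speaks of vertex numbers, the gadget of class and index; a coordinate function
    -- is fixed to translate.
    obtain ⟨c, i, hci⟩ : ∃ c : Fin (4 * s) → Fin 4, ∃ i : Fin (4 * s) → Fin s,
        ∀ p, p = vtx (c p) (i p) := by
      choose c i h using (exists_vtx (s := s))
      exact ⟨c, i, h⟩
    obtain ⟨T₃, σ₃, D, τ₃, hr₃, hg₃, hI₃, hD₃, hT₃⟩ := runs_start H hs₂ (base := k * st) (by simp)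
      hwin (fun a j _ => hz₁ (a + 5) (by omega) (k * st + j) (by omega))
      (by simpa using (hreg 1 (by norm_num)).trans h1) (startE_ok S).1 (startE_ok S).2
      (P := fun p r => S.IsStartEdge (blockOf Mx n s k) (c p) (i p) (c r) (i r)) (by
        intro p r σ' hr' hm' h6
        refine startE_eval S L.le_dim (n := n) ?_ ?_ ?_ ?_ ?_
        · intro x hx y hy
          rw [hm' 3 (by norm_num), MState.setReg_mem, hmem 3 (by norm_num)]
          exact hM x hx y hy
        · rw [hr' 0 (by norm_num), hreg₂ 0 (by norm_num), hreg 0 (by norm_num), h0]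
        · rw [hr' 1 (by norm_num), hreg₂ 1 (by norm_num), hreg 1 (by norm_num), h1]
        · rw [hr' 4 (by norm_num), hreg₂ 4 (by norm_num), h4]
        · rw [← hci, ← hci]; exact h6)
    have hps : PhaseState S (blockOf Mx n s k) 0 D := .start fun c₁ i₁ c₂ i₂ => by
      have h₁ := hci (vtx c₁ i₁)
      have h₂ := hci (vtx c₂ i₂)
      rw [vtx_inj] at h₁ h₂
      rw [hD₃, ← h₁.1, ← h₁.2, ← h₂.1, ← h₂.2]
    have hinst := hK.update (K' := k + 1) (fun id' h h' => by omega) hg₃.frame hI₃ hps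
    refine ⟨_, σ₃, hr₂.seq hr₃, hg₃.small, ?_, hg₃.small.setReg
      ((Nat.succ_le_of_lt hk).trans L.blocks_cube_le), by simp, fun r hr => ?_, fun a ha => ?_,
      fun a ha j hj => ?_, _, hinst.congr (fun id _ => ?_) (fun _ _ => rfl), ?_⟩
    · rw [hg₃.reg 4 (by norm_num), hreg₂ 4 (by norm_num), h4]
    · rw [MState.setReg_reg, Function.update_of_ne (by omega), hg₃.reg r (by omega),
        hreg₂ r (by omega), hreg r hr]
    · rw [MState.setReg_mem, hg₃.frame.data ha, MState.setReg_mem, hmem a ha]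
    · rw [Nat.succ_mul] at hj
      rw [MState.setReg_mem, hg₃.frame a j (.inr (.inr hj)), MState.setReg_mem]
      exact hz₁ a ha j (by omega)
    · simp only [Function.update_apply]
      split_ifs <;> rfl
    · have hsum : ∑ id ∈ Finset.range k, Function.update τ k τ₃ id =
          ∑ id ∈ Finset.range k, τ id := Finset.sum_congr rfl fun id hid => by
        rw [Function.update_of_ne (Finset.mem_range.1 hid).ne]
      rw [Finset.sum_range_succ, Function.update_self, hsum]
      have e1 : (RamExpr.var 4 * .var 3).size = 3 := rfl
      have h1 : A.overhead * 1 ≤ A.overhead * (s * s) :=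
        Nat.mul_le_mul_left _ (Nat.mul_pos hs hs)
      have h2 : 41 * A.overhead * (s * s) * (k + 1) = 41 * A.overhead * (s * s) * k +
        (40 * A.overhead * (s * s) + A.overhead * (s * s)) := by ring
      omega
  obtain ⟨T, σ', hr, hs', -, hreg, hmem, -, τ, hK, hT⟩ := Runs.forLoop (σ := σ)
    (b := B * B * B) (e := blocksE * blocksE * blocksE) H.fits (x := 4) (by norm_num) (by decide)
    I hσ L.blocks_cube_le
    ⟨hσ.setReg (by omega), by simp, fun r hr => by
      rw [MState.setReg_reg, Function.update_of_ne (by omega)], fun _ _ => rfl,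
      fun a ha j _ => hz a ha j, fun _ => 0, fun id hid => by omega, by omega⟩
    (fun k _ σ' T h => ⟨h.1, h.2.1, by
      rw [RamExpr.eval_mul, RamExpr.eval_mul, blocksE_eval ((h.2.2.1 0 (by norm_num)).trans h0)
        ((h.2.2.1 1 (by norm_num)).trans h1)]⟩) step
  refine ⟨_, σ', τ, hr, hs', hreg, hmem, hK, ?_⟩
  have e1 : (blocksE * blocksE * blocksE).size = 17 := rfl
  rw [e1]
  have hss : 1 ≤ s * s := Nat.mul_pos hs hs
  have hB1 : 1 ≤ B * B * B := Nat.mul_pos (Nat.mul_pos hB hB) hB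
  generalize A.overhead = o at *
  generalize B * B * B = Q at *
  have h1 : Q ≤ s * s * Q := Nat.le_mul_of_pos_left _ hss
  have h2 : 1000 * (s * s * Q) ≤ o * (s * s * Q) := Nat.mul_le_mul_right _ hoh
  have h3 : 41 * o * (s * s) * Q = 41 * (o * (s * s * Q)) := by ring
  have h4 : 43 * o * (s * s * Q) = 43 * (o * (s * s * Q)) := by ring
  rw [h3] at hT
  rw [h4]
  omega

theorem ready_setup (H : Host A S w X w' st s t₀ m₀ cst upd qry) (L : Layout n s st X)
    (hlt : n < (s + 1) * (s + 1) * (s + 1)) {c : ℕ} (hst : st = (8 * s) ^ c)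
    (M : Matrix (Fin n) (Fin n) Bool) :
    ∃ T mem τ, Call w (A.omvSetup S c) (encodeMatrix M) Memory.zero T mem ∧
      Ready A S w' st n s t₀ m₀ X (padMatrix M) 0 mem τ ∧
      T ≤ (50 * A.overhead + 10 * c) *
          (n * n + s * s * (blocks n s * blocks n s * blocks n s)) +
        2 * ∑ id ∈ Finset.range (blocks n s * blocks n s * blocks n s), τ id := by
  have hX := H.fits
  have hn := L.dim_pos
  have hs := L.pos
  have hoh : 1000 ≤ A.overhead := by simp only [MatchingAlg.overhead]; omega
  have hin : ∀ j, (Memory.zero.withInput (encodeMatrix M)) 0 j = (encodeMatrix M).getD j 0 :=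
    fun j => by simp [Memory.withInput, Memory.zero]
  have hother : ∀ a ≠ 0, ∀ j, (Memory.zero.withInput (encodeMatrix M)) a j = 0 := fun a ha j => by
    simp [Memory.withInput, Memory.zero, ha]
  have hbool : ∀ b : Bool, b.toNat ≤ 1 := by decide
  let σ : MState := ⟨fun _ => 0, Memory.zero.withInput (encodeMatrix M)⟩
  have hnX : n ≤ X := L.le_of_dim (by omega)
  have hσ : SmallState X σ := by
    refine ⟨fun _ _ => Nat.zero_le _, fun a ha j => ?_⟩
    by_cases h : a = 0
    · subst h
      change (Memory.zero.withInput (encodeMatrix M)) 0 j ≤ X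
      rw [hin, encodeMatrix_getD]
      split_ifs
      · exact hnX
      · exact (hbool _).trans (by omega)
      · exact Nat.zero_le _
    · change (Memory.zero.withInput (encodeMatrix M)) a j ≤ X
      rw [hother a h]
      exact Nat.zero_le _
  have ev₁ : (RamExpr.rd 0 0).eval σ = n := by
    change (Memory.zero.withInput (encodeMatrix M)) 0 0 = n
    rw [hin, encodeMatrix_getD, if_pos rfl]
  have hr₁ := Runs.assign hX hσ 0 (e := .rd 0 0) (by decide) (by rwa [ev₁])
  rw [ev₁] at hr₁
  obtain ⟨σ₂, hr₂, hs₂, h0₂, h1₂, hm₂⟩ := runs_findBlockSize hX (hσ.setReg (x := 0) hnX)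
    (n := n) (s := s) (by simp) (by simp [σ]) L.le_dim L.cube_le hlt (L.le_of_dim (by omega))
  obtain ⟨σ₃, hr₃, hs₃, hreg₃, hm₃, hM₃⟩ := runs_copyMatrix hX hs₂ h0₂ hn
    (L.le_of_sq (by nlinarith)) (M := M)
    (fun k hk => by
      rw [hm₂]
      change (Memory.zero.withInput (encodeMatrix M)) 0 (k + 1) = _
      rw [hin, encodeMatrix_getD, if_neg (Nat.succ_ne_zero k), Nat.add_sub_cancel, if_pos hk])
    (fun j => by rw [hm₂]; exact hother 3 (by norm_num) j)
  have hstX : st ≤ X := (Nat.le_mul_of_pos_left _ (Nat.mul_pos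
    (Nat.mul_pos blocks_pos blocks_pos) blocks_pos)).trans L.windows
  have hr₄ := runs_windowLength hX hs₃ ((hreg₃ 1 (by norm_num)).trans h1₂) hs c (hst ▸ hstX)
  rw [← hst] at hr₄
  have hzero : ∀ a, a ≠ 0 → a ≠ 3 → ∀ j, σ₃.mem a j = 0 := fun a h h' j => by
    rw [hm₃ a h', hm₂]
    exact hother a h j
  obtain ⟨T₅, σ₅, τ, hr₅, hs₅, hreg₅, hm₅, hK₅, hT₅⟩ := runs_startInstances H L
    (hs₃.setReg (x := 3) hstX) (Mx := padMatrix M)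
    (by simpa using (hreg₃ 0 (by norm_num)).trans h0₂)
    (by simpa using (hreg₃ 1 (by norm_num)).trans h1₂) (by simp) hM₃
    (fun a ha j => hzero a (by omega) (by omega) j)
  have h0₅ : σ₅.reg 0 = n := by
    rw [hreg₅ 0 (by norm_num)]; simpa using (hreg₃ 0 (by norm_num)).trans h0₂
  have h1₅ : σ₅.reg 1 = s := by
    rw [hreg₅ 1 (by norm_num)]; simpa using (hreg₃ 1 (by norm_num)).trans h1₂
  have h3₅ : σ₅.reg 3 = st := by rw [hreg₅ 3 (by norm_num)]; simp
  have hr₆ := Runs.write hX hs₅ 2 (e₁ := 0) (e₂ := .var 0) (by decide) (by decide)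
  have ev : ∀ σ' : MState, (RamExpr.var 0).eval σ' = σ'.reg 0 ∧
    (RamExpr.var 1).eval σ' = σ'.reg 1 ∧ (RamExpr.var 3).eval σ' = σ'.reg 3 ∧
    (0 : RamExpr).eval σ' = 0 ∧ (1 : RamExpr).eval σ' = 1 ∧ (3 : RamExpr).eval σ' = 3 :=
    fun _ => ⟨rfl, rfl, rfl, rfl, rfl, rfl⟩
  rw [(ev _).1, (ev _).2.2.2.1, h0₅] at hr₆
  have hs₆ : SmallState X (σ₅.setCell 2 0 n) := hs₅.setCell hnX
  have hr₇ := Runs.write hX hs₆ 2 (e₁ := 1) (e₂ := .var 1) (by decide) (by decide)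
  rw [(ev _).2.1, (ev _).2.2.2.2.1, MState.setCell_reg, h1₅] at hr₇
  have hs₇ : SmallState X ((σ₅.setCell 2 0 n).setCell 2 1 s) :=
    hs₆.setCell (L.le_dim.trans hnX)
  have hr₈ := Runs.write hX hs₇ 2 (e₁ := 3) (e₂ := .var 3) (by decide) (by decide)
  rw [(ev _).2.2.1, (ev _).2.2.2.2.2, MState.setCell_reg, MState.setCell_reg, h3₅] at hr₈
  have hs₈ : SmallState X (((σ₅.setCell 2 0 n).setCell 2 1 s).setCell 2 3 st) :=
    hs₇.setCell hstX
  have hm₈ : ∀ a ≠ 2, (((σ₅.setCell 2 0 n).setCell 2 1 s).setCell 2 3 st).mem a = σ₅.mem a := by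
    intro a ha
    simp only [MState.setCell_mem, Function.update_of_ne ha]
  have hz₅ : ∀ a < 5, a ≠ 0 → a ≠ 3 → ∀ j, σ₅.mem a j = 0 := fun a ha h h' j => by
    rw [hm₅ a ha]; exact hzero a h h' j
  obtain ⟨T, hT, z, hx, hz⟩ := (hr₁.seq (hr₂.seq (hr₃.seq (hr₄.seq (hr₅.seq
    (hr₆.seq (hr₇.seq hr₈))))))) σ ⟨rfl, fun _ _ => rfl⟩
  refine ⟨T, z.mem, τ, ⟨z.reg, hx⟩, ?_, ?_⟩
  · rw [hz.mem]
    refine ⟨by simp [MState.setCell_mem_apply], by simp [MState.setCell_mem_apply], ?_,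
      by simp [MState.setCell_mem_apply], fun i hi j hj => ?_, fun j _ => ?_, fun j => ?_, hs₈.mem,
      hK₅.congr (fun _ _ => phasesDone_zero) fun a ha => hm₈ a (by omega)⟩
    · simp [MState.setCell_mem_apply, hz₅ 2]
    · rw [hm₈ 3 (by norm_num), hm₅ 3 (by norm_num)]
      exact hM₃ i hi j hj
    · rw [hm₈ 4 (by norm_num)]
      exact hz₅ 4 (by norm_num) (by norm_num) (by norm_num) j
    · rw [hm₈ 1 (by norm_num), hz₅ 1 (by norm_num) (by norm_num) (by norm_num)]
      exact Nat.zero_le _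
  · have e1 : (RamExpr.rd 0 0).size + 1 = 3 := rfl
    have e2 : (0 : RamExpr).size + (RamExpr.var 0).size + 1 = 3 := rfl
    have e3 : (1 : RamExpr).size + (RamExpr.var 1).size + 1 = 3 := rfl
    have e4 : (3 : RamExpr).size + (RamExpr.var 3).size + 1 = 3 := rfl
    rw [e1, e2, e3, e4] at hT
    have hnn : n ≤ n * n := Nat.le_mul_of_pos_left _ hn
    generalize A.overhead = o at *
    generalize s * s * (blocks n s * blocks n s * blocks n s) = Q at *
    have h1 : (50 * o + 10 * c) * (n * n + Q) =
      50 * (o * (n * n)) + 10 * (c * (n * n)) + 50 * (o * Q) + 10 * (c * Q) := by ring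
    have h2 : 1000 * (n * n) ≤ o * (n * n) := Nat.mul_le_mul_right _ hoh
    have h3 : c * 1 ≤ c * (n * n) := Nat.mul_le_mul_left _ (hn.trans_le hnn)
    have h4 : 43 * o * Q = 43 * (o * Q) := by ring
    rw [h4] at hT₅
    rw [h1]
    omega

end

/-! ### The total running time on one input. -/

section
variable {A : MatchingAlg} {S : Setting} {w X w' st n s t₀ t : ℕ} {m₀ mem : Memory}
  {cst upd qry : ℝ} {τ : ℕ → ℕ}

/-- From a ready memory state all remaining vectors are answered. -/
theorem ready_answers (H : Host A S w X w' st s t₀ m₀ cst upd qry) (L : Layout n s st X) (c : ℕ)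
    {M : Matrix (Fin n) (Fin n) Bool} (vs : List (Fin n → Bool)) (ht : t + vs.length ≤ n)
    (hR : Ready A S w' st n s t₀ m₀ X (padMatrix M) t mem τ) :
    ∃ T mem' τ', (A.omvAlg S c).Answers w M mem vs T ∧
      Ready A S w' st n s t₀ m₀ X (padMatrix M) (t + vs.length) mem' τ' ∧
      T + 2 * ∑ id ∈ Finset.range (blocks n s * blocks n s * blocks n s), τ id ≤
        vs.length * (25 * A.overhead * (s * (blocks n s * blocks n s) + s * s * n)) +
        2 * ∑ id ∈ Finset.range (blocks n s * blocks n s * blocks n s), τ' id := by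
  induction vs generalizing t mem τ with
  | nil => exact ⟨0, mem, τ, rfl, hR, by simp⟩
  | cons v vs ih =>
    rw [List.length_cons] at ht
    obtain ⟨T₁, mem₁, τ₁, hc, hans, hR₁, hT₁⟩ := ready_multiply H L v (by omega) hR
    obtain ⟨T₂, mem₂, τ₂, hA, hR₂, hT₂⟩ := ih (t := t + 1) (by omega) hR₁
    refine ⟨_, mem₂, τ₂, ⟨T₁, mem₁, T₂, hc, hans, hA, rfl⟩, ?_, ?_⟩
    · rwa [List.length_cons, add_comm vs.length, ← add_assoc]
    · rw [List.length_cons, add_one_mul]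
      omega

/-- An instance has touched at most all `(4 s)²` pairs of vertices and has answered at most `s`
queries, one per phase of its epoch. -/
theorem Ready.time_le {Mx : ℕ → ℕ → Bool}
    (hR : Ready A S w' st n s t₀ m₀ X Mx t mem τ)
    (hA : Server A S w' (4 * s) t₀ m₀ cst upd qry) (hu : 0 ≤ upd) (hq : 0 ≤ qry) {id : ℕ}
    (hid : id < blocks n s * blocks n s * blocks n s) :
    (τ id : ℝ) ≤ cst + (4 * s) * (4 * s) * upd + s * qry := by
  obtain ⟨D, ⟨m, -, hm⟩, -⟩ := hR.inst id hid
  refine (hm.time_le hA).trans ?_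
  have h1 : (D.card : ℝ) ≤ (4 * s) * (4 * s) := by
    have := Finset.card_le_univ D
    rw [Fintype.card_prod, Fintype.card_fin] at this
    exact_mod_cast this
  have h2 : (phasesDone s t (id / (blocks n s * blocks n s)) : ℝ) ≤ s := by
    exact_mod_cast phasesDone_le
  gcongr

/-- The running time of the OMv algorithm on one input. -/
theorem omvAlg_run (H : Host A S w X w' st s t₀ m₀ cst upd qry) (L : Layout n s st X)
    (hlt : n < (s + 1) * (s + 1) * (s + 1)) {c : ℕ} (hst : st = (8 * s) ^ c)
    (hu : 0 ≤ upd) (hq : 0 ≤ qry) (M : Matrix (Fin n) (Fin n) Bool) (vs : List (Fin n → Bool))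
    (hvs : vs.length = n) :
    ∃ t m T, Call w (A.omvAlg S c).setup (encodeMatrix M) Memory.zero t m ∧
      (A.omvAlg S c).Answers w M m vs T ∧
      (t + T : ℝ) ≤ (50 * A.overhead + 10 * c : ℕ) *
          (n * n + s * s * (blocks n s * blocks n s * blocks n s) +
            n * (s * (blocks n s * blocks n s) + s * s * n)) +
        2 * ((blocks n s * blocks n s * blocks n s) *
          (cst + (4 * s) * (4 * s) * upd + s * qry)) := by
  obtain ⟨T₁, mem₁, τ₁, hc, hR₁, hT₁⟩ := ready_setup H L hlt hst M
  obtain ⟨T₂, mem₂, τ₂, hA, hR₂, hT₂⟩ := ready_answers H L c vs (t := 0) (by omega) hR₁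
  refine ⟨T₁, mem₁, T₂, hc, hA, ?_⟩
  -- The telescoped host bounds leave twice the total guest time at the end, to which the bound for
  -- one instance is applied `blocks n s ^ 3` times.
  have hsum : (∑ id ∈ Finset.range (blocks n s * blocks n s * blocks n s), (τ₂ id : ℝ)) ≤
      (blocks n s * blocks n s * blocks n s) * (cst + (4 * s) * (4 * s) * upd + s * qry) := by
    have := Finset.sum_le_card_nsmul
      (Finset.range (blocks n s * blocks n s * blocks n s)) (fun id => (τ₂ id : ℝ)) _
      fun id hid => hR₂.time_le H.server hu hq (Finset.mem_range.1 hid)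
    simpa [mul_add] using this
  rw [hvs] at hT₂
  have hN : T₁ + T₂ ≤ (50 * A.overhead + 10 * c) *
        (n * n + s * s * (blocks n s * blocks n s * blocks n s) +
          n * (s * (blocks n s * blocks n s) + s * s * n)) +
      2 * ∑ id ∈ Finset.range (blocks n s * blocks n s * blocks n s), τ₂ id := by
    have h : n * (25 * A.overhead * (s * (blocks n s * blocks n s) + s * s * n)) ≤
        (50 * A.overhead + 10 * c) * (n * (s * (blocks n s * blocks n s) + s * s * n)) := by
      rw [mul_left_comm]
      gcongr
      omega
    rw [mul_add (50 * A.overhead + 10 * c)]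
    omega
  have hN' := (Nat.cast_le (α := ℝ)).2 hN
  push_cast at hN' ⊢
  linarith

end

/-! ### Parameters -/

theorem exists_cube_root {n : ℕ} (hn : 1 ≤ n) :
    ∃ s, 0 < s ∧ s * s * s ≤ n ∧ n < (s + 1) * (s + 1) * (s + 1) := by
  let P : ℕ → Prop := fun s => s * s * s ≤ n
  have h1 : P 1 := by simpa [P] using hn
  have hpos : 1 ≤ Nat.findGreatest P n := Nat.le_findGreatest hn h1
  refine ⟨Nat.findGreatest P n, hpos, Nat.findGreatest_spec (P := P) hn h1, ?_⟩
  by_contra! h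
  -- A number whose cube is at most `n` is itself in the range of the search, so a successor with
  -- this property would contradict maximality.
  have hle : Nat.findGreatest P n + 1 ≤ n := by
    refine le_trans ?_ h
    rw [mul_assoc]
    exact Nat.le_mul_of_pos_right _ (by positivity)
  have := Nat.le_findGreatest (P := P) hle h
  omega

theorem le_of_cube_le {n s : ℕ} (h : s * s * s ≤ n) : s ≤ n := by
  rcases s.eq_zero_or_pos with rfl | hs
  · exact n.zero_le
  · rw [mul_assoc] at h
    exact (Nat.le_mul_of_pos_right s (Nat.mul_pos hs hs)).trans h

/-- Words of `O(log N)` bits address polynomially many cells. For `N = 4 s` the bound is the window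
length `(8 s) ^ c`, which the program can compute. -/
theorem two_pow_wordSize_le {c N : ℕ} (hN : N ≠ 0) : 2 ^ wordSize c N ≤ (2 * N) ^ c := by
  rw [wordSize, mul_comm, pow_mul, pow_succ, mul_comm]
  gcongr
  exact Nat.pow_log_le_self 2 hN

theorem pow_le_two_pow_wordSize (c n : ℕ) : (n + 1) ^ c ≤ 2 ^ wordSize c n := by
  rw [wordSize, mul_comm, pow_mul]
  gcongr
  exact Nat.lt_pow_succ_log_self (by norm_num) n

theorem eight_mul_pow_le {n s : ℕ} (hn : 1 ≤ n) (hs : s ≤ n) (c : ℕ) :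
    (8 * s) ^ c ≤ (n + 1) ^ (4 * c) := by
  rw [pow_mul]
  gcongr
  calc 8 * s ≤ 2 ^ 3 * (n + 1) := by omega
    _ ≤ (n + 1) ^ 3 * (n + 1) := by gcongr; omega
    _ = (n + 1) ^ 4 := by ring

theorem sixteen_mul_le_pow {n k : ℕ} (hn : 1 ≤ n) : 16 * k * k ≤ (n + 1) ^ 4 * (k * k) := by
  rw [mul_assoc]
  gcongr
  calc 16 = 2 ^ 4 := rfl
    _ ≤ (n + 1) ^ 4 := by gcongr; omega

theorem sixteen_mul_sq_le {n k : ℕ} (hn : 1 ≤ n) (hk : k ≤ n) (c : ℕ) :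
    16 * k * k ≤ (n + 1) ^ (4 * c + 6) := by
  calc 16 * k * k ≤ (n + 1) ^ 4 * (k * k) := sixteen_mul_le_pow hn
    _ ≤ (n + 1) ^ 4 * ((n + 1) * (n + 1)) := by gcongr <;> omega
    _ = (n + 1) ^ 6 := by ring
    _ ≤ (n + 1) ^ (4 * c + 6) := Nat.pow_le_pow_right (by omega) (by omega)

/-- A window is at most `(n + 1) ^ (4 c)` long and there are at most `(n + 1) ^ 3` of them; the
exponent `4 c + 6` also leaves room for `16 n²`. -/
theorem layout_of_cube_root {n s : ℕ} (hn : 1 ≤ n) (hs : 0 < s) (hsn : s * s * s ≤ n) (c : ℕ) :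
    Layout n s ((8 * s) ^ c) ((n + 1) ^ (4 * c + 6)) where
  pos := hs
  st_pos := by positivity
  cube_le := hsn
  sq_le := sixteen_mul_sq_le hn le_rfl c
  windows := by
    have hB : blocks n s ≤ n + 1 := Nat.succ_le_succ (Nat.div_le_self n s)
    have hsn' : s ≤ n := le_of_cube_le hsn
    calc blocks n s * blocks n s * blocks n s * (8 * s) ^ c
        ≤ (n + 1) * (n + 1) * (n + 1) * (n + 1) ^ (4 * c) := by
          have := eight_mul_pow_le hn hsn' c
          gcongr ?_ * ?_ * ?_ * ?_
      _ = (n + 1) ^ (4 * c + 3) := by ring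
      _ ≤ (n + 1) ^ (4 * c + 6) := Nat.pow_le_pow_right (by omega) (by omega)

/-- With `X = (n + 1) ^ (4 c + 6)`, words of the host must exceed `X ^ 200`; the added `1` in the
word size makes the inequality strict. Since `s ≤ n`, guest words are at most `3 c (⌊log₂ n⌋ + 1)`
bits long. -/
theorem host_of_server {A : MatchingAlg} {S : Setting} {n s c t₀ : ℕ} {m₀ : Memory}
    {cst upd qry : ℝ} (hc : 0 < c) (hs : 0 < s) (hsn : s ≤ n)
    (hA : Server A S (wordSize c (4 * s)) (4 * s) t₀ m₀ cst upd qry) :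
    Host A S (wordSize (200 * (4 * c + 6) + 1) n) ((n + 1) ^ (4 * c + 6)) (wordSize c (4 * s))
      ((8 * s) ^ c) s t₀ m₀ cst upd qry where
  fits := by
    refine ⟨?_, ?_⟩
    · simpa using sixteen_mul_sq_le (k := 1) (by omega : 1 ≤ n) (by omega) c
    · refine lt_of_lt_of_le ?_ (pow_le_two_pow_wordSize _ n)
      rw [← pow_mul]
      exact Nat.pow_lt_pow_right (by omega) (by omega)
  le := by
    have h : Nat.log 2 (4 * s) ≤ Nat.log 2 n + 2 := by
      calc Nat.log 2 (4 * s) ≤ Nat.log 2 (n * 2 * 2) := Nat.log_mono_right (by omega)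
        _ = Nat.log 2 n + 2 := by
          rw [Nat.log_mul_base (by norm_num) (by omega), Nat.log_mul_base (by norm_num) (by omega)]
    calc c * (Nat.log 2 (4 * s) + 1) ≤ c * (3 * (Nat.log 2 n + 1)) := by gcongr; omega
      _ = 3 * c * (Nat.log 2 n + 1) := by ring
      _ ≤ _ := by rw [wordSize]; gcongr; omega
  window := by
    refine (two_pow_wordSize_le (by omega)).trans_eq ?_
    ring
  two_le := by
    calc 2 ≤ 8 * s := by omega
      _ ≤ (8 * s) ^ c := Nat.le_self_pow hc.ne' _
  pos := hs
  edges_le := sixteen_mul_sq_le (by omega) hsn c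
  server := hA

/-! ### Running time -/

/-- From `n < (s + 1)³ ≤ (2 s)³` the saving `s ^ ε` is at least a constant times `n ^ (ε / 3)`; the
constant `2 ^ ε` is at most `2` because `ε ≤ 1`. -/
theorem rpow_neg_le_of_lt_cube {n s : ℕ} {ε : ℝ} (hn : 1 ≤ n) (hs : 0 < s)
    (hlt : n < (s + 1) * (s + 1) * (s + 1)) (hε : 0 < ε) (hε1 : ε ≤ 1) :
    (s : ℝ) ^ (-ε) ≤ 2 * (n : ℝ) ^ (-(ε / 3)) := by
  have hs' : (0 : ℝ) < s := by exact_mod_cast hs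
  have hn' : (0 : ℝ) < n := by exact_mod_cast hn
  have h1 : (n : ℝ) ≤ (2 * s) ^ (3 : ℝ) := by
    have : n ≤ (2 * s) ^ 3 := by
      calc n ≤ (s + 1) * (s + 1) * (s + 1) := hlt.le
        _ = (s + 1) ^ 3 := by ring
        _ ≤ (2 * s) ^ 3 := by gcongr; omega
    exact_mod_cast this
  have h2 : (n : ℝ) ^ (ε / 3) ≤ 2 * (s : ℝ) ^ ε := by
    calc (n : ℝ) ^ (ε / 3) ≤ ((2 * s) ^ (3 : ℝ)) ^ (ε / 3) := by gcongr
      _ = (2 * s : ℝ) ^ ε := by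
        rw [← Real.rpow_mul (by positivity)]
        congr 1
        ring
      _ = 2 ^ ε * (s : ℝ) ^ ε := Real.mul_rpow (by norm_num) hs'.le
      _ ≤ 2 ^ (1 : ℝ) * (s : ℝ) ^ ε := by gcongr; norm_num
      _ = 2 * (s : ℝ) ^ ε := by rw [Real.rpow_one]
  rw [Real.rpow_neg hs'.le, Real.rpow_neg hn'.le, ← div_eq_mul_inv, inv_eq_one_div,
    div_le_div_iff₀ (by positivity) (by positivity), one_mul]
  exact h2

/-- The time that one instance on `4 s + 4 s` vertices takes. -/
theorem instance_cost_le {s : ℕ} {ε : ℝ} (hs : 0 < s) (hε : 0 < ε) :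
    ((4 * s : ℕ) : ℝ) ^ (3 - ε) + (4 * s) * (4 * s) * ((4 * s : ℕ) : ℝ) ^ (1 - ε) +
      s * ((4 * s : ℕ) : ℝ) ^ (2 - ε) ≤ 192 * ((s : ℝ) * s * s * (s : ℝ) ^ (-ε)) := by
  have hs' : (0 : ℝ) < s := by exact_mod_cast hs
  push_cast
  have h4 : (0 : ℝ) < 4 * s := by positivity
  have hle : (4 * s : ℝ) ^ (-ε) ≤ (s : ℝ) ^ (-ε) :=
    Real.rpow_le_rpow_of_nonpos hs' (by linarith) (by linarith)
  have e (k : ℕ) : (4 * s : ℝ) ^ ((k : ℝ) - ε) = (4 * s : ℝ) ^ k * (4 * s : ℝ) ^ (-ε) := by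
    rw [sub_eq_add_neg, Real.rpow_add h4, Real.rpow_natCast]
  have e3 := e 3
  have e2 := e 2
  have e1 := e 1
  push_cast at e1 e2 e3
  rw [e1, e2, e3]
  have h0 : 0 ≤ (s : ℝ) * s * s * (4 * s : ℝ) ^ (-ε) := by positivity
  -- Initialization, updates and queries contribute `64 + 64 + 16`.
  calc _ = 144 * ((s : ℝ) * s * s * (4 * s : ℝ) ^ (-ε)) := by ring
    _ ≤ 192 * ((s : ℝ) * s * s * (4 * s : ℝ) ^ (-ε)) := by linarith
    _ ≤ _ := by gcongr

/-- The time spent outside the instances. -/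
theorem host_cost_le {n s : ℕ} {ε : ℝ} (hs : 0 < s) (hsn : s * s * s ≤ n) (hε1 : ε ≤ 1) :
    ((n * n + s * s * (blocks n s * blocks n s * blocks n s) +
      n * (s * (blocks n s * blocks n s) + s * s * n) : ℕ) : ℝ) ≤
      14 * ((n : ℝ) ^ 3 * (s : ℝ) ^ (-ε)) := by
  have hs' : (1 : ℝ) ≤ s := by exact_mod_cast hs
  have hsn' : s ≤ n := le_of_cube_le hsn
  have hB := blocks_mul_le hsn'
  -- After multiplication by `s` every term is a multiple of `n³`: `blocks n s * s ≤ 2 n` handles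
  -- the block terms, and `s³ ≤ n` the naive multiplications. The constants add up to `1 + 8 + 4 +
  -- 1`.
  have hN : (n * n + s * s * (blocks n s * blocks n s * blocks n s) +
      n * (s * (blocks n s * blocks n s) + s * s * n)) * s ≤ 14 * n ^ 3 := by
    calc _ = n * n * s + (blocks n s * s) ^ 3 + n * (blocks n s * s) ^ 2 +
          n * n * (s * s * s) := by ring
      _ ≤ n * n * n + (2 * n) ^ 3 + n * (2 * n) ^ 2 + n * n * n := by gcongr
      _ = 14 * n ^ 3 := by ring
  have hR : ((n * n + s * s * (blocks n s * blocks n s * blocks n s) +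
      n * (s * (blocks n s * blocks n s) + s * s * n) : ℕ) : ℝ) * s ≤ 14 * (n : ℝ) ^ 3 := by
    exact_mod_cast hN
  -- A saving of a full factor `s` is at least a saving of `s ^ ε`, since `ε ≤ 1`.
  have hinv : (s : ℝ)⁻¹ ≤ (s : ℝ) ^ (-ε) := by
    rw [← Real.rpow_neg_one]
    exact Real.rpow_le_rpow_of_exponent_le hs' (by linarith)
  calc _ ≤ 14 * (n : ℝ) ^ 3 * (s : ℝ)⁻¹ := by
        rw [← div_eq_mul_inv, le_div_iff₀ (by linarith)]
        exact hR
    _ ≤ 14 * (n : ℝ) ^ 3 * (s : ℝ) ^ (-ε) := by gcongr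
    _ = _ := by ring

theorem total_cost_le {n s : ℕ} {ε C K : ℝ} (hn : 1 ≤ n) (hs : 0 < s) (hsn : s * s * s ≤ n)
    (hlt : n < (s + 1) * (s + 1) * (s + 1)) (hε : 0 < ε) (hε1 : ε ≤ 1) (hC : 0 ≤ C)
    (hK : 0 ≤ K) :
    K * (n * n + s * s * (blocks n s * blocks n s * blocks n s) +
        n * (s * (blocks n s * blocks n s) + s * s * n)) +
      2 * ((blocks n s * blocks n s * blocks n s) *
        (C * ((4 * s : ℕ) : ℝ) ^ (3 - ε) + (4 * s) * (4 * s) * (C * ((4 * s : ℕ) : ℝ) ^ (1 - ε)) +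
          s * (C * ((4 * s : ℕ) : ℝ) ^ (2 - ε)))) ≤
      (28 * K + 6144 * C) * (n : ℝ) ^ (3 - ε / 3) := by
  have hn' : (0 : ℝ) < n := by exact_mod_cast hn
  have hsn' : s ≤ n := le_of_cube_le hsn
  have hB : (blocks n s * s : ℝ) ≤ 2 * n := by exact_mod_cast blocks_mul_le hsn'
  have h1 := host_cost_le hs hsn hε1
  push_cast at h1
  have h2 := instance_cost_le hs hε
  have h3 := rpow_neg_le_of_lt_cube hn hs hlt hε hε1
  have hpow : (n : ℝ) ^ (3 - ε / 3) = (n : ℝ) ^ 3 * (n : ℝ) ^ (-(ε / 3)) := by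
    rw [sub_eq_add_neg, Real.rpow_add hn']
    norm_cast
  -- The cubic factor `s³` in the cost of an instance cancels against the number of instances,
  -- `(blocks n s * s)³ ≤ 8 n³`; what remains is the saving `s ^ (-ε)`.
  have h4 : ((blocks n s : ℝ) * blocks n s * blocks n s) *
      (192 * ((s : ℝ) * s * s * (s : ℝ) ^ (-ε))) ≤ 1536 * ((n : ℝ) ^ 3 * (s : ℝ) ^ (-ε)) := by
    calc _ = 192 * (blocks n s * s : ℝ) ^ 3 * (s : ℝ) ^ (-ε) := by ring
      _ ≤ 192 * (2 * n : ℝ) ^ 3 * (s : ℝ) ^ (-ε) := by gcongr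
      _ = _ := by ring
  have h5 := (mul_le_mul_of_nonneg_left h2
    (by positivity : (0 : ℝ) ≤ blocks n s * blocks n s * blocks n s)).trans h4
  calc _ = K * (n * n + s * s * (blocks n s * blocks n s * blocks n s) +
        n * (s * (blocks n s * blocks n s) + s * s * n)) +
      2 * C * ((blocks n s * blocks n s * blocks n s) *
        (((4 * s : ℕ) : ℝ) ^ (3 - ε) + (4 * s) * (4 * s) * ((4 * s : ℕ) : ℝ) ^ (1 - ε) +
          s * ((4 * s : ℕ) : ℝ) ^ (2 - ε))) := by ring
    _ ≤ K * (14 * ((n : ℝ) ^ 3 * (s : ℝ) ^ (-ε))) +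
        2 * C * (1536 * ((n : ℝ) ^ 3 * (s : ℝ) ^ (-ε))) := by gcongr
    _ = (14 * K + 3072 * C) * ((n : ℝ) ^ 3 * (s : ℝ) ^ (-ε)) := by ring
    _ ≤ (14 * K + 3072 * C) * ((n : ℝ) ^ 3 * (2 * (n : ℝ) ^ (-(ε / 3)))) := by gcongr
    _ = _ := by rw [hpow]; ring

/-- Amortized bounds may be weakened. -/
theorem MatchingAlg.Solves.mono {A : MatchingAlg} {S : Setting} {ε δ : ℝ} (hδ : δ ≤ ε)
    (h : A.Solves S (fun n => (n : ℝ) ^ (3 - ε)) (fun n => (n : ℝ) ^ (1 - ε))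
      (fun n => (n : ℝ) ^ (2 - ε))) :
    ∃ (c : ℕ) (C : ℝ), 0 < c ∧ 0 ≤ C ∧ ∀ n : ℕ, 1 ≤ n → ∃ (t : ℕ) (m : Memory),
      Server A S (wordSize c n) n t m (C * (n : ℝ) ^ (3 - δ)) (C * (n : ℝ) ^ (1 - δ))
        (C * (n : ℝ) ^ (2 - δ)) := by
  obtain ⟨c, C, hc, h⟩ := h
  -- The given constant need not be nonnegative; monotonicity in the bounds needs one that is.
  refine ⟨c, max C 0, hc, le_max_right _ _, fun n hn => ?_⟩
  obtain ⟨t, m, hcall, hops⟩ := h n hn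
  refine ⟨t, m, hcall, fun ops hl => ?_⟩
  obtain ⟨T, hT, hle⟩ := hops ops hl
  refine ⟨T, hT, hle.trans ?_⟩
  have hn' : (1 : ℝ) ≤ n := by exact_mod_cast hn
  calc C * ((n : ℝ) ^ (3 - ε) + numUpdates ops * (n : ℝ) ^ (1 - ε) +
        numQueries ops * (n : ℝ) ^ (2 - ε))
      ≤ max C 0 * ((n : ℝ) ^ (3 - δ) + numUpdates ops * (n : ℝ) ^ (1 - δ) +
        numQueries ops * (n : ℝ) ^ (2 - δ)) := by
        gcongr
        exact le_max_left _ _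
    _ = _ := by ring

/-- Unless the OMv conjecture is false, there is no incremental and no decremental algorithm for
maximum cardinality bipartite matching with amortized time `O(n ^ (1 - ε))` per update and
`O(n ^ (2 - ε))` per query, even if it may spend `O(n ^ (3 - ε))` on the initial graph. -/
theorem theorem1 (hOMv : OMvConjecture) (S : Setting) (ε : ℝ) (hε : 0 < ε) :
    ¬ ∃ A : MatchingAlg,
      A.Solves S (fun n => (n : ℝ) ^ (3 - ε)) (fun n => (n : ℝ) ^ (1 - ε))
        (fun n => (n : ℝ) ^ (2 - ε)) := by
  rintro ⟨A, hA⟩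
  -- Lowering `ε` to at most `1` weakens the assumed bounds and makes the cost estimates applicable.
  have hδ : 0 < min ε 1 := lt_min hε one_pos
  obtain ⟨c, C, hc, hC, hserver⟩ := hA.mono (min_le_left ε 1)
  refine hOMv (min ε 1 / 3) (by positivity) ⟨A.omvAlg S c, 200 * (4 * c + 6) + 1,
    28 * (50 * A.overhead + 10 * c : ℕ) + 6144 * C, by positivity, fun n hn M vs hvs => ?_⟩
  obtain ⟨s, hs, hsn, hlt⟩ := exists_cube_root hn
  have hsn' : s ≤ n := le_of_cube_le hsn
  -- The instances have `4 s` vertices on each side, so their word size depends on `4 s` rather than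
  -- on `n`.
  obtain ⟨t₀, m₀, hsrv⟩ := hserver (4 * s) (by omega)
  obtain ⟨t, m, T, hcall, hans, hT⟩ := omvAlg_run (host_of_server hc hs hsn' hsrv)
    (layout_of_cube_root hn hs hsn c) hlt rfl (by positivity) (by positivity) M vs hvs
  exact ⟨t, m, T, hcall, hans, hT.trans
    (total_cost_le hn hs hsn hlt hδ (min_le_right ε 1) hC (Nat.cast_nonneg _))⟩
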